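/- Let $K$ be an algebraically closed field of characteristic zero, let $A_n$ be the $n$-th Weyl algebra over $K$ (generators $p_i,q_i$, $1\le i\le n$, with $[p_i,p_j]=[q_i,q_j]=0$ and $[q_i,p_j]=\delta_{ij}$), and identify $A_2$ with $A_1\otimes_K A_1$ in the standard way. For an element $z$ of a unital associative $K$-algebra $A$, let $\mathrm{ad}_z(x)=zx-xz$ and put $$Ev(z)=\{\lambda\in K\mid \exists x\in A\setminus\{0\},\ \mathrm{ad}_z(x)=\lambda x\},\qquad F(z)=\{x\in A\mid \dim_K K[\mathrm{ad}_z](x)<\infty\},$$ $$N(z)=\{x\in A\mid \exists m\ge 0,\ \mathrm{ad}_z^m(x)=0\},\qquad C(z)=\{x\in A\mid \mathrm{ad}_z(x)=0\},\qquad D(z)=\bigoplus_{\lambda\in Ev(z)}\ker(\mathrm{ad}_z-\lambda).$$ The element $z$ is called strictly nilpotent if $Ev(z)=\{0\}$ and $C(z)\subsetneq N(z)=A$; weakly nilpotent if $Ev(z)=\{0\}$ and $C(z)\subsetneq N(z)\subsetneq A$; nilpotent if it is strictly or weakly nilpotent. It is called semisimple if $Ev(z)\supsetneq\{0\}$ and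 $D(z)=F(z)$ (whether $F(z)=A$ or $F(z)\subsetneq A$). Write $z\in\Omega_0'(A)$ if $Ev(z)=\{0\}$ and $C(z)=F(z)\subsetneq A$. Let $z_1,z_2\in A_1\setminus K$. 1. If $z_1$ or $z_2$ is nilpotent in $A_1$, then $z_1\otimes z_2$ is nilpotent in $A_2$, and $z_1\otimes z_2$ is strictly nilpotent if and only if both $z_1$ and $z_2$ are strictly nilpotent. 2. If neither $z_1$ nor $z_2$ is nilpotent, then $z_1\otimes z_2\in\Omega_0'(A_2)$. 3. If $z_1$ or $z_2$ is not nilpotent, then $C(z_1\otimes z_2)=C(z_1)\otimes C(z_2)$, and this algebra is commutative. 4. If both $z_1$ and $z_2$ are semisimple, then $C(z_1\otimes z_2)=K[z_1]\otimes K[z_2]$. -/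

import Mathlib

open scoped TensorProduct

noncomputable section

/-! The Weyl algebras, by generators and relations. -/

/-- The defining relations of the `n`-th Weyl algebra, on the free algebra with generators
`p i = ι (Sum.inl i)` and `q i = ι (Sum.inr i)`: the `p i` commute, the `q i` commute, and
`[q i, p j] = δ i j`. -/
inductive WeylRel (K : Type*) [Field K] (n : ℕ) :
    FreeAlgebra K (Fin n ⊕ Fin n) → FreeAlgebra K (Fin n ⊕ Fin n) → Prop
  | p_comm (i j : Fin n) : WeylRel K n
      (FreeAlgebra.ι K (Sum.inl i) * FreeAlgebra.ι K (Sum.inl j))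
      (FreeAlgebra.ι K (Sum.inl j) * FreeAlgebra.ι K (Sum.inl i))
  | q_comm (i j : Fin n) : WeylRel K n
      (FreeAlgebra.ι K (Sum.inr i) * FreeAlgebra.ι K (Sum.inr j))
      (FreeAlgebra.ι K (Sum.inr j) * FreeAlgebra.ι K (Sum.inr i))
  | q_p (i j : Fin n) : WeylRel K n
      (FreeAlgebra.ι K (Sum.inr i) * FreeAlgebra.ι K (Sum.inl j))
      (FreeAlgebra.ι K (Sum.inl j) * FreeAlgebra.ι K (Sum.inr i) + if i = j then 1 else 0)

/-- The `n`-th Weyl algebra `A_n` over `K`. -/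
def WeylAlgebra (K : Type*) [Field K] (n : ℕ) : Type _ := RingQuot (WeylRel K n)

namespace WeylAlgebra

variable (K : Type*) [Field K] (n : ℕ)

instance : Ring (WeylAlgebra K n) := inferInstanceAs (Ring (RingQuot (WeylRel K n)))

instance : Algebra K (WeylAlgebra K n) := inferInstanceAs (Algebra K (RingQuot (WeylRel K n)))

/-- The quotient map from the free algebra. -/
def mk : FreeAlgebra K (Fin n ⊕ Fin n) →ₐ[K] WeylAlgebra K n := RingQuot.mkAlgHom K (WeylRel K n)

variable {n}

/-- The generator `p i` of the Weyl algebra. -/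
def p (i : Fin n) : WeylAlgebra K n := mk K n (FreeAlgebra.ι K (Sum.inl i))

/-- The generator `q i` of the Weyl algebra. -/
def q (i : Fin n) : WeylAlgebra K n := mk K n (FreeAlgebra.ι K (Sum.inr i))

theorem p_mul_p (i j : Fin n) : p K i * p K j = p K j * p K i := by
  have h := RingQuot.mkAlgHom_rel K (WeylRel.p_comm (K := K) i j)
  rw [map_mul, map_mul] at h
  exact h

theorem q_mul_q (i j : Fin n) : q K i * q K j = q K j * q K i := by
  have h := RingQuot.mkAlgHom_rel K (WeylRel.q_comm (K := K) i j)
  rw [map_mul, map_mul] at h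
  exact h

theorem q_mul_p (i j : Fin n) : q K i * p K j = p K j * q K i + if i = j then 1 else 0 := by
  have h := RingQuot.mkAlgHom_rel K (WeylRel.q_p (K := K) i j)
  have e : RingQuot.mkAlgHom K (WeylRel K n) (if i = j then 1 else 0) = if i = j then 1 else 0 := by
    split_ifs <;> simp
  rw [map_mul, map_add, map_mul, e] at h
  exact h

variable {K}

/-- The universal property of the Weyl algebra. -/
def lift {B : Type*} [Ring B] [Algebra K B] (P Q : Fin n → B)
    (hP : ∀ i j, P i * P j = P j * P i) (hQ : ∀ i j, Q i * Q j = Q j * Q i)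
    (hQP : ∀ i j, Q i * P j = P j * Q i + if i = j then 1 else 0) : WeylAlgebra K n →ₐ[K] B :=
  RingQuot.liftAlgHom K ⟨FreeAlgebra.lift K (Sum.elim P Q), by
    intro x y h
    cases h with
    | p_comm i j => simpa using hP i j
    | q_comm i j => simpa using hQ i j
    | q_p i j =>
      have h := hQP i j
      split_ifs at h ⊢ <;> simpa using h⟩

section lift

variable {B : Type*} [Ring B] [Algebra K B] (P Q : Fin n → B)
    (hP : ∀ i j, P i * P j = P j * P i) (hQ : ∀ i j, Q i * Q j = Q j * Q i)
    (hQP : ∀ i j, Q i * P j = P j * Q i + if i = j then 1 else 0)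

@[simp]
theorem lift_p (i : Fin n) : lift P Q hP hQ hQP (p K i) = P i := by
  have h := RingQuot.liftAlgHom_mkAlgHom_apply K (FreeAlgebra.lift K (Sum.elim P Q))
    (s := WeylRel K n) (by
      intro x y h
      cases h with
      | p_comm i j => simpa using hP i j
      | q_comm i j => simpa using hQ i j
      | q_p i j =>
        have h := hQP i j
        split_ifs at h ⊢ <;> simpa using h) (FreeAlgebra.ι K (Sum.inl i))
  rw [FreeAlgebra.lift_ι_apply] at h
  exact h

@[simp]
theorem lift_q (i : Fin n) : lift P Q hP hQ hQP (q K i) = Q i := by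
  have h := RingQuot.liftAlgHom_mkAlgHom_apply K (FreeAlgebra.lift K (Sum.elim P Q))
    (s := WeylRel K n) (by
      intro x y h
      cases h with
      | p_comm i j => simpa using hP i j
      | q_comm i j => simpa using hQ i j
      | q_p i j =>
        have h := hQP i j
        split_ifs at h ⊢ <;> simpa using h) (FreeAlgebra.ι K (Sum.inr i))
  rw [FreeAlgebra.lift_ι_apply] at h
  exact h

end lift

theorem algHom_ext {B : Type*} [Ring B] [Algebra K B] {f g : WeylAlgebra K n →ₐ[K] B}
    (hp : ∀ i, f (p K i) = g (p K i)) (hq : ∀ i, f (q K i) = g (q K i)) : f = g := by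
  have h : f.comp (mk K n) = g.comp (mk K n) := by
    apply FreeAlgebra.hom_ext
    funext x
    cases x with
    | inl i => exact hp i
    | inr i => exact hq i
  apply AlgHom.ext
  intro x
  obtain ⟨y, rfl⟩ := RingQuot.mkAlgHom_surjective K (WeylRel K n) x
  exact DFunLike.congr_fun h y

/-- A subalgebra that contains the generators is everything. -/
theorem mem_of_gens (S : Subalgebra K (WeylAlgebra K n)) (hp : ∀ i, p K i ∈ S)
    (hq : ∀ i, q K i ∈ S) (x : WeylAlgebra K n) : x ∈ S := by
  obtain ⟨y, rfl⟩ := RingQuot.mkAlgHom_surjective K (WeylRel K n) x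
  have hy : y ∈ Algebra.adjoin K (Set.range (FreeAlgebra.ι K : Fin n ⊕ Fin n → _)) := by
    rw [FreeAlgebra.adjoin_range_ι]; trivial
  have hle : Algebra.adjoin K (Set.range (FreeAlgebra.ι K : Fin n ⊕ Fin n → _)) ≤
      S.comap (mk K n) := by
    rw [Algebra.adjoin_le_iff]
    rintro _ ⟨i, rfl⟩
    cases i with
    | inl i => exact hp i
    | inr i => exact hq i
  exact hle hy

variable (K)

/-- The embedding of `A_1` in `A_2` onto the copy generated by `p k` and `q k`. -/
def incl (k : Fin 2) : WeylAlgebra K 1 →ₐ[K] WeylAlgebra K 2 :=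
  lift (fun _ => p K k) (fun _ => q K k) (fun _ _ => rfl) (fun _ _ => rfl) (fun i j => by
    rw [q_mul_p, if_pos rfl, if_pos (Subsingleton.elim i j)])

@[simp]
theorem incl_p (k : Fin 2) (i : Fin 1) : incl K k (p K i) = p K k := lift_p ..

@[simp]
theorem incl_q (k : Fin 2) (i : Fin 1) : incl K k (q K i) = q K k := lift_q ..

theorem incl_commute (x y : WeylAlgebra K 1) : Commute (incl K 0 x) (incl K 1 y) := by
  have key : ∀ b : WeylAlgebra K 2, (Commute (p K 0) b) → Commute (q K 0) b →
      ∀ x, Commute (incl K 0 x) b := by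
    intro b h1 h2 x
    have := mem_of_gens ((Subalgebra.centralizer K {b}).comap (incl K 0))
      (fun i => by simpa [Subalgebra.mem_centralizer_iff] using h1.symm.eq)
      (fun i => by simpa [Subalgebra.mem_centralizer_iff] using h2.symm.eq) x
    rw [Subalgebra.mem_comap, Subalgebra.mem_centralizer_iff] at this
    exact (this b rfl).symm
  have := mem_of_gens ((Subalgebra.centralizer K {incl K 0 x}).comap (incl K 1))
    (fun i => by
      rw [Subalgebra.mem_comap, Subalgebra.mem_centralizer_iff, incl_p]
      rintro _ rfl
      exact (key _ (p_mul_p K 0 1) (by simpa [Commute, SemiconjBy] using q_mul_p K (0 : Fin 2) 1) x).eq)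
    (fun i => by
      rw [Subalgebra.mem_comap, Subalgebra.mem_centralizer_iff, incl_q]
      rintro _ rfl
      exact (key _ (by simpa [Commute, SemiconjBy] using (q_mul_p K (1 : Fin 2) 0).symm) (q_mul_q K 0 1) x).eq) y
  rw [Subalgebra.mem_comap, Subalgebra.mem_centralizer_iff] at this
  exact this _ rfl

/-- The map `A_1 ⊗ A_1 → A_2`. -/
def tensorHom : WeylAlgebra K 1 ⊗[K] WeylAlgebra K 1 →ₐ[K] WeylAlgebra K 2 :=
  Algebra.TensorProduct.lift (incl K 0) (incl K 1) (incl_commute K)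

/-- The map `A_2 → A_1 ⊗ A_1`. -/
def tensorInv : WeylAlgebra K 2 →ₐ[K] WeylAlgebra K 1 ⊗[K] WeylAlgebra K 1 :=
  lift ![p K 0 ⊗ₜ 1, 1 ⊗ₜ p K 0] ![q K 0 ⊗ₜ 1, 1 ⊗ₜ q K 0]
    (fun i j => by fin_cases i <;> fin_cases j <;> simp)
    (fun i j => by fin_cases i <;> fin_cases j <;> simp)
    (fun i j => by
      fin_cases i <;> fin_cases j <;>
        simp [q_mul_p, TensorProduct.add_tmul, TensorProduct.tmul_add,
          Algebra.TensorProduct.one_def])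

/-- The standard identification `A_1 ⊗ A_1 ≃ A_2`, which sends `p ⊗ 1`, `q ⊗ 1`, `1 ⊗ p`, `1 ⊗ q`
to `p 0`, `q 0`, `p 1`, `q 1`. -/
def tensorEquiv : WeylAlgebra K 1 ⊗[K] WeylAlgebra K 1 ≃ₐ[K] WeylAlgebra K 2 :=
  AlgEquiv.ofAlgHom (tensorHom K) (tensorInv K)
    (by
      apply algHom_ext
      · intro i; fin_cases i <;> simp [tensorHom, tensorInv]
      · intro i; fin_cases i <;> simp [tensorHom, tensorInv])
    (by
      apply Algebra.TensorProduct.ext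
      · apply algHom_ext <;> intro i <;> fin_cases i <;> simp [tensorHom, tensorInv]
      · apply algHom_ext <;> intro i <;> fin_cases i <;> simp [tensorHom, tensorInv])

variable {K}

/-- `z₁ ⊗ z₂` as an element of `A_2`. -/
def tmul (z₁ z₂ : WeylAlgebra K 1) : WeylAlgebra K 2 := tensorEquiv K (z₁ ⊗ₜ[K] z₂)

/-- `B₁ ⊗ B₂` as a subalgebra of `A_2`: the image of the tensor product of two subalgebras. -/
def tensorSubalgebra (B₁ B₂ : Subalgebra K (WeylAlgebra K 1)) : Subalgebra K (WeylAlgebra K 2) :=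
  (Algebra.TensorProduct.map B₁.val B₂.val).range.map (tensorEquiv K).toAlgHom

end WeylAlgebra

/-! Types of elements of an associative algebra `A`, with the commutator as its bracket. -/

namespace ElementType

variable (K : Type*) [Field K] {A : Type*} [Ring A] [Algebra K A]

/-- The inner derivation `ad z`, which maps `x` to `z * x - x * z`. -/
def ad (z : A) : A →ₗ[K] A := LinearMap.mulLeft K z - LinearMap.mulRight K z

theorem ad_apply (z x : A) : ad K z x = z * x - x * z := rfl

/-- `Ev(z)`, the set of eigenvalues of `ad z`. -/
def Ev (z : A) : Set K := {c | ∃ x : A, x ≠ 0 ∧ ad K z x = c • x}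

/-- `F(z)`, the torsion algebra: the `x` for which `K[ad z] x` is finite dimensional. -/
def F (z : A) : Set A :=
  {x | FiniteDimensional K (Submodule.span K (Set.range fun m : ℕ => (ad K z ^ m) x))}

/-- `N(z)`, the nil-algebra. -/
def N (z : A) : Set A := {x | ∃ m : ℕ, (ad K z ^ m) x = 0}

/-- `C(z)`, the centralizer. -/
def C (z : A) : Subalgebra K A := Subalgebra.centralizer K {z}

/-- `D(z)`, the eigenvalue algebra: the sum of the eigenspaces of `ad z`. -/
def D (z : A) : Submodule K A := ⨆ c ∈ Ev K z, Module.End.eigenspace (ad K z) c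

theorem mem_C_iff (z x : A) : x ∈ C K z ↔ ad K z x = 0 := by
  simp [C, Subalgebra.mem_centralizer_iff, ad_apply, sub_eq_zero]

/-- `z ∈ Ω₀'(A)`. -/
def IsOmegaZero' (z : A) : Prop :=
  Ev K z = {0} ∧ (C K z : Set A) = F K z ∧ F K z ⊂ Set.univ

/-- `z ∈ Ω₁(A)`. -/
def IsStrictlyNilpotent (z : A) : Prop :=
  Ev K z = {0} ∧ (C K z : Set A) ⊂ N K z ∧ N K z = Set.univ

/-- `z ∈ Ω₁'(A)`. -/
def IsWeaklyNilpotent (z : A) : Prop :=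
  Ev K z = {0} ∧ (C K z : Set A) ⊂ N K z ∧ N K z ⊂ Set.univ

/-- `z ∈ Ω₁(A) ∪ Ω₁'(A)`. -/
def IsNilpotentType (z : A) : Prop := IsStrictlyNilpotent K z ∨ IsWeaklyNilpotent K z

/-- `z ∈ Ω₂(A)`. -/
def IsStrictlySemisimple (z : A) : Prop :=
  {0} ⊂ Ev K z ∧ (D K z : Set A) = F K z ∧ F K z = Set.univ

/-- `z ∈ Ω₂'(A)`. -/
def IsWeaklySemisimple (z : A) : Prop :=
  {0} ⊂ Ev K z ∧ (D K z : Set A) = F K z ∧ F K z ⊂ Set.univ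

/-- `z ∈ Ω₂(A) ∪ Ω₂'(A)`. -/
def IsSemisimpleType (z : A) : Prop := IsStrictlySemisimple K z ∨ IsWeaklySemisimple K z

end ElementType

end

/-! A tensor `u` is studied through its slices, its images under `id ⊗ g` for functionals `g` on the
second factor. They form a finite-dimensional space V. Let a and b be left and right multiplication
by z₁. Slicing `ad (z₁ ⊗ z₂)` gives a relation between a and b on V in which z₂ acts only on
functionals; since right multiplication by z₂ is injective, every functional has the form g(· z₂).

Eigenvalues: an eigenvector with eigenvalue c gives b V ⊆ a V + V. Since z₁ is not scalar, a has no
eigenvectors, and this yields a functional f that kills a V and satisfies f ∘ b = β f on V. Applying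
f in the first factor gives y(β z₂ + c) = 0 with y ≠ 0, so c = 0 because z₂ is not scalar
(`eq_zero_of_ad_tmul_eq_smul`).

Nil-algebra: if a power of `ad (z₁ ⊗ z₂)` kills u, a finite-dimensional H built from V satisfies b H
⊆ a H. The only possible eigenvalue of a⁻¹b on H is 1, by comparing leading coefficients of v z₁ = μ
z₁ v. So a - b = `ad z₁` is nilpotent on H, and the slices of u lie in N(z₁) (`slice_mem_N`).

Elements of A₁: a nonzero eigenvalue of `ad z` and an element of N(z) outside C(z) would give
independent monomials in three parameters, too many for the quadratic growth of A₁. So z is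
non-nilpotent exactly when N(z) = C(z). For such z₁ the slices of an element of C(z₁ ⊗ z₂) lie in
C(z₁), and cancelling z₁ puts the slices in the other direction into C(z₂). If neither factor is
nilpotent, this applies in both directions to all of N(z₁ ⊗ z₂), which therefore equals C(z₁ ⊗ z₂).

Centralizers: in the skew field of fractions of A₁, elements that commute with z and have equal
order have proportional leading coefficients. Such a one-dimensional filtration forces
commutativity. If zx - xz = cx with c ≠ 0 and x ≠ 0, conjugation by x is a shift z ↦ z - c of the
centralizer. Applied to a shift-stable space without negative orders, it lowers every positive order
by exactly ord z, which gives C(z) = K[z]. -/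

noncomputable section

namespace WeylAlgebra

open Polynomial

/-! ### Normal forms in A₁, orders, leading coefficients, symbols of commutators. -/

section NormalForm

variable {K : Type*} [Field K]

/-- The coefficientwise derivative on `K[X][Y]`. -/
def coeffDeriv (K : Type*) [Field K] : K[X][X] →ₗ[K] K[X][X] where
  toFun F := F.sum fun i f => monomial i (derivative f)
  map_add' F G := by
    rw [Polynomial.sum_add_index] <;> simp
  map_smul' c F := by
    rw [Polynomial.sum_smul_index' _ _ _ (by simp), Polynomial.sum_def, Polynomial.sum_def,
      Finset.smul_sum]
    exact Finset.sum_congr rfl fun i _ => by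
      rw [derivative_smul, ← smul_monomial, RingHom.id_apply]

theorem coeff_coeffDeriv (F : K[X][X]) (i : ℕ) :
    (coeffDeriv K F).coeff i = derivative (F.coeff i) := by
  change (F.sum fun i f => monomial i (derivative f)).coeff i = _
  rw [Polynomial.sum_def, finsetSum_coeff]
  simp only [coeff_monomial]
  rw [Finset.sum_ite_eq']
  split_ifs with h
  · rfl
  · rw [notMem_support_iff.mp h, derivative_zero]

/-- The action of `q` on normal forms: multiplication by `Y` plus the derivative in `X`. -/
def qAct (K : Type*) [Field K] : Module.End K K[X][X] :=
  LinearMap.mulLeft K (X : K[X][X]) + coeffDeriv K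

theorem qAct_apply (F : K[X][X]) : qAct K F = X * F + coeffDeriv K F := rfl

/-- The left regular representation of `A_1` on normal forms. -/
def normalRep (K : Type*) [Field K] : WeylAlgebra K 1 →ₐ[K] Module.End K K[X][X] :=
  lift (fun _ => LinearMap.mulLeft K (C (X : K[X]))) (fun _ => qAct K)
    (fun _ _ => rfl) (fun _ _ => rfl) (fun i j => by
      rw [if_pos (Subsingleton.elim i j)]
      ext1 F
      ext1 i
      simp only [Module.End.mul_apply, LinearMap.add_apply, qAct_apply, LinearMap.mulLeft_apply,
        Module.End.one_apply, coeff_add, coeff_C_mul, coeff_coeffDeriv, derivative_mul,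
        derivative_X, mul_add]
      rw [mul_left_comm, coeff_C_mul]
      ring)

theorem normalRep_p (F : K[X][X]) : normalRep K (p K 0) F = C X * F := by
  simp [normalRep]

theorem normalRep_q (F : K[X][X]) : normalRep K (q K 0) F = X * F + coeffDeriv K F := by
  simp [normalRep, qAct_apply]

theorem q_mul_aeval_p (f : K[X]) :
    q K (0 : Fin 1) * aeval (p K 0) f = aeval (p K 0) f * q K 0 + aeval (p K 0) (derivative f) := by
  induction f using Polynomial.induction_on' with
  | add f g hf hg => simp only [map_add, mul_add, add_mul, hf, hg]; abel
  | monomial n a =>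
    have key : ∀ n : ℕ, q K (0 : Fin 1) * p K 0 ^ n = p K 0 ^ n * q K 0 + n • p K 0 ^ (n - 1) := by
      intro n
      induction n with
      | zero => simp
      | succ n ih =>
        rw [pow_succ, ← mul_assoc, ih, add_mul, mul_assoc, q_mul_p, if_pos rfl, mul_add, mul_one,
          ← mul_assoc, smul_mul_assoc, add_assoc, Nat.add_sub_cancel, succ_nsmul']
        cases n with
        | zero => simp
        | succ n => rw [Nat.add_sub_cancel, ← pow_succ, ← pow_succ]
    rw [derivative_monomial, aeval_monomial, aeval_monomial, map_mul, ← mul_assoc,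
      ← Algebra.commutes, mul_assoc, key, mul_add, mul_assoc, map_natCast, nsmul_eq_mul, mul_assoc]

/-- The element of `A_1` with a given normal form. -/
def ofNormal (K : Type*) [Field K] : K[X][X] →ₗ[K] WeylAlgebra K 1 where
  toFun F := F.sum fun i f => aeval (p K 0) f * q K 0 ^ i
  map_add' F G := by
    rw [Polynomial.sum_add_index] <;> simp [add_mul]
  map_smul' c F := by
    rw [Polynomial.sum_smul_index' _ _ _ (by simp), Polynomial.sum_def, Polynomial.sum_def,
      Finset.smul_sum]
    exact Finset.sum_congr rfl fun i _ => by rw [map_smul, smul_mul_assoc, RingHom.id_apply]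

theorem ofNormal_monomial (i : ℕ) (f : K[X]) :
    ofNormal K (monomial i f) = aeval (p K 0) f * q K 0 ^ i := by
  change ((monomial i f).sum fun i f => aeval (p K (0 : Fin 1)) f * q K (0 : Fin 1) ^ i) = _
  rw [sum_monomial_index]
  simp

theorem coeffDeriv_monomial (i : ℕ) (f : K[X]) :
    coeffDeriv K (monomial i f) = monomial i (derivative f) := by
  ext1 j
  rw [coeff_coeffDeriv, coeff_monomial, coeff_monomial]
  split_ifs <;> simp

/-- The elements `a` with this property form a subalgebra, so the generators suffice. At F = 1 it
says that every element has a normal form. -/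
theorem ofNormal_normalRep (a : WeylAlgebra K 1) (F : K[X][X]) :
    ofNormal K (normalRep K a F) = a * ofNormal K F := by
  let S : Subalgebra K (WeylAlgebra K 1) :=
    { carrier := {a | ∀ F, ofNormal K (normalRep K a F) = a * ofNormal K F}
      mul_mem' := fun {a b} ha hb F => by
        rw [map_mul, Module.End.mul_apply, ha, hb, mul_assoc]
      add_mem' := fun {a b} ha hb F => by
        rw [map_add, LinearMap.add_apply, map_add, ha, hb, add_mul]
      algebraMap_mem' := fun c F => by
        rw [AlgHom.commutes, Module.algebraMap_end_apply, map_smul, Algebra.smul_def] }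
  refine mem_of_gens S (fun i => ?_) (fun i => ?_) a F
  · intro F
    rw [Subsingleton.elim i 0]
    induction F using Polynomial.induction_on' with
    | add F G hF hG => simp only [map_add, mul_add, hF, hG]
    | monomial i f =>
      rw [normalRep_p, C_mul_monomial, ofNormal_monomial, ofNormal_monomial, map_mul, aeval_X,
        mul_assoc]
  · intro F
    rw [Subsingleton.elim i 0]
    induction F using Polynomial.induction_on' with
    | add F G hF hG => simp only [map_add, mul_add, hF, hG]
    | monomial i f =>
      rw [normalRep_q, map_add, coeffDeriv_monomial, X_mul_monomial, ofNormal_monomial,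
        ofNormal_monomial, ofNormal_monomial, ← mul_assoc, q_mul_aeval_p, add_mul, pow_succ',
        mul_assoc]

theorem normalRep_aeval_p (f : K[X]) (F : K[X][X]) :
    normalRep K (aeval (p K 0) f) F = C f * F := by
  induction f using Polynomial.induction_on' generalizing F with
  | add f g hf hg => simp only [map_add, LinearMap.add_apply, hf, hg, add_mul]
  | monomial n a =>
    rw [aeval_monomial, map_mul, Module.End.mul_apply, AlgHom.commutes, Module.algebraMap_end_apply,
      map_pow]
    have : ∀ n : ℕ, ((normalRep K (p K 0)) ^ n) F = C (X ^ n) * F := by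
      intro n
      induction n with
      | zero => simp
      | succ n ih => rw [pow_succ', Module.End.mul_apply, ih, normalRep_p, pow_succ', C_mul, mul_assoc]
    rw [this, ← C_mul_X_pow_eq_monomial, C_mul (a := Polynomial.C a), mul_assoc, ← smul_eq_C_mul,
      ← smul_eq_C_mul]
    ext1 i
    simp [Polynomial.smul_eq_C_mul]

/-- The uniqueness half of the normal form: the action on 1 recovers all coefficients. -/
theorem normalRep_ofNormal_one (F : K[X][X]) : normalRep K (ofNormal K F) 1 = F := by
  induction F using Polynomial.induction_on' with
  | add F G hF hG => simp only [map_add, LinearMap.add_apply, hF, hG]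
  | monomial i f =>
    rw [ofNormal_monomial, map_mul, Module.End.mul_apply, normalRep_aeval_p,
      ← C_mul_X_pow_eq_monomial, map_pow]
    congr 1
    induction i with
    | zero => simp
    | succ i ih =>
      rw [pow_succ', Module.End.mul_apply, ih, normalRep_q, ← monomial_one_right_eq_X_pow,
        coeffDeriv_monomial, derivative_one, map_zero, add_zero, X_mul_monomial,
        monomial_one_right_eq_X_pow]

/-- The normal form of an element of `A_1`: `Σ F_i(p) q ^ i` corresponds to `Σ F_i Y ^ i`. -/
def normalForm (K : Type*) [Field K] : WeylAlgebra K 1 ≃ₗ[K] K[X][X] where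
  toLinearMap := (LinearMap.applyₗ (1 : K[X][X])).comp (normalRep K).toLinearMap
  invFun := ofNormal K
  left_inv a := by
    change ofNormal K (normalRep K a 1) = a
    rw [ofNormal_normalRep, ← monomial_zero_one, ofNormal_monomial]
    simp
  right_inv F := normalRep_ofNormal_one F

theorem normalForm_apply (a : WeylAlgebra K 1) : normalForm K a = normalRep K a 1 := rfl

theorem normalForm_mul (a b : WeylAlgebra K 1) :
    normalForm K (a * b) = normalRep K a (normalForm K b) := by
  simp [normalForm_apply]

theorem normalForm_aeval_p_mul_q_pow (f : K[X]) (i : ℕ) :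
    normalForm K (aeval (p K 0) f * q K 0 ^ i) = monomial i f := by
  rw [← ofNormal_monomial]
  exact normalRep_ofNormal_one _

theorem eq_sum_normalForm (a : WeylAlgebra K 1) :
    a = (normalForm K a).sum fun i f => aeval (p K 0) f * q K 0 ^ i :=
  ((normalForm K).symm_apply_apply a).symm

/-- Each factor `q` raises the degree by one and adds the derivative of the top coefficient to the
next one. Multiplying by `X` reads the coefficient below the top without subtracting in ℕ, with
value zero if there is none. -/
theorem qAct_pow_coeff {n : ℕ} {G : K[X][X]} (hG : G.natDegree ≤ n) (i : ℕ) :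
    ((qAct K ^ i) G).natDegree ≤ n + i ∧ ((qAct K ^ i) G).coeff (n + i) = G.coeff n ∧
      (X * (qAct K ^ i) G).coeff (n + i) =
        (X * G).coeff n + (i : K[X]) * derivative (G.coeff n) := by
  induction i with
  | zero => simp [hG]
  | succ i ih =>
    obtain ⟨h1, h2, h3⟩ := ih
    rw [pow_succ', Module.End.mul_apply, qAct_apply, ← add_assoc]
    set H := (qAct K ^ i) G
    have h4 : H.coeff (n + i + 1) = 0 := coeff_eq_zero_of_natDegree_lt (by omega)
    refine ⟨?_, ?_, ?_⟩
    · rw [natDegree_le_iff_coeff_eq_zero]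
      intro N hN
      obtain ⟨N, rfl⟩ : ∃ M, N = M + 1 := ⟨N - 1, by omega⟩
      rw [coeff_add, coeff_X_mul, coeff_coeffDeriv, coeff_eq_zero_of_natDegree_lt (by omega),
        coeff_eq_zero_of_natDegree_lt (by omega)]
      simp
    · rw [coeff_add, coeff_X_mul, coeff_coeffDeriv, h4, h2]
      simp
    · rw [coeff_X_mul, coeff_add, h3, coeff_coeffDeriv, h2]
      push_cast
      ring

theorem normalRep_eq_sum (a : WeylAlgebra K 1) {m : ℕ} (ha : (normalForm K a).natDegree ≤ m)
    (G : K[X][X]) : normalRep K a G =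
      ∑ i ∈ Finset.range (m + 1), C ((normalForm K a).coeff i) * (qAct K ^ i) G := by
  conv_lhs => rw [eq_sum_normalForm a,
    Polynomial.sum_over_range' _ (by simp) (m + 1) (Nat.lt_succ_of_le ha)]
  rw [map_sum, LinearMap.sum_apply]
  refine Finset.sum_congr rfl fun i _ => ?_
  rw [map_mul, Module.End.mul_apply, normalRep_aeval_p, map_pow]
  congr 3
  ext1 F
  rw [normalRep_q, qAct_apply]

theorem normalForm_mul_natDegree_le {a b : WeylAlgebra K 1} {m n : ℕ}
    (ha : (normalForm K a).natDegree ≤ m) (hb : (normalForm K b).natDegree ≤ n) :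
    (normalForm K (a * b)).natDegree ≤ m + n := by
  rw [normalForm_mul, normalRep_eq_sum a ha]
  refine natDegree_sum_le_of_forall_le _ _ fun i hi => ?_
  refine (natDegree_C_mul_le _ _).trans ((qAct_pow_coeff hb i).1.trans ?_)
  have := Finset.mem_range.mp hi
  omega

theorem coeff_normalForm_mul {a b : WeylAlgebra K 1} {m n : ℕ}
    (ha : (normalForm K a).natDegree ≤ m) (hb : (normalForm K b).natDegree ≤ n) :
    (normalForm K (a * b)).coeff (m + n) = (normalForm K a).coeff m * (normalForm K b).coeff n := by
  rw [normalForm_mul, normalRep_eq_sum a ha, finsetSum_coeff, Finset.sum_range_succ,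
    Finset.sum_eq_zero, zero_add, coeff_C_mul, add_comm m n, (qAct_pow_coeff hb m).2.1]
  intro i hi
  have := Finset.mem_range.mp hi
  have := (qAct_pow_coeff hb i).1
  rw [coeff_C_mul, coeff_eq_zero_of_natDegree_lt (p := (qAct K ^ i) _) (by omega), mul_zero]

/-- Only the two top coefficients of `a` reach this degree. The derivative term is the only one not
symmetric in `a` and `b`, so it alone survives in the commutator. -/
theorem coeff_X_mul_normalForm_mul {a b : WeylAlgebra K 1} {m n : ℕ}
    (ha : (normalForm K a).natDegree ≤ m) (hb : (normalForm K b).natDegree ≤ n) :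
    (X * normalForm K (a * b)).coeff (m + n) =
      (normalForm K a).coeff m * (X * normalForm K b).coeff n +
      (X * normalForm K a).coeff m * (normalForm K b).coeff n +
      m * (normalForm K a).coeff m * derivative ((normalForm K b).coeff n) := by
  rw [normalForm_mul, normalRep_eq_sum a ha, Finset.mul_sum, finsetSum_coeff,
    Finset.sum_range_succ, mul_left_comm, coeff_C_mul, add_comm m n, (qAct_pow_coeff hb m).2.2]
  have key : ∑ i ∈ Finset.range m,
      (X * (C ((normalForm K a).coeff i) * (qAct K ^ i) (normalForm K b))).coeff (n + m) =
      (X * normalForm K a).coeff m * (normalForm K b).coeff n := by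
    cases m with
    | zero => simp
    | succ m =>
      rw [Finset.sum_range_succ, Finset.sum_eq_zero, zero_add, ← add_assoc, coeff_X_mul,
        coeff_X_mul, coeff_C_mul, (qAct_pow_coeff hb m).2.1]
      intro i hi
      have := Finset.mem_range.mp hi
      have := (qAct_pow_coeff hb i).1
      rw [← add_assoc, coeff_X_mul, coeff_C_mul,
        coeff_eq_zero_of_natDegree_lt (p := (qAct K ^ i) _) (by omega), mul_zero]
  rw [key]
  ring

/-- The top coefficient of a commutator is the Poisson bracket of the symbols. -/
theorem coeff_X_mul_normalForm_commutator {a b : WeylAlgebra K 1} {m n : ℕ}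
    (ha : (normalForm K a).natDegree ≤ m) (hb : (normalForm K b).natDegree ≤ n) :
    (X * normalForm K (a * b - b * a)).coeff (m + n) =
      m * (normalForm K a).coeff m * derivative ((normalForm K b).coeff n) -
      n * (normalForm K b).coeff n * derivative ((normalForm K a).coeff m) := by
  rw [map_sub, mul_sub, coeff_sub, coeff_X_mul_normalForm_mul ha hb, add_comm m n,
    coeff_X_mul_normalForm_mul hb ha]
  ring

/-- The order of an element of `A_1` as a differential operator. -/
def ord (a : WeylAlgebra K 1) : ℕ := (normalForm K a).natDegree

/-- The leading coefficient of an element of `A_1` as a differential operator. -/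
def lc (a : WeylAlgebra K 1) : K[X] := (normalForm K a).leadingCoeff

theorem lc_eq_zero {a : WeylAlgebra K 1} : lc a = 0 ↔ a = 0 := by
  rw [lc, leadingCoeff_eq_zero, LinearEquiv.map_eq_zero_iff]

/-- Leading coefficients lie in the domain K[X], so they cannot cancel; this is what makes A₁ a
domain. -/
theorem lc_mul (a b : WeylAlgebra K 1) : lc (a * b) = lc a * lc b := by
  have h := coeff_normalForm_mul (a := a) (b := b) le_rfl le_rfl
  by_cases ha : a = 0
  · simp [ha, lc]
  by_cases hb : b = 0
  · simp [hb, lc]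
  have h1 : (normalForm K (a * b)).natDegree = ord a + ord b := by
    apply le_antisymm (normalForm_mul_natDegree_le le_rfl le_rfl)
    apply le_natDegree_of_ne_zero
    change (normalForm K (a * b)).coeff ((normalForm K a).natDegree + (normalForm K b).natDegree) ≠ 0
    rw [h]
    exact mul_ne_zero (mt lc_eq_zero.mp ha) (mt lc_eq_zero.mp hb)
  rw [lc, leadingCoeff, h1]
  exact h

instance : Nontrivial (WeylAlgebra K 1) := (normalForm K).toEquiv.nontrivial

instance : IsDomain (WeylAlgebra K 1) :=
  have : NoZeroDivisors (WeylAlgebra K 1) := ⟨fun {a b} h => by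
    rw [← lc_eq_zero, lc_mul, mul_eq_zero, lc_eq_zero, lc_eq_zero] at h
    exact h⟩
  NoZeroDivisors.to_isDomain _

theorem ord_mul {a b : WeylAlgebra K 1} (ha : a ≠ 0) (hb : b ≠ 0) :
    ord (a * b) = ord a + ord b := by
  apply le_antisymm (normalForm_mul_natDegree_le le_rfl le_rfl)
  apply le_natDegree_of_ne_zero
  change (normalForm K (a * b)).coeff ((normalForm K a).natDegree + (normalForm K b).natDegree) ≠ 0
  rw [coeff_normalForm_mul le_rfl le_rfl]
  exact mul_ne_zero (mt lc_eq_zero.mp ha) (mt lc_eq_zero.mp hb)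

theorem normalForm_algebraMap (c : K) :
    normalForm K (algebraMap K (WeylAlgebra K 1) c) = C (C c) := by
  have := normalForm_aeval_p_mul_q_pow (C c) 0
  rw [aeval_C, pow_zero, mul_one, monomial_zero_left] at this
  exact this

theorem exists_aeval_p_of_ord_eq_zero {a : WeylAlgebra K 1} (ha : ord a = 0) :
    a = aeval (p K 0) (lc a) := by
  apply (normalForm K).injective
  have := normalForm_aeval_p_mul_q_pow (lc a) 0
  rw [pow_zero, mul_one, monomial_zero_left] at this
  rw [this, eq_C_of_natDegree_eq_zero ha, lc, leadingCoeff, show (normalForm K a).natDegree = 0 from ha]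

theorem lc_smul (c : K) (a : WeylAlgebra K 1) : lc (c • a) = C c * lc a := by
  rw [Algebra.smul_def, lc_mul]
  congr 1
  rw [lc, normalForm_algebraMap, leadingCoeff_C]

/-- Leading coefficients commute, so `v * z` and `z * v` have the same one. This supplies the
eigenvalue condition of `ElementType.slice_mem_N`. -/
theorem eq_one_of_mul_eq_smul_mul {z v : WeylAlgebra K 1} {c : K} (hz : z ≠ 0) (hv : v ≠ 0)
    (h : v * z = c • (z * v)) : c = 1 := by
  have h1 := congrArg lc h
  rw [lc_smul, lc_mul, lc_mul, mul_comm] at h1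
  have h2 : lc z * lc v ≠ 0 := mul_ne_zero (mt lc_eq_zero.mp hz) (mt lc_eq_zero.mp hv)
  have h3 : C c = 1 := mul_right_cancel₀ h2 (by rw [one_mul, ← h1])
  exact C_injective (by rw [h3, C_1])

theorem normalForm_p : normalForm K (p K 0) = C X := by
  have := normalForm_aeval_p_mul_q_pow (K := K) X 0
  rwa [aeval_X, pow_zero, mul_one, monomial_zero_left] at this

theorem normalForm_q : normalForm K (q K 0) = X := by
  have := normalForm_aeval_p_mul_q_pow (K := K) 1 1
  rwa [map_one, pow_one, one_mul, monomial_one_one_eq_X] at this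

/-- The center of `A_1` is `K`. -/
theorem exists_not_commute [CharZero K] {z : WeylAlgebra K 1}
    (hz : z ∉ Set.range (algebraMap K (WeylAlgebra K 1))) : ∃ x, z * x - x * z ≠ 0 := by
  by_contra! H
  -- Commuting with `p` forces ord z · lc z = 0.
  have h1 := coeff_X_mul_normalForm_commutator (a := z) (b := p K 0) (n := 0) le_rfl
    (by rw [normalForm_p, natDegree_C])
  rw [H, map_zero, mul_zero, coeff_zero, normalForm_p, coeff_C_zero, derivative_X, mul_one,
    Nat.cast_zero, zero_mul, zero_mul, sub_zero] at h1
  rcases mul_eq_zero.mp h1.symm with h2 | h2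
  · have h3 : ord z = 0 := by exact_mod_cast h2
    -- Now z is a polynomial in `p`, and commuting with `q` makes its derivative vanish.
    have h4 := coeff_X_mul_normalForm_commutator (a := z) (b := q K 0) (n := 1) h3.le
      (by rw [normalForm_q]; exact natDegree_X_le)
    rw [H, map_zero, mul_zero, coeff_zero, normalForm_q, coeff_X_one] at h4
    simp only [derivative_one, Nat.cast_zero, zero_mul, Nat.cast_one, one_mul, zero_sub] at h4
    have h5 : derivative (lc z) = 0 := by
      rw [lc, leadingCoeff, show (normalForm K z).natDegree = 0 from h3]
      exact neg_eq_zero.mp h4.symm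
    apply hz
    refine ⟨(lc z).coeff 0, ?_⟩
    conv_rhs => rw [exists_aeval_p_of_ord_eq_zero h3,
      eq_C_of_natDegree_eq_zero (derivative_eq_zero.mp h5), aeval_C]
  · have : z = 0 := lc_eq_zero.mp h2
    exact hz ⟨0, by rw [this, map_zero]⟩

end NormalForm

end WeylAlgebra

end

/-! ### Linear independence from generalized eigenspaces of `ad z`. -/

noncomputable section

/-- If the maps `T k` are jointly injective, then they send a linearly independent family to a
linearly independent family. -/
theorem LinearIndependent.prod_of_forall_sum_eq_zero {K V W ι κ : Type*} [Field K] [AddCommGroup V]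
    [Module K V] [AddCommGroup W] [Module K W] {v : ι → V} (hv : LinearIndependent K v)
    (T : κ → V →ₗ[K] W)
    (hT : ∀ u : κ →₀ V, (u.sum fun k x => T k x) = 0 → u = 0) :
    LinearIndependent K fun i : κ × ι => T i.1 (v i.2) := by
  have h1 := Finsupp.linearIndependent_single (R := K) (ι := κ) (φ := fun _ => ι) (fun _ => v)
    (fun _ => hv)
  have h2 := h1.map' (Finsupp.lsum K T) (LinearMap.ker_eq_bot'.mpr fun u hu => hT u hu)
  have h3 := h2.comp (Equiv.sigmaEquivProd κ ι).symm (Equiv.injective _)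
  have h4 : (fun i : κ × ι => T i.1 (v i.2)) =
      (Finsupp.lsum K T ∘ fun ix : (_ : κ) × ι => Finsupp.single ix.1 (v ix.2)) ∘
        (Equiv.sigmaEquivProd κ ι).symm := by
    funext i
    simp [Function.comp_def]
  rw [h4]
  exact h3

namespace ElementType

variable {K : Type*} [Field K] {A : Type*} [Ring A] [Algebra K A]

theorem ad_mul (z a b : A) : ad K z (a * b) = ad K z a * b + a * ad K z b := by
  simp only [ad_apply]
  noncomm_ring

theorem ad_pow_mul_of_mem_C {z c : A} (hc : ad K z c = 0) (x : A) (m : ℕ) :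
    (ad K z ^ m) (c * x) = c * (ad K z ^ m) x := by
  induction m with
  | zero => rfl
  | succ m ih => rw [pow_succ', Module.End.mul_apply, ih, ad_mul, hc, zero_mul, zero_add,
      Module.End.mul_apply]

/-- The Leibniz formula stops after two terms, because `ad z` kills `ad z y`. -/
theorem ad_pow_mul_of_ad_ad_eq_zero {z y : A} (hy : ad K z (ad K z y) = 0) (a : A) (m : ℕ) :
    (ad K z ^ (m + 1)) (a * y) =
      (ad K z ^ (m + 1)) a * y + (m + 1 : ℕ) • ((ad K z ^ m) a * ad K z y) := by
  induction m with
  | zero => simp [ad_mul]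
  | succ m ih =>
    rw [pow_succ', Module.End.mul_apply, ih, map_add, map_nsmul, ad_mul, ad_mul, hy, mul_zero,
      add_zero, ← Module.End.mul_apply, ← Module.End.mul_apply, ← pow_succ', ← pow_succ', add_assoc,
      succ_nsmul' _ (m + 1)]

/-- For `ad z` the element y behaves like a variable of degree one, so differentiation separates its
powers. -/
theorem ad_pow_pow_of_ad_ad_eq_zero {z y : A} (hy : ad K z (ad K z y) = 0) (k : ℕ) :
    (ad K z ^ k) (y ^ k) = k.factorial • ad K z y ^ k ∧ (ad K z ^ (k + 1)) (y ^ k) = 0 := by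
  induction k with
  | zero => simp [ad_apply]
  | succ k ih =>
    obtain ⟨h1, h2⟩ := ih
    rw [pow_succ y, ad_pow_mul_of_ad_ad_eq_zero hy, ad_pow_mul_of_ad_ad_eq_zero hy, h2, h1,
      pow_succ' _ (k + 1), Module.End.mul_apply, h2]
    refine ⟨?_, by simp⟩
    rw [zero_mul, zero_add, smul_mul_assoc, ← pow_succ, smul_smul, Nat.factorial_succ]

theorem ad_pow_eq_zero_of_le {z x : A} {m n : ℕ} (h : (ad K z ^ m) x = 0) (hmn : m ≤ n) :
    (ad K z ^ n) x = 0 := by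
  rw [← Nat.sub_add_cancel hmn, pow_add, Module.End.mul_apply, h, map_zero]

theorem mem_N_iff_mem_maxGenEigenspace (z x : A) :
    x ∈ N K z ↔ x ∈ Module.End.maxGenEigenspace (ad K z) 0 := by
  rw [Module.End.mem_maxGenEigenspace, zero_smul, sub_zero]
  rfl

theorem C_le_N (z : A) : (C K z : Set A) ⊆ N K z := fun x hx =>
  ⟨1, by rwa [pow_one, ← mem_C_iff]⟩

/-- If `N(z)` is not `C(z)`, then some `y` satisfies `[z, [z, y]] = 0` and `[z, y] ≠ 0`. -/
theorem exists_ad_ad_eq_zero {z x : A} (hx : x ∈ N K z) (hx' : ad K z x ≠ 0) :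
    ∃ y, ad K z (ad K z y) = 0 ∧ ad K z y ≠ 0 := by
  classical
  have hx2 : ∃ m : ℕ, (ad K z ^ m) x = 0 := hx
  obtain ⟨m, hm⟩ : ∃ m, Nat.find hx2 = m + 2 := by
    have h0 : Nat.find hx2 ≠ 0 := fun h => hx' (by
      have := Nat.find_spec hx2
      rw [h] at this
      rw [show x = 0 from this, map_zero])
    have h1 : Nat.find hx2 ≠ 1 := fun h => hx' (by
      have := Nat.find_spec hx2
      rwa [h, pow_one] at this)
    exact ⟨Nat.find hx2 - 2, by omega⟩
  refine ⟨(ad K z ^ m) x, ?_, ?_⟩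
  · have := Nat.find_spec hx2
    rwa [hm, pow_succ', pow_succ', Module.End.mul_apply, Module.End.mul_apply] at this
  · have := Nat.find_min hx2 (m := m + 1) (by omega)
    rwa [pow_succ', Module.End.mul_apply] at this

open Polynomial

/-- Over an algebraically closed field f splits into linear factors, and each z - c is nonzero in a
domain. -/
theorem aeval_ne_zero_of_notMem_range [IsAlgClosed K] [IsDomain A] {z : A}
    (hz : z ∉ Set.range (algebraMap K A)) {f : K[X]} (hf : f ≠ 0) : aeval z f ≠ 0 := by
  induction hn : f.natDegree generalizing f with
  | zero =>
    rw [eq_C_of_natDegree_eq_zero hn, aeval_C]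
    rw [Ne, FaithfulSMul.algebraMap_eq_zero_iff]
    rintro h
    exact hf (by rw [eq_C_of_natDegree_eq_zero hn, h, C_0])
  | succ n ih =>
    obtain ⟨c, hc⟩ := IsAlgClosed.exists_root f (fun h => by
      have := natDegree_eq_of_degree_eq_some (n := 0) h
      omega)
    obtain ⟨g, rfl⟩ := dvd_iff_isRoot.mpr hc
    have hg : g ≠ 0 := right_ne_zero_of_mul hf
    rw [natDegree_mul (X_sub_C_ne_zero c) hg, natDegree_X_sub_C] at hn
    rw [map_mul]
    refine mul_ne_zero (fun h => hz ⟨c, ?_⟩) (ih hg (by omega))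
    rw [map_sub, aeval_X, aeval_C, sub_eq_zero] at h
    exact h.symm

theorem aeval_mem_C (z : A) (f : K[X]) : ad K z (aeval z f) = 0 := by
  have h := congrArg (aeval z) (mul_comm X f)
  rw [map_mul, map_mul, aeval_X] at h
  rw [ad_apply, h, sub_self]

theorem notMem_range_of_ad_ne_zero {z x : A} (h : ad K z x ≠ 0) :
    z ∉ Set.range (algebraMap K A) := by
  rintro ⟨c, rfl⟩
  exact h (by rw [ad_apply, Algebra.commutes, sub_self])

/-- A nonzero eigenvalue of `ad z` and an element of `N(z)` outside `C(z)` yield a family with three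
parameters. -/
theorem linearIndependent_pow_mul_pow_mul_pow [IsAlgClosed K] [CharZero K] [IsDomain A] {z x y : A}
    {c : K} (hc : c ≠ 0) (hx : x ≠ 0) (hzx : ad K z x = c • x) (hy : ad K z (ad K z y) = 0)
    (hy' : ad K z y ≠ 0) :
    LinearIndependent K fun i : ℕ × ℕ × ℕ => x ^ i.1 * (z ^ i.2.2 * y ^ i.2.1) := by
  have hz := notMem_range_of_ad_ne_zero hy'
  have hX : LinearIndependent K fun n : ℕ => (X : K[X]) ^ n := by
    simpa [monomial_one_right_eq_X_pow] using (basisMonomials K).linearIndependent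
  have h1 := hX.prod_of_forall_sum_eq_zero
    (fun k : ℕ => (LinearMap.mulRight K (y ^ k)).comp (aeval (R := K) z).toLinearMap) (by
      intro u hu
      by_contra hne
      have hs : u.support.Nonempty := Finsupp.support_nonempty_iff.mpr hne
      -- For the largest power of y, the k-th power of `ad z` kills all other terms and leaves k!
      -- f(z) [z, y]^k.
      set k := u.support.max' hs with hk
      have h2 := congrArg (ad K z ^ k) hu
      rw [Finsupp.sum, map_zero, map_sum, Finset.sum_eq_single k] at h2
      · simp only [LinearMap.comp_apply, LinearMap.mulRight_apply, AlgHom.toLinearMap_apply] at h2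
        rw [ad_pow_mul_of_mem_C (aeval_mem_C z _), (ad_pow_pow_of_ad_ad_eq_zero hy k).1,
          ← Nat.cast_smul_eq_nsmul K, mul_smul_comm, smul_eq_zero] at h2
        rcases h2 with h2 | h2
        · exact Nat.factorial_ne_zero k (by exact_mod_cast h2)
        · refine mul_ne_zero (aeval_ne_zero_of_notMem_range hz ?_) (pow_ne_zero _ hy') h2
          exact Finsupp.mem_support_iff.mp (Finset.max'_mem _ hs)
      · intro i hi hik
        have : i < k := lt_of_le_of_ne (Finset.le_max' _ _ hi) hik
        simp only [LinearMap.comp_apply, LinearMap.mulRight_apply, AlgHom.toLinearMap_apply]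
        rw [ad_pow_mul_of_mem_C (aeval_mem_C z _),
          ad_pow_eq_zero_of_le (ad_pow_pow_of_ad_ad_eq_zero hy i).2 this, mul_zero]
      · intro h
        exact absurd (Finset.max'_mem _ hs) h)
  have hN : ∀ i : ℕ × ℕ, z ^ i.2 * y ^ i.1 ∈ Module.End.maxGenEigenspace (ad K z) 0 := by
    intro i
    rw [← mem_N_iff_mem_maxGenEigenspace]
    refine ⟨i.1 + 1, ?_⟩
    rw [ad_pow_mul_of_mem_C (by simpa using aeval_mem_C (K := K) z (X ^ i.2)),
      (ad_pow_pow_of_ad_ad_eq_zero hy i.1).2, mul_zero]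
  have h2 : LinearIndependent K fun i : ℕ × ℕ =>
      (⟨_, hN i⟩ : Module.End.maxGenEigenspace (ad K z) 0) := by
    refine LinearIndependent.of_comp (Submodule.subtype _) ?_
    simpa [Function.comp_def] using h1
  have hxj : ∀ j : ℕ, ad K z (x ^ j) = (j * c) • x ^ j := by
    intro j
    induction j with
    | zero => simp [ad_apply]
    | succ j ih =>
      rw [pow_succ, ad_mul, ih, hzx, mul_smul_comm, smul_mul_assoc, ← add_smul]
      push_cast
      ring_nf
  -- Left multiplication by x^j intertwines `ad z` with `ad z - j c`.
  have hmem : ∀ (j : ℕ) (u : A), u ∈ Module.End.maxGenEigenspace (ad K z) 0 →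
      x ^ j * u ∈ Module.End.maxGenEigenspace (ad K z) (j * c) := by
    intro j u hu
    rw [Module.End.mem_maxGenEigenspace] at hu ⊢
    obtain ⟨m, hm⟩ := hu
    refine ⟨m, ?_⟩
    have key : ∀ m : ℕ, ((ad K z - (j * c) • 1) ^ m) (x ^ j * u) =
        x ^ j * ((ad K z - (0 : K) • 1) ^ m) u := by
      intro m
      induction m with
      | zero => rfl
      | succ m ih =>
        rw [pow_succ', Module.End.mul_apply, ih, LinearMap.sub_apply, ad_mul, hxj, pow_succ',
          Module.End.mul_apply]
        simp
    rw [key, hm, mul_zero]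
  -- The values j c are distinct in characteristic zero.
  have hind := (Module.End.independent_maxGenEigenspace (ad K z)).comp
    (f := fun j : ℕ => (j * c : K)) (fun i j hij => by
      have := mul_right_cancel₀ hc hij
      exact_mod_cast this)
  rw [iSupIndep_iff_finsetSum_eq_zero_imp_eq_zero] at hind
  have h3 := h2.prod_of_forall_sum_eq_zero
    (fun j : ℕ => (LinearMap.mulLeft K (x ^ j)).comp (Submodule.subtype _)) (by
      intro u hu
      have := hind u.support (fun j => x ^ j * (u j : A)) (fun j _ => hmem j _ (u j).2) hu
      ext j
      by_cases hj : j ∈ u.support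
      · simpa [hx] using this j hj
      · rw [Finsupp.notMem_support_iff.mp hj]; rfl)
  exact h3

end ElementType

/-! ### Quadratic growth of A₁ and its consequences, among them the Ore condition. -/

namespace WeylAlgebra

open Polynomial

variable {K : Type*} [Field K]

/-- The span of the words of length at most `n` in `p` and `q`. -/
def wordSpan (K : Type*) [Field K] (n : ℕ) : Submodule K (WeylAlgebra K 1) :=
  (Submodule.span K {1, p K 0, q K 0}) ^ n

/-- The span of `p ^ i * q ^ j` with `i, j ≤ n`. -/
def boxSpan (K : Type*) [Field K] (n : ℕ) : Submodule K (WeylAlgebra K 1) :=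
  Submodule.span K (Set.range fun i : Fin (n + 1) × Fin (n + 1) =>
    p K (0 : Fin 1) ^ (i.1 : ℕ) * q K (0 : Fin 1) ^ (i.2 : ℕ))

theorem pow_mul_pow_mem_boxSpan {i j n : ℕ} (hi : i ≤ n) (hj : j ≤ n) :
    p K (0 : Fin 1) ^ i * q K (0 : Fin 1) ^ j ∈ boxSpan K n :=
  Submodule.subset_span ⟨(⟨i, by omega⟩, ⟨j, by omega⟩), rfl⟩

theorem finrank_boxSpan_le (n : ℕ) : Module.finrank K (boxSpan K n) ≤ (n + 1) ^ 2 := by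
  refine (finrank_range_le_card _).trans ?_
  simp [sq]

instance (n : ℕ) : FiniteDimensional K (boxSpan K n) :=
  FiniteDimensional.span_of_finite K (Set.finite_range _)

/-- Moving `q` to the right past a power of `p` only creates a term with a lower power of `p`, so
normal ordering stays inside the box. -/
theorem wordSpan_le_boxSpan (n : ℕ) : wordSpan K n ≤ boxSpan K n := by
  induction n with
  | zero =>
    rw [wordSpan, pow_zero, Submodule.one_le]
    simpa using pow_mul_pow_mem_boxSpan (K := K) (le_refl 0) (le_refl 0)
  | succ n ih =>
    rw [wordSpan, pow_succ']
    refine (mul_le_mul' le_rfl ih).trans ?_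
    rw [boxSpan, Submodule.span_mul_span, Submodule.span_le]
    rintro _ ⟨a, ha, _, ⟨⟨i, j⟩, rfl⟩, rfl⟩
    simp only [Set.mem_insert_iff, Set.mem_singleton_iff] at ha
    have hi := i.2
    have hj := j.2
    rcases ha with rfl | rfl | rfl
    · simp only [one_mul]
      exact pow_mul_pow_mem_boxSpan (by omega) (by omega)
    · simp only [← mul_assoc, ← pow_succ']
      exact pow_mul_pow_mem_boxSpan (by omega) (by omega)
    · have h := q_mul_aeval_p (K := K) (X ^ (i : ℕ))
      rw [derivative_X_pow, map_mul, aeval_C, map_pow, map_pow, aeval_X] at h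
      simp only [← mul_assoc]
      rw [h, add_mul, mul_assoc _ (q K 0), ← pow_succ', mul_assoc, ← Algebra.smul_def]
      exact add_mem (pow_mul_pow_mem_boxSpan (by omega) (by omega))
        (Submodule.smul_mem _ _ (pow_mul_pow_mem_boxSpan (by omega) (by omega)))

theorem wordSpan_mono : Monotone (wordSpan K) := fun m n h => by
  refine pow_le_pow_right' ?_ h
  rw [Submodule.one_le]
  exact Submodule.subset_span (by simp)

theorem mul_mem_wordSpan {m n : ℕ} {a b : WeylAlgebra K 1} (ha : a ∈ wordSpan K m)
    (hb : b ∈ wordSpan K n) : a * b ∈ wordSpan K (m + n) := by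
  rw [wordSpan, pow_add]
  exact Submodule.mul_mem_mul ha hb

theorem pow_mem_wordSpan {m : ℕ} {a : WeylAlgebra K 1} (ha : a ∈ wordSpan K m) (i : ℕ) :
    a ^ i ∈ wordSpan K (m * i) := by
  rw [wordSpan, pow_mul]
  exact Submodule.pow_mem_pow _ ha i

theorem exists_mem_wordSpan (a : WeylAlgebra K 1) : ∃ n, a ∈ wordSpan K n := by
  let S : Subalgebra K (WeylAlgebra K 1) :=
    { carrier := {a | ∃ n, a ∈ wordSpan K n}
      mul_mem' := fun ⟨m, hm⟩ ⟨n, hn⟩ => ⟨m + n, mul_mem_wordSpan hm hn⟩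
      add_mem' := fun ⟨m, hm⟩ ⟨n, hn⟩ => ⟨max m n, add_mem (wordSpan_mono (le_max_left _ _) hm)
        (wordSpan_mono (le_max_right _ _) hn)⟩
      algebraMap_mem' := fun c => ⟨0, by
        rw [wordSpan, pow_zero, Submodule.one_eq_range]
        exact ⟨c, rfl⟩⟩ }
  refine mem_of_gens S (fun i => ⟨1, ?_⟩) (fun i => ⟨1, ?_⟩) a <;>
  · rw [Subsingleton.elim i 0, wordSpan, pow_one]
    exact Submodule.subset_span (by simp)

/-- `A_1` has Gelfand-Kirillov dimension less than three. -/
theorem not_linearIndependent_of_forall_mem_wordSpan (c : ℕ) (f : ℕ × ℕ × ℕ → WeylAlgebra K 1)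
    (hf : ∀ i j k, f (i, j, k) ∈ wordSpan K (c * (i + j + k + 1))) : ¬ LinearIndependent K f := by
  intro h
  -- The (n+1)³ elements with indices at most n lie in a box of dimension at most (c(3n+1)+1)² ≤
  -- (3c+1)²(n+1)². This n turns the bound into n(n+1)², which is too small.
  set n := (3 * c + 1) ^ 2 with hn
  let e : Fin (n + 1) × Fin (n + 1) × Fin (n + 1) → ℕ × ℕ × ℕ := fun i => (i.1, i.2.1, i.2.2)
  have he : Function.Injective e := by
    rintro ⟨i, j, k⟩ ⟨i', j', k'⟩ h
    simp only [e, Prod.mk.injEq, Fin.val_inj] at h ⊢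
    exact h
  have hmem : ∀ i, f (e i) ∈ boxSpan K (c * (3 * n + 1)) := by
    rintro ⟨i, j, k⟩
    refine wordSpan_le_boxSpan _ (wordSpan_mono (Nat.mul_le_mul_left c ?_) (hf _ _ _))
    have := i.2
    have := j.2
    have := k.2
    omega
  have h2 : LinearIndependent K fun i => (⟨_, hmem i⟩ : boxSpan K (c * (3 * n + 1))) :=
    LinearIndependent.of_comp (Submodule.subtype _) (h.comp e he)
  have h3 := h2.fintype_card_le_finrank.trans (finrank_boxSpan_le _)
  simp only [Fintype.card_prod, Fintype.card_fin] at h3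
  have h4 : c * (3 * n + 1) + 1 ≤ (3 * c + 1) * (n + 1) := by nlinarith
  have h5 := h3.trans (Nat.pow_le_pow_left h4 2)
  have h6 : (n + 1) * ((n + 1) * (n + 1)) ≤ n * ((n + 1) * (n + 1)) := by
    refine h5.trans (le_of_eq ?_)
    rw [hn]
    ring
  have := Nat.le_of_mul_le_mul_right h6 (by positivity)
  omega

/-- If `ad z` has a nonzero eigenvalue, then `N(z) = C(z)`. -/
theorem ad_eq_zero_of_mem_N [IsAlgClosed K] [CharZero K] {z x y : WeylAlgebra K 1} {c : K}
    (hc : c ≠ 0) (hx : x ≠ 0) (hzx : ElementType.ad K z x = c • x) (hy : y ∈ ElementType.N K z) :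
    ElementType.ad K z y = 0 := by
  by_contra hy'
  obtain ⟨u, hu, hu'⟩ := ElementType.exists_ad_ad_eq_zero hy hy'
  obtain ⟨m, hm⟩ := exists_mem_wordSpan z
  obtain ⟨n, hn⟩ := exists_mem_wordSpan x
  obtain ⟨k, hk⟩ := exists_mem_wordSpan u
  refine not_linearIndependent_of_forall_mem_wordSpan (m + n + k) _ (fun i j l => ?_)
    (ElementType.linearIndependent_pow_mul_pow_mul_pow hc hx hzx hu hu')
  refine wordSpan_mono ?_ (mul_mem_wordSpan (pow_mem_wordSpan hn i)
    (mul_mem_wordSpan (pow_mem_wordSpan hm l) (pow_mem_wordSpan hk j)))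
  nlinarith [Nat.zero_le (m * i), Nat.zero_le (m * j), Nat.zero_le (n * j), Nat.zero_le (n * l),
    Nat.zero_le (k * i), Nat.zero_le (k * l)]

theorem linearIndependent_p_pow_mul_q_pow :
    LinearIndependent K fun i : ℕ × ℕ => p K (0 : Fin 1) ^ i.2 * q K (0 : Fin 1) ^ i.1 := by
  have hX : LinearIndependent K fun n : ℕ => (X : K[X]) ^ n := by
    simpa [monomial_one_right_eq_X_pow] using (basisMonomials K).linearIndependent
  have h := hX.prod_of_forall_sum_eq_zero (fun k : ℕ =>
    (LinearMap.mulRight K (q K (0 : Fin 1) ^ k)).comp (aeval (R := K) (p K (0 : Fin 1))).toLinearMap)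
    (by
      intro u hu
      have h1 := congrArg (normalForm K) hu
      simp only [Finsupp.sum, map_sum, LinearMap.comp_apply, LinearMap.mulRight_apply,
        AlgHom.toLinearMap_apply, normalForm_aeval_p_mul_q_pow, map_zero] at h1
      ext1 k
      have h2 := congrArg (fun F => F.coeff k) h1
      simp only [finsetSum_coeff, coeff_monomial, Finset.sum_ite_eq', coeff_zero] at h2
      by_cases hk : k ∈ u.support
      · rwa [if_pos hk] at h2
      · exact Finsupp.notMem_support_iff.mp hk)
  simpa using h

/-- The left Ore condition. -/
theorem exists_mul_eq_mul_ne_zero {a b : WeylAlgebra K 1} (hb : b ≠ 0) :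
    ∃ s t, s * a = t * b ∧ s ≠ 0 := by
  -- If only s = 0 solves s a = t b, the sum of the left ideals A₁ a b^k is direct. The elements p^r
  -- q^j a b^i then form an independent family with three parameters.
  by_contra! H
  have key : ∀ (n : ℕ) (c : ℕ → WeylAlgebra K 1),
      ∑ k ∈ Finset.range n, c k * (a * b ^ k) = 0 → ∀ k < n, c k = 0 := by
    intro n
    induction n with
    | zero => intro c _ k hk; omega
    | succ n ih =>
      intro c hc
      rw [Finset.sum_range_succ'] at hc
      -- All terms with k ≥ 1 end in b, so the relation has the form c₀ a = t b.
      have h0 : c 0 = 0 := by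
        refine H (c 0) (-∑ k ∈ Finset.range n, c (k + 1) * (a * b ^ k)) ?_
        rw [neg_mul, Finset.sum_mul, ← add_eq_zero_iff_eq_neg, ← hc, pow_zero, mul_one, add_comm]
        simp only [pow_succ, mul_assoc]
      intro k hk
      cases k with
      | zero => exact h0
      | succ k =>
        refine ih (fun k => c (k + 1)) ?_ k (by omega)
        refine mul_right_cancel₀ hb ?_
        rw [h0, zero_mul, add_zero] at hc
        rw [Finset.sum_mul, zero_mul, ← hc]
        simp only [pow_succ, mul_assoc]
  have h := linearIndependent_p_pow_mul_q_pow.prod_of_forall_sum_eq_zero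
    (fun k : ℕ => LinearMap.mulRight K (a * b ^ k)) (by
      intro u hu
      obtain ⟨n, hn⟩ : ∃ n, u.support ⊆ Finset.range n := u.support.exists_nat_subset_range
      rw [Finsupp.sum_of_support_subset u hn _ (by simp)] at hu
      ext1 k
      by_cases hk : k ∈ u.support
      · exact key n u hu k (Finset.mem_range.mp (hn hk))
      · exact Finsupp.notMem_support_iff.mp hk)
  obtain ⟨m, hm⟩ := exists_mem_wordSpan (p K (0 : Fin 1))
  obtain ⟨n, hn⟩ := exists_mem_wordSpan (q K (0 : Fin 1))
  obtain ⟨k, hk⟩ := exists_mem_wordSpan a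
  obtain ⟨l, hl⟩ := exists_mem_wordSpan b
  refine not_linearIndependent_of_forall_mem_wordSpan (m + n + k + l) _ (fun i j r => ?_) h
  refine wordSpan_mono ?_ (mul_mem_wordSpan (mul_mem_wordSpan (pow_mem_wordSpan hm r)
    (pow_mem_wordSpan hn j)) (mul_mem_wordSpan hk (pow_mem_wordSpan hl i)))
  have : m * r + n * j + (k + l * i) ≤ (m + n + k + l) * r + (m + n + k + l) * j +
      ((m + n + k + l) + (m + n + k + l) * i) := by gcongr <;> omega
  refine this.trans (le_of_eq ?_)
  ring

end WeylAlgebra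

end

/-! ### Rings with a one-dimensional order function are commutative. -/

noncomputable section

/-- An integer valued order function whose associated graded ring is commutative and has components
of dimension at most one. -/
structure IsOneDimOrder (K : Type*) {R : Type*} [Field K] [Ring R] [Algebra K R] (o : R → ℤ) :
    Prop where
  mul : ∀ x y, x ≠ 0 → y ≠ 0 → o (x * y) = o x + o y
  add : ∀ x y, x ≠ 0 → y ≠ 0 → x + y ≠ 0 → o (x + y) ≤ max (o x) (o y)
  smul : ∀ (c : K) (x), c ≠ 0 → x ≠ 0 → o (c • x) = o x
  oneDim : ∀ x y, x ≠ 0 → y ≠ 0 → o x = o y → ∃ c : K, x - c • y = 0 ∨ o (x - c • y) < o x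
  commutator : ∀ x y, x ≠ 0 → y ≠ 0 → x * y - y * x = 0 ∨ o (x * y - y * x) < o x + o y

/-- The elements of order at most `n`. -/
def orderLE {R : Type*} [Zero R] (o : R → ℤ) (n : ℤ) : Set R := {x | x = 0 ∨ o x ≤ n}

namespace IsOneDimOrder

variable {K R : Type*} [Field K] [Ring R] [NoZeroDivisors R] [Algebra K R] {o : R → ℤ}

omit [NoZeroDivisors R] in
theorem zero_mem (n : ℤ) : (0 : R) ∈ orderLE o n := Or.inl rfl

omit [NoZeroDivisors R] in
theorem mem_self (x : R) : x ∈ orderLE o (o x) := Or.inr le_rfl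

omit [NoZeroDivisors R] in
theorem mono {m n : ℤ} (hmn : m ≤ n) {x : R} (hx : x ∈ orderLE o m) : x ∈ orderLE o n :=
  hx.imp id fun h => h.trans hmn

omit [NoZeroDivisors R] in
theorem eq_of_notMem {n : ℤ} {x : R} (hx : x ∈ orderLE o n) (hx' : x ∉ orderLE o (n - 1)) :
    x ≠ 0 ∧ o x = n := by
  simp only [orderLE, Set.mem_ofPred_eq, not_or] at hx hx'
  refine ⟨hx'.1, ?_⟩
  have := hx.resolve_left hx'.1
  omega

omit [NoZeroDivisors R] in
theorem notMem {x : R} (hx : x ≠ 0) {n : ℤ} (hn : n < o x) : x ∉ orderLE o n := by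
  simp only [orderLE, Set.mem_ofPred_eq, not_or]
  exact ⟨hx, by omega⟩

variable (ho : IsOneDimOrder K o)

include ho

omit [NoZeroDivisors R] in
theorem add_mem {n : ℤ} {x y : R} (hx : x ∈ orderLE o n) (hy : y ∈ orderLE o n) :
    x + y ∈ orderLE o n := by
  by_cases h1 : x = 0
  · rwa [h1, zero_add]
  by_cases h2 : y = 0
  · rwa [h2, add_zero]
  by_cases h3 : x + y = 0
  · exact Or.inl h3
  · have := ho.add x y h1 h2 h3
    exact Or.inr (this.trans (max_le (hx.resolve_left h1) (hy.resolve_left h2)))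

omit [NoZeroDivisors R] in
theorem smul_mem {n : ℤ} {x : R} (c : K) (hx : x ∈ orderLE o n) : c • x ∈ orderLE o n := by
  by_cases h1 : x = 0
  · rw [h1, smul_zero]
    exact zero_mem n
  by_cases h2 : c = 0
  · rw [h2, zero_smul]
    exact zero_mem n
  · exact Or.inr ((ho.smul c x h2 h1).le.trans (hx.resolve_left h1))

omit [NoZeroDivisors R] in
theorem neg_mem {n : ℤ} {x : R} (hx : x ∈ orderLE o n) : -x ∈ orderLE o n := by
  rw [← neg_one_smul K]
  exact ho.smul_mem _ hx

omit [NoZeroDivisors R] in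
theorem sub_mem {n : ℤ} {x y : R} (hx : x ∈ orderLE o n) (hy : y ∈ orderLE o n) :
    x - y ∈ orderLE o n := by
  rw [sub_eq_add_neg]
  exact ho.add_mem hx (ho.neg_mem hy)

omit [NoZeroDivisors R] in
theorem mul_mem {m n : ℤ} {x y : R} (hx : x ∈ orderLE o m) (hy : y ∈ orderLE o n) :
    x * y ∈ orderLE o (m + n) := by
  by_cases h1 : x = 0
  · rw [h1, zero_mul]
    exact zero_mem _
  by_cases h2 : y = 0
  · rw [h2, mul_zero]
    exact zero_mem _
  · exact Or.inr ((ho.mul x y h1 h2).le.trans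
      (add_le_add (hx.resolve_left h1) (hy.resolve_left h2)))

omit [NoZeroDivisors R] in
theorem commutator_mem {m n : ℤ} {x y : R} (hx : x ∈ orderLE o m) (hy : y ∈ orderLE o n) :
    x * y - y * x ∈ orderLE o (m + n - 1) := by
  by_cases h1 : x = 0
  · rw [h1, zero_mul, mul_zero, sub_zero]
    exact zero_mem _
  by_cases h2 : y = 0
  · rw [h2, zero_mul, mul_zero, sub_zero]
    exact zero_mem _
  · refine (ho.commutator x y h1 h2).imp id fun h => ?_
    have := hx.resolve_left h1
    have := hy.resolve_left h2
    omega

omit [NoZeroDivisors R] in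
theorem one [Nontrivial R] : o 1 = 0 := by
  have := ho.mul 1 1 one_ne_zero one_ne_zero
  rw [mul_one] at this
  omega

theorem pow [Nontrivial R] {x : R} (hx : x ≠ 0) (n : ℕ) : o (x ^ n) = n * o x := by
  induction n with
  | zero => simp [ho.one]
  | succ n ih =>
    rw [pow_succ, ho.mul _ _ (pow_ne_zero n hx) hx, ih]
    push_cast
    ring

omit [NoZeroDivisors R] in
theorem exists_smul_add {x y : R} (hx : x ≠ 0) (hy : y ≠ 0) (hxy : o x = o y) :
    ∃ c : K, c ≠ 0 ∧ ∃ r ∈ orderLE o (o x - 1), x = c • y + r := by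
  obtain ⟨c, hc⟩ := ho.oneDim x y hx hy hxy
  refine ⟨c, ?_, x - c • y, hc.imp id (fun h => by omega), by abel⟩
  rintro rfl
  rw [zero_smul, sub_zero] at hc
  rcases hc with h | h
  · exact hx h
  · exact lt_irrefl _ h

/-- The leading term of `[x ^ n, y]`. -/
theorem commutator_pow [Nontrivial R] {x y : R} (hx : x ≠ 0) (n : ℕ) :
    x ^ (n + 1) * y - y * x ^ (n + 1) - ((n + 1 : ℕ) : K) • (x ^ n * (x * y - y * x)) ∈
      orderLE o (n * o x + o (x * y - y * x) - 1) := by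
  set w := x * y - y * x with hw
  induction n with
  | zero => simpa [hw] using zero_mem _
  | succ n ih =>
    have h1 : x ^ (n + 1 + 1) * y - y * x ^ (n + 1 + 1) -
        ((n + 1 + 1 : ℕ) : K) • (x ^ (n + 1) * w) =
        x * (x ^ (n + 1) * y - y * x ^ (n + 1) - ((n + 1 : ℕ) : K) • (x ^ n * w)) +
        (w * x ^ (n + 1) - x ^ (n + 1) * w) := by
      have h2 : x ^ (n + 1 + 1) * y - y * x ^ (n + 1 + 1) =
          x * (x ^ (n + 1) * y - y * x ^ (n + 1)) + w * x ^ (n + 1) := by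
        rw [hw, pow_succ' x (n + 1)]
        simp only [mul_sub, sub_mul, mul_assoc]
        abel
      rw [h2, Nat.cast_succ (n + 1), add_smul, one_smul]
      simp only [pow_succ' x n, mul_sub, mul_smul_comm, mul_assoc]
      abel
    rw [h1]
    refine ho.add_mem ?_ ?_
    · refine mono ?_ (ho.mul_mem (mem_self x) ih)
      push_cast
      linarith
    · refine mono ?_ (ho.commutator_mem (mem_self w) (mem_self (x ^ (n + 1))))
      rw [ho.pow hx]
      push_cast
      linarith

theorem exists_pow_mul_pos [Nontrivial R] {z : R} (hz : 0 < o z) (hz0 : z ≠ 0) {x : R}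
    (hx : x ≠ 0) : ∀ᶠ N : ℕ in Filter.atTop, 0 < o (z ^ N * x) := by
  filter_upwards [Filter.eventually_ge_atTop (o x).natAbs.succ] with N hN
  rw [ho.mul _ _ (pow_ne_zero N hz0) hx, ho.pow hz0]
  have h1 : (N : ℤ) ≤ N * o z := le_mul_of_one_le_right (by positivity) hz
  omega

/-- Suitable powers of x and y have equal order, so they agree up to a scalar and a remainder r of
lower order. Then [xᵐ, y] = [r, y] is smaller than its leading term m xᵐ⁻¹[x, y] allows, unless [x,
y] is itself smaller. Iterating pushes the order of [x, y] below every bound. -/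
theorem commutator_mem_sub [Nontrivial R] [CharZero K] {z : R} (hz : 0 < o z) (hz0 : z ≠ 0)
    (hzc : ∀ x, z * x = x * z) (k : ℕ) {x y : R} (hx : x ≠ 0) (hy : y ≠ 0) :
    x * y - y * x ∈ orderLE o (o x + o y - 1 - k) := by
  induction k generalizing x y with
  | zero => simpa using ho.commutator_mem (mem_self x) (mem_self y)
  | succ k ih =>
    by_contra hcon
    obtain ⟨h0, h1⟩ := eq_of_notMem (ih hx hy) (by
      rwa [show o x + o y - 1 - (k : ℤ) - 1 = o x + o y - 1 - ((k + 1 : ℕ) : ℤ) by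
        push_cast; ring])
    -- The central factor z^N makes both orders positive and does not change the gap k between the
    -- order of the commutator and its first bound.
    obtain ⟨N, hNx, hNy⟩ := ((ho.exists_pow_mul_pos hz hz0 hx).and
      (ho.exists_pow_mul_pos hz hz0 hy)).exists
    have hzN := pow_ne_zero N hz0
    have hzNc : ∀ x, z ^ N * x = x * z ^ N := fun x => ((show Commute z x from hzc x).pow_left N).eq
    set x' := z ^ N * x with hx'
    set y' := z ^ N * y with hy'
    have hx0 : x' ≠ 0 := mul_ne_zero hzN hx
    have hy0 : y' ≠ 0 := mul_ne_zero hzN hy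
    have hw : x' * y' - y' * x' = z ^ N * (z ^ N * (x * y - y * x)) := by
      rw [hx', hy', mul_assoc, ← mul_assoc x, ← hzNc x, mul_assoc (z ^ N) y, ← mul_assoc y,
        ← hzNc y]
      simp only [mul_sub, mul_assoc]
    have hw0 : x' * y' - y' * x' ≠ 0 := by
      rw [hw]
      exact mul_ne_zero hzN (mul_ne_zero hzN h0)
    have hwo : o (x' * y' - y' * x') = o x' + o y' - 1 - k := by
      rw [hw, ho.mul _ _ hzN (mul_ne_zero hzN h0), ho.mul _ _ hzN h0, h1, hx', hy',
        ho.mul _ _ hzN hx, ho.mul _ _ hzN hy]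
      ring
    obtain ⟨a, ha⟩ : ∃ a : ℕ, o x' = a + 1 := ⟨(o x' - 1).toNat, by omega⟩
    obtain ⟨b, hb⟩ : ∃ b : ℕ, o y' = b + 1 := ⟨(o y' - 1).toNat, by omega⟩
    have hxo : o (x' ^ (b + 1)) = (b + 1) * (a + 1) := by
      rw [ho.pow hx0, ha]
      push_cast
      ring
    -- With orders a+1 and b+1, these exponents give both powers the order (a+1)(b+1).
    obtain ⟨c, -, r, hr, hcr⟩ := ho.exists_smul_add (pow_ne_zero (b + 1) hx0)
      (pow_ne_zero (a + 1) hy0) (by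
        rw [hxo, ho.pow hy0, hb]
        push_cast
        ring)
    have h2 : x' ^ (b + 1) * y' - y' * x' ^ (b + 1) = r * y' - y' * r := by
      rw [hcr, add_mul, mul_add, smul_mul_assoc, mul_smul_comm, ← pow_succ, ← pow_succ']
      abel
    have h3 : r * y' - y' * r ∈ orderLE o ((b + 1) * (a + 1) - 1 + (b + 1) - 1 - k) := by
      by_cases hr0 : r = 0
      · rw [hr0, zero_mul, mul_zero, sub_zero]
        exact zero_mem _
      · refine mono ?_ (ih hr0 hy0)
        have := hr.resolve_left hr0
        rw [hxo] at this
        linarith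
    have h4 := ho.commutator_pow (y := y') hx0 b
    rw [h2] at h4
    have h5 : ((b + 1 : ℕ) : K) • (x' ^ b * (x' * y' - y' * x')) ∈
        orderLE o (b * o x' + o (x' * y' - y' * x') - 1) := by
      have := ho.sub_mem (mono (n := b * o x' + o (x' * y' - y' * x') - 1) (by
        rw [hwo, ha, hb]
        linarith) h3) h4
      simpa using this
    have hbK : ((b + 1 : ℕ) : K) ≠ 0 := by exact_mod_cast Nat.succ_ne_zero b
    refine notMem (smul_ne_zero hbK (mul_ne_zero (pow_ne_zero b hx0) hw0)) ?_ h5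
    rw [ho.smul _ _ hbK (mul_ne_zero (pow_ne_zero b hx0) hw0), ho.mul _ _ (pow_ne_zero b hx0) hw0,
      ho.pow hx0]
    linarith

/-- A ring with a one-dimensional order function and a central element of positive order is
commutative. -/
theorem mul_comm [Nontrivial R] [CharZero K] {z : R} (hz : 0 < o z) (hz0 : z ≠ 0)
    (hzc : ∀ x, z * x = x * z) (x y : R) : x * y = y * x := by
  by_cases hx : x = 0
  · rw [hx, zero_mul, mul_zero]
  by_cases hy : y = 0
  · rw [hy, zero_mul, mul_zero]
  by_contra h
  have h0 := sub_ne_zero.mpr h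
  -- This k puts the bound below the order of the commutator itself.
  refine notMem h0 ?_ (ho.commutator_mem_sub hz hz0 hzc (o x + o y - o (x * y - y * x)).natAbs hx hy)
  omega

/-! ### Endomorphisms that shift z by a constant. -/

section Shift

variable [Nontrivial R] (hcomm : ∀ x y : R, x * y = y * x) (σ : R →ₐ[K] R)
    (hσo : ∀ x, x ≠ 0 → σ x - x ∈ orderLE o (o x - 1))

include hcomm hσo

/-- The leading term of `σ (x ^ n) - x ^ n`. -/
theorem shift_pow {x : R} (hx : x ≠ 0) (n : ℕ) :
    σ (x ^ (n + 1)) - x ^ (n + 1) - ((n + 1 : ℕ) : K) • (x ^ n * (σ x - x)) ∈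
      orderLE o (n * o x + o (σ x - x) - 1) := by
  set w := σ x - x with hw
  induction n with
  | zero => simpa [hw] using zero_mem _
  | succ n ih =>
    have h1 : σ (x ^ (n + 1 + 1)) - x ^ (n + 1 + 1) -
        ((n + 1 + 1 : ℕ) : K) • (x ^ (n + 1) * w) =
        x * (σ (x ^ (n + 1)) - x ^ (n + 1) - ((n + 1 : ℕ) : K) • (x ^ n * w)) +
        w * (σ (x ^ (n + 1)) - x ^ (n + 1)) := by
      have h2 : σ (x ^ (n + 1 + 1)) - x ^ (n + 1 + 1) = x * (σ (x ^ (n + 1)) - x ^ (n + 1)) +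
          w * (σ (x ^ (n + 1)) - x ^ (n + 1)) + w * x ^ (n + 1) := by
        rw [hw, pow_succ' x (n + 1), map_mul]
        simp only [mul_sub, sub_mul]
        abel
      rw [h2, Nat.cast_succ (n + 1), add_smul, one_smul, hcomm w (x ^ (n + 1))]
      simp only [pow_succ' x n, mul_sub, mul_smul_comm, mul_assoc]
      abel
    rw [h1]
    refine ho.add_mem ?_ ?_
    · refine mono ?_ (ho.mul_mem (mem_self x) ih)
      push_cast
      linarith
    · refine mono ?_ (ho.mul_mem (mem_self w) (hσo _ (pow_ne_zero (n + 1) hx)))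
      rw [ho.pow hx]
      push_cast
      linarith

theorem shift_pow_order {x : R} (hx : x ≠ 0) (n : ℕ) [CharZero K] (hw : σ x - x ≠ 0) :
    σ (x ^ (n + 1)) - x ^ (n + 1) ≠ 0 ∧
      o (σ (x ^ (n + 1)) - x ^ (n + 1)) = n * o x + o (σ x - x) := by
  have h := ho.shift_pow hcomm σ hσo hx n
  have hn : ((n + 1 : ℕ) : K) ≠ 0 := by exact_mod_cast Nat.succ_ne_zero n
  have h1 : o (((n + 1 : ℕ) : K) • (x ^ n * (σ x - x))) = n * o x + o (σ x - x) := by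
    rw [ho.smul _ _ hn (mul_ne_zero (pow_ne_zero n hx) hw), ho.mul _ _ (pow_ne_zero n hx) hw,
      ho.pow hx]
  have h2 := smul_ne_zero hn (mul_ne_zero (pow_ne_zero n hx) hw)
  refine eq_of_notMem ?_ fun h3 => ?_
  · rw [← sub_add_cancel (σ (x ^ (n + 1)) - x ^ (n + 1)) (((n + 1 : ℕ) : K) • (x ^ n * (σ x - x)))]
    refine ho.add_mem (mono (by linarith) h) ?_
    rw [← h1]
    exact mem_self _
  · have h4 := ho.sub_mem h3 h
    rw [sub_sub_cancel] at h4
    exact notMem h2 (by omega) h4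

variable [CharZero K] {z : R} (hz0 : z ≠ 0) {d : ℕ} (hz : o z = d + 1) {c : K} (hc : c ≠ 0)
    (hσz : σ z = z - c • 1)

include hz0 hz hc hσz

omit [NoZeroDivisors R] hcomm hσo [CharZero K] hz0 hz in
theorem shift_order_self : σ z - z ≠ 0 ∧ o (σ z - z) = 0 := by
  have h : σ z - z = (-c) • (1 : R) := by
    rw [hσz, neg_smul]
    abel
  rw [h]
  refine ⟨smul_ne_zero (neg_ne_zero.mpr hc) one_ne_zero, ?_⟩
  rw [ho.smul _ _ (neg_ne_zero.mpr hc) one_ne_zero, ho.one]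

theorem shift_pow_self_order (n : ℕ) :
    σ (z ^ (n + 1)) - z ^ (n + 1) ≠ 0 ∧ o (σ (z ^ (n + 1)) - z ^ (n + 1)) = n * (d + 1) := by
  obtain ⟨h1, h2⟩ := ho.shift_order_self σ hc hσz
  obtain ⟨h3, h4⟩ := ho.shift_pow_order hcomm σ hσo hz0 n h1
  exact ⟨h3, by rw [h4, h2, hz, add_zero]⟩

theorem shift_pow_self_mem (n : ℕ) :
    σ (z ^ n) - z ^ n ∈ orderLE o (n * (d + 1) - (d + 1)) := by
  cases n with
  | zero => simpa using zero_mem _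
  | succ n =>
    refine Or.inr ((ho.shift_pow_self_order hcomm σ hσo hz0 hz hc hσz n).2.trans ?_).le
    push_cast
    ring

/-- The comparison of powers used for commutators, now with `σ - 1` as the derivation-like operator
and powers of z as the reference. On powers of z it lowers the order by d+1, which is why the
argument runs up to k = d. -/
theorem shift_mem_sub (k : ℕ) (hk : k ≤ d) {x : R} (hx : x ≠ 0) :
    σ x - x ∈ orderLE o (o x - 1 - k) := by
  induction k generalizing x with
  | zero => simpa using hσo x hx
  | succ k ih =>
    replace ih := fun {x : R} (hx : x ≠ 0) => ih (by omega) hx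
    by_contra hcon
    obtain ⟨h0, h1⟩ := eq_of_notMem (ih hx) (by
      rwa [show o x - 1 - (k : ℤ) - 1 = o x - 1 - ((k + 1 : ℕ) : ℤ) by push_cast; ring])
    have hkd : (k : ℤ) + 1 ≤ d := by exact_mod_cast hk
    obtain ⟨N, hN⟩ := (ho.exists_pow_mul_pos (by rw [hz]; positivity) hz0 hx).exists
    have hzN := pow_ne_zero N hz0
    set x' := z ^ N * x with hx'
    have hx0 : x' ≠ 0 := mul_ne_zero hzN hx
    have hxo : o x' = N * (d + 1) + o x := by rw [hx', ho.mul _ _ hzN hx, ho.pow hz0, hz]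
    have hw : σ x' - x' = z ^ N * (σ x - x) + (σ (z ^ N) - z ^ N) * σ x := by
      rw [hx', map_mul, mul_sub, sub_mul]
      abel
    have hσx : σ x ∈ orderLE o (o x) := by
      rw [← sub_add_cancel (σ x) x]
      exact ho.add_mem (mono (by omega) (hσo x hx)) (mem_self x)
    have h2 : (σ (z ^ N) - z ^ N) * σ x ∈ orderLE o (o x' - 1 - k - 1) := by
      refine mono ?_ (ho.mul_mem (ho.shift_pow_self_mem hcomm σ hσo hz0 hz hc hσz N) hσx)
      rw [hxo]
      linarith
    have h3 : o (z ^ N * (σ x - x)) = o x' - 1 - k := by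
      rw [ho.mul _ _ hzN h0, ho.pow hz0, hz, h1, hxo]
      ring
    obtain ⟨hw0, hwo⟩ : σ x' - x' ≠ 0 ∧ o (σ x' - x') = o x' - 1 - k := by
      refine eq_of_notMem (ih hx0) fun h4 => ?_
      have h5 := ho.sub_mem h4 h2
      rw [hw, add_sub_cancel_right] at h5
      exact notMem (mul_ne_zero hzN h0) (by omega) h5
    obtain ⟨a, ha⟩ : ∃ a : ℕ, o x' = a + 1 := ⟨(o x' - 1).toNat, by omega⟩
    have hxo' : o (x' ^ (d + 1)) = (d + 1) * (a + 1) := by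
      rw [ho.pow hx0, ha]
      push_cast
      ring
    -- Both powers have order (d+1)(a+1). Neither the power of z nor the remainder r accounts for a
    -- drop of only k+1.
    obtain ⟨e, -, r, hr, her⟩ := ho.exists_smul_add (pow_ne_zero (d + 1) hx0)
      (pow_ne_zero (a + 1) hz0) (by
        rw [hxo', ho.pow hz0, hz]
        push_cast
        ring)
    obtain ⟨h6, h7⟩ := ho.shift_pow_order hcomm σ hσo hx0 d hw0
    have h8 : σ (x' ^ (d + 1)) - x' ^ (d + 1) =
        e • (σ (z ^ (a + 1)) - z ^ (a + 1)) + (σ r - r) := by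
      rw [her, map_add, map_smul, smul_sub]
      abel
    have h9 : σ (x' ^ (d + 1)) - x' ^ (d + 1) ∈ orderLE o ((d + 1) * (a + 1) - 1 - k - 1) := by
      rw [h8]
      refine ho.add_mem (ho.smul_mem _ (mono ?_
        (ho.shift_pow_self_mem hcomm σ hσo hz0 hz hc hσz (a + 1)))) ?_
      · push_cast
        linarith
      · by_cases hr0 : r = 0
        · rw [hr0, map_zero, sub_zero]
          exact zero_mem _
        · refine mono ?_ (ih hr0)
          have := hr.resolve_left hr0
          rw [hxo'] at this
          linarith
    refine notMem h6 ?_ h9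
    rw [h7, hwo, ha]
    linarith

/-- The upper bound is `shift_mem_sub` at k = d. For the lower bound, `σ - 1` applied to x^(d+1) has
the order a(d+1) that comes from z^(a+1), since the remainder contributes less. -/
theorem shift_order {x : R} (hx : x ≠ 0) (hxo : 0 < o x) :
    σ x - x ≠ 0 ∧ o (σ x - x) = o x - (d + 1) := by
  have hd := fun {x : R} (hx : x ≠ 0) =>
    ho.shift_mem_sub hcomm σ hσo hz0 hz hc hσz d le_rfl (x := x) hx
  obtain ⟨a, ha⟩ : ∃ a : ℕ, o x = a + 1 := ⟨(o x - 1).toNat, by omega⟩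
  have hxo' : o (x ^ (d + 1)) = (d + 1) * (a + 1) := by
    rw [ho.pow hx, ha]
    push_cast
    ring
  obtain ⟨e, he, r, hr, her⟩ := ho.exists_smul_add (pow_ne_zero (d + 1) hx)
    (pow_ne_zero (a + 1) hz0) (by
      rw [hxo', ho.pow hz0, hz]
      push_cast
      ring)
  have h8 : σ (x ^ (d + 1)) - x ^ (d + 1) - (σ r - r) =
      e • (σ (z ^ (a + 1)) - z ^ (a + 1)) := by
    rw [her, map_add, map_smul, smul_sub]
    abel
  have hr' : σ r - r ∈ orderLE o (a * (d + 1) - 1) := by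
    by_cases hr0 : r = 0
    · rw [hr0, map_zero, sub_zero]
      exact zero_mem _
    · refine mono ?_ (hd hr0)
      have := hr.resolve_left hr0
      rw [hxo'] at this
      linarith
  obtain ⟨h1, h2⟩ := ho.shift_pow_self_order hcomm σ hσo hz0 hz hc hσz a
  have h3 : σ (x ^ (d + 1)) - x ^ (d + 1) ∉ orderLE o (a * (d + 1) - 1) := fun h => by
    have h4 := ho.sub_mem h hr'
    rw [h8] at h4
    refine notMem (smul_ne_zero he h1) ?_ h4
    rw [ho.smul _ _ he h1, h2]
    omega
  have hw0 : σ x - x ≠ 0 := fun h => h3 (Or.inl (by rw [map_pow, sub_eq_zero.mp h, sub_self]))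
  refine ⟨hw0, le_antisymm ?_ ?_⟩
  · have := (hd hx).resolve_left hw0
    omega
  · by_contra! hlt
    refine h3 (Or.inr ?_)
    rw [(ho.shift_pow_order hcomm σ hσo hx d hw0).2, ha]
    rw [ha] at hlt
    linarith

/-- A `σ`-stable subspace that contains `K[z]` and has no elements of negative order is `K[z]`. -/
theorem mem_adjoin_of_shift_stable (O : Submodule K R) (hO : ∀ n : ℕ, z ^ n ∈ O)
    (hσO : ∀ x ∈ O, σ x ∈ O) (hpos : ∀ x ∈ O, x ≠ 0 → 0 ≤ o x) {x : R} (hx : x ∈ O) :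
    x ∈ Submodule.span K (Set.range fun n : ℕ => z ^ n) := by
  have key : ∀ n : ℕ, ∀ x ∈ O, x ≠ 0 → o x = n →
      x ∈ Submodule.span K (Set.range fun n : ℕ => z ^ n) ∧ ((d + 1 : ℕ) : ℤ) ∣ o x := by
    intro n
    induction n using Nat.strong_induction_on with
    | _ n ih =>
      intro x hx hx0 hxn
      have hdvd : ((d + 1 : ℕ) : ℤ) ∣ o x := by
        rcases Nat.eq_zero_or_pos n with rfl | hn
        · rw [hxn]; exact dvd_zero _
        -- `σ x - x` lies in O with order smaller by exactly d+1, so divisibility of the order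
        -- passes from it to x.
        · obtain ⟨h1, h2⟩ := ho.shift_order hcomm σ hσo hz0 hz hc hσz hx0 (by omega)
          have h3 := O.sub_mem (hσO x hx) hx
          have h4 := hpos _ h3 h1
          have h5 := (ih (o (σ x - x)).toNat (by omega) _ h3 h1 (by omega)).2
          rw [h2] at h5
          have := dvd_add h5 (dvd_refl ((d + 1 : ℕ) : ℤ))
          push_cast at this ⊢
          rwa [sub_add_cancel] at this
      refine ⟨?_, hdvd⟩
      obtain ⟨m, hm⟩ := hdvd
      have hm0 : 0 ≤ m := by
        by_contra! h
        have : ((d + 1 : ℕ) : ℤ) * m < 0 := mul_neg_of_pos_of_neg (by positivity) h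
        omega
      lift m to ℕ using hm0
      -- Now z^m has the order of x, and subtracting a multiple of it leaves a smaller element of O.
      obtain ⟨e, -, r, hr, her⟩ := ho.exists_smul_add hx0 (pow_ne_zero m hz0) (by
        rw [ho.pow hz0, hz, hm]
        push_cast
        ring)
      have hrO : r ∈ O := by
        have := O.sub_mem hx (O.smul_mem e (hO m))
        rwa [her, add_sub_cancel_left] at this
      rw [her]
      refine Submodule.add_mem _ (Submodule.smul_mem _ _ (Submodule.subset_span ⟨m, rfl⟩)) ?_
      by_cases hr0 : r = 0
      · rw [hr0]; exact Submodule.zero_mem _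
      · have h1 := hr.resolve_left hr0
        have h2 := hpos r hrO hr0
        exact (ih (o r).toNat (by omega) r hrO hr0 (by omega)).1
  by_cases hx0 : x = 0
  · rw [hx0]; exact Submodule.zero_mem _
  · have := hpos x hx hx0
    exact (key (o x).toNat x hx hx0 (by omega)).1

end Shift

end IsOneDimOrder

end

/-! ### The skew field of fractions and commutativity of centralizers. -/

noncomputable section

namespace WeylAlgebra

open Polynomial

variable (K : Type*) [Field K]

instance : OreLocalization.OreSet (nonZeroDivisors (WeylAlgebra K 1)) :=
  Classical.choice (OreLocalization.nonempty_oreSet_iff_of_noZeroDivisors.mpr fun r s => by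
    obtain ⟨u, t, h, hu⟩ := exists_mul_eq_mul_ne_zero (a := r) (nonZeroDivisors.ne_zero s.2)
    exact ⟨t, ⟨u, mem_nonZeroDivisors_of_ne_zero hu⟩, h⟩)

/-- The skew field of fractions of `A_1`. -/
abbrev SkewField : Type _ :=
  OreLocalization (nonZeroDivisors (WeylAlgebra K 1)) (WeylAlgebra K 1)

/-- The embedding of `A_1` in its skew field of fractions. -/
def toSkew : WeylAlgebra K 1 →ₐ[K] SkewField K where
  __ := OreLocalization.numeratorRingHom
  commutes' _ := rfl

variable {K}

theorem toSkew_injective : Function.Injective (toSkew K) :=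
  OreLocalization.numeratorHom_inj (fun _ h => h.1)

theorem toSkew_ne_zero {a : WeylAlgebra K 1} (ha : a ≠ 0) : toSkew K a ≠ 0 :=
  (map_ne_zero_iff _ toSkew_injective).mpr ha

theorem exists_mul_eq_toSkew (x : SkewField K) :
    ∃ s a, s ≠ 0 ∧ toSkew K s * x = toSkew K a := by
  induction x using OreLocalization.ind with
  | _ a s =>
    refine ⟨s, a, nonZeroDivisors.ne_zero s.2, ?_⟩
    change (OreLocalization.oreDiv (s : WeylAlgebra K 1) 1) * (OreLocalization.oreDiv a s) =
      OreLocalization.oreDiv a 1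
    exact OreLocalization.mul_cancel

theorem exists_mul_eq_toSkew_pair (x y : SkewField K) :
    ∃ s a b, s ≠ 0 ∧ toSkew K s * x = toSkew K a ∧ toSkew K s * y = toSkew K b := by
  obtain ⟨s, a, hs, hx⟩ := exists_mul_eq_toSkew x
  obtain ⟨t, b, ht, hy⟩ := exists_mul_eq_toSkew y
  obtain ⟨u, v, h, hu⟩ := exists_mul_eq_mul_ne_zero (a := s) ht
  refine ⟨u * s, u * a, v * b, mul_ne_zero hu hs, ?_, ?_⟩
  · rw [map_mul, mul_assoc, hx, map_mul]
  · rw [h, map_mul, mul_assoc, hy, map_mul]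

/-- The denominator of a chosen representation as a left fraction. -/
def skewDen (x : SkewField K) : WeylAlgebra K 1 := (exists_mul_eq_toSkew x).choose

/-- The numerator of a chosen representation as a left fraction. -/
def skewNum (x : SkewField K) : WeylAlgebra K 1 := (exists_mul_eq_toSkew x).choose_spec.choose

theorem skewDen_ne_zero (x : SkewField K) : skewDen x ≠ 0 :=
  (exists_mul_eq_toSkew x).choose_spec.choose_spec.1

theorem skewDen_mul (x : SkewField K) : toSkew K (skewDen x) * x = toSkew K (skewNum x) :=
  (exists_mul_eq_toSkew x).choose_spec.choose_spec.2

/-- The order of an element of the skew field. -/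
def skewOrd (x : SkewField K) : ℤ := ord (skewNum x) - ord (skewDen x)

/-- The leading coefficient of an element of the skew field. -/
def skewLc (x : SkewField K) : RatFunc K :=
  algebraMap K[X] (RatFunc K) (lc (skewNum x)) / algebraMap K[X] (RatFunc K) (lc (skewDen x))

theorem algebraMap_lc_ne_zero {a : WeylAlgebra K 1} (ha : a ≠ 0) :
    algebraMap K[X] (RatFunc K) (lc a) ≠ 0 :=
  (map_ne_zero_iff _ (RatFunc.algebraMap_injective K)).mpr (mt lc_eq_zero.mp ha)

theorem num_ne_zero_of_mul_eq {s a : WeylAlgebra K 1} {x : SkewField K} (hs : s ≠ 0) (hx : x ≠ 0)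
    (h : toSkew K s * x = toSkew K a) : a ≠ 0 := by
  rintro rfl
  rw [map_zero] at h
  exact mul_ne_zero (toSkew_ne_zero hs) hx h

/-- Two denominators have a common left multiple, and `ord` and `lc` turn products into sums and
products. Hence the choice of fraction does not matter. -/
theorem skewOrd_skewLc_eq {s a : WeylAlgebra K 1} {x : SkewField K} (hs : s ≠ 0) (hx : x ≠ 0)
    (h : toSkew K s * x = toSkew K a) : skewOrd x = ord a - ord s ∧
      skewLc x = algebraMap K[X] (RatFunc K) (lc a) / algebraMap K[X] (RatFunc K) (lc s) := by
  obtain ⟨u, v, huv, hu⟩ := exists_mul_eq_mul_ne_zero (a := skewDen x) hs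
  have hd := skewDen_ne_zero x
  have hv : v ≠ 0 := left_ne_zero_of_mul (huv ▸ mul_ne_zero hu hd)
  have hn := num_ne_zero_of_mul_eq hd hx (skewDen_mul x)
  have ha := num_ne_zero_of_mul_eq hs hx h
  have huv' : u * skewNum x = v * a := toSkew_injective (by
    rw [map_mul, map_mul, ← skewDen_mul, ← h, ← mul_assoc, ← mul_assoc, ← map_mul, ← map_mul, huv])
  constructor
  · have h1 := congrArg ord huv
    have h2 := congrArg ord huv'
    rw [ord_mul hu hd, ord_mul hv hs] at h1
    rw [ord_mul hu hn, ord_mul hv ha] at h2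
    rw [skewOrd]
    omega
  · have h1 := congrArg (fun t => algebraMap K[X] (RatFunc K) (lc t)) huv
    have h2 := congrArg (fun t => algebraMap K[X] (RatFunc K) (lc t)) huv'
    simp only [lc_mul, map_mul] at h1 h2
    rw [skewLc, div_eq_div_iff (algebraMap_lc_ne_zero hd) (algebraMap_lc_ne_zero hs)]
    have h3 := algebraMap_lc_ne_zero hu
    have h4 := algebraMap_lc_ne_zero hv
    apply mul_left_cancel₀ (mul_ne_zero h3 h4)
    linear_combination (algebraMap K[X] (RatFunc K) (lc v) * algebraMap K[X] (RatFunc K) (lc s)) * h2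
      - (algebraMap K[X] (RatFunc K) (lc v) * algebraMap K[X] (RatFunc K) (lc a)) * h1

theorem skewOrd_toSkew {a : WeylAlgebra K 1} (ha : a ≠ 0) : skewOrd (toSkew K a) = ord a := by
  rw [(skewOrd_skewLc_eq (s := 1) (a := a) one_ne_zero (toSkew_ne_zero ha)
    (by rw [map_one, one_mul])).1]
  have := ord_mul (one_ne_zero (α := WeylAlgebra K 1)) ha
  rw [one_mul] at this
  omega

/-- The Ore condition u a = t s' rewrites s⁻¹a · s'⁻¹a' as (us)⁻¹(ta'). -/
theorem skewOrd_skewLc_mul {x y : SkewField K} (hx : x ≠ 0) (hy : y ≠ 0) :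
    skewOrd (x * y) = skewOrd x + skewOrd y ∧ skewLc (x * y) = skewLc x * skewLc y := by
  obtain ⟨s, a, hs, h⟩ := exists_mul_eq_toSkew x
  obtain ⟨s', a', hs', h'⟩ := exists_mul_eq_toSkew y
  have ha := num_ne_zero_of_mul_eq hs hx h
  have ha' := num_ne_zero_of_mul_eq hs' hy h'
  obtain ⟨u, t, hut, hu⟩ := exists_mul_eq_mul_ne_zero (a := a) hs'
  have ht : t ≠ 0 := left_ne_zero_of_mul (hut ▸ mul_ne_zero hu ha)
  have hxy : toSkew K (u * s) * (x * y) = toSkew K (t * a') := by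
    rw [map_mul, mul_assoc, ← mul_assoc _ x y, h, ← mul_assoc, ← map_mul, hut, map_mul, mul_assoc,
      h', map_mul]
  obtain ⟨h1, h2⟩ := skewOrd_skewLc_eq (mul_ne_zero hu hs) (mul_ne_zero hx hy) hxy
  obtain ⟨h3, h4⟩ := skewOrd_skewLc_eq hs hx h
  obtain ⟨h5, h6⟩ := skewOrd_skewLc_eq hs' hy h'
  constructor
  · have h7 := congrArg ord hut
    rw [ord_mul hu ha, ord_mul ht hs'] at h7
    rw [h1, h3, h5, ord_mul hu hs, ord_mul ht ha']
    push_cast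
    omega
  · have h7 := congrArg (fun t => algebraMap K[X] (RatFunc K) (lc t)) hut
    simp only [lc_mul, map_mul] at h7
    rw [h2, h4, h6, div_mul_div_comm, div_eq_div_iff (algebraMap_lc_ne_zero (mul_ne_zero hu hs))
      (mul_ne_zero (algebraMap_lc_ne_zero hs) (algebraMap_lc_ne_zero hs'))]
    simp only [lc_mul, map_mul]
    linear_combination (-(algebraMap K[X] (RatFunc K) (lc a')) *
      algebraMap K[X] (RatFunc K) (lc s)) * h7

theorem skewOrd_skewLc_smul {c : K} (hc : c ≠ 0) {x : SkewField K} (hx : x ≠ 0) :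
    skewOrd (c • x) = skewOrd x ∧
      skewLc (c • x) = algebraMap K[X] (RatFunc K) (C c) * skewLc x := by
  obtain ⟨s, a, hs, h⟩ := exists_mul_eq_toSkew x
  have hca : toSkew K s * (c • x) = toSkew K (c • a) := by
    rw [mul_smul_comm, h, map_smul]
  obtain ⟨h1, h2⟩ := skewOrd_skewLc_eq hs (smul_ne_zero hc hx) hca
  obtain ⟨h3, h4⟩ := skewOrd_skewLc_eq hs hx h
  constructor
  · have h5 : ord (c • a) = ord a := by
      rw [ord, map_smul]
      exact natDegree_smul_of_smul_regular _ (IsSMulRegular.of_ne_zero hc)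
    rw [h1, h3, h5]
  · rw [h2, h4, lc_smul, map_mul, mul_div_assoc]

theorem skewOrd_add_le {x y : SkewField K} (hx : x ≠ 0) (hy : y ≠ 0) (hxy : x + y ≠ 0) :
    skewOrd (x + y) ≤ max (skewOrd x) (skewOrd y) := by
  obtain ⟨s, a, b, hs, ha, hb⟩ := exists_mul_eq_toSkew_pair x y
  rw [(skewOrd_skewLc_eq hs hx ha).1, (skewOrd_skewLc_eq hs hy hb).1,
    (skewOrd_skewLc_eq (a := a + b) hs hxy (by rw [mul_add, ha, hb, map_add])).1]
  have : ord (a + b) ≤ max (ord a) (ord b) := by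
    rw [ord, map_add]
    exact natDegree_add_le _ _
  omega

theorem skewOrd_sub_lt {x y : SkewField K} (hx : x ≠ 0) (hy : y ≠ 0) (ho : skewOrd x = skewOrd y)
    (hl : skewLc x = skewLc y) : x - y = 0 ∨ skewOrd (x - y) < skewOrd x := by
  by_cases hxy : x - y = 0
  · exact Or.inl hxy
  refine Or.inr ?_
  obtain ⟨s, a, b, hs, ha, hb⟩ := exists_mul_eq_toSkew_pair x y
  have hab : toSkew K s * (x - y) = toSkew K (a - b) := by rw [mul_sub, ha, hb, map_sub]
  obtain ⟨h1, h2⟩ := skewOrd_skewLc_eq hs hx ha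
  obtain ⟨h3, h4⟩ := skewOrd_skewLc_eq hs hy hb
  rw [h1, (skewOrd_skewLc_eq hs hxy hab).1]
  rw [h2, h4, div_left_inj' (algebraMap_lc_ne_zero hs)] at hl
  have h5 : lc a = lc b := RatFunc.algebraMap_injective K hl
  have h6 : ord a = ord b := by omega
  have ha0 : normalForm K a ≠ 0 := by
    rw [Ne, LinearEquiv.map_eq_zero_iff]
    exact num_ne_zero_of_mul_eq hs hx ha
  have hab0 : normalForm K (a - b) ≠ 0 := by
    rw [Ne, LinearEquiv.map_eq_zero_iff]
    exact num_ne_zero_of_mul_eq hs hxy hab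
  have hb0 : normalForm K b ≠ 0 := by
    rw [Ne, LinearEquiv.map_eq_zero_iff]
    exact num_ne_zero_of_mul_eq hs hy hb
  have h7 : (normalForm K a - normalForm K b).degree < (normalForm K a).degree := by
    refine degree_sub_lt_left ?_ ha0 h5
    rw [degree_eq_natDegree ha0, degree_eq_natDegree hb0]
    exact congrArg _ h6
  rw [← map_sub] at h7
  have h8 : ord (a - b) < ord a := natDegree_lt_natDegree hab0 h7
  omega

theorem skewOrd_commutator_lt {x y : SkewField K} (hx : x ≠ 0) (hy : y ≠ 0) :
    x * y - y * x = 0 ∨ skewOrd (x * y - y * x) < skewOrd x + skewOrd y := by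
  obtain ⟨h1, h2⟩ := skewOrd_skewLc_mul hx hy
  obtain ⟨h3, h4⟩ := skewOrd_skewLc_mul hy hx
  rw [← h1]
  exact skewOrd_sub_lt (mul_ne_zero hx hy) (mul_ne_zero hy hx) (by rw [h1, h3, add_comm])
    (by rw [h2, h4, mul_comm])

theorem coeff_eq_lc (a : WeylAlgebra K 1) : (normalForm K a).coeff (ord a) = lc a := rfl

/-- The equation that relates the symbols of the numerator and the denominator of a fraction that
commutes with `z`. -/
theorem lc_equation {z s a : WeylAlgebra K 1} (hz : 0 < ord z) {x : SkewField K} (hx : x ≠ 0)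
    (hs : s ≠ 0) (hzx : toSkew K z * x = x * toSkew K z) (h : toSkew K s * x = toSkew K a) :
    ((ord z : K[X]) * lc z * derivative (lc a) - ord a * lc a * derivative (lc z)) * lc s =
      ((ord z : K[X]) * lc z * derivative (lc s) - ord s * lc s * derivative (lc z)) * lc a := by
  have ha := num_ne_zero_of_mul_eq hs hx h
  -- Since z commutes with x, [z, s] x = [z, s x]; thus [z, s] and [z, a] represent x as well, if
  -- [z, s] ≠ 0.
  have hc : toSkew K (z * s - s * z) * x = toSkew K (z * a - a * z) := by
    rw [map_sub, map_sub, map_mul, map_mul, map_mul, map_mul, ← h, sub_mul, mul_assoc, mul_assoc,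
      hzx, mul_assoc]
  obtain ⟨d, hd⟩ : ∃ d, ord z = d + 1 := ⟨ord z - 1, by omega⟩
  have hbr : ∀ b : WeylAlgebra K 1, (normalForm K (z * b - b * z)).coeff (d + ord b) =
      (ord z : K[X]) * lc z * derivative (lc b) - ord b * lc b * derivative (lc z) ∧
      ord (z * b - b * z) ≤ d + ord b := by
    intro b
    have h1 := coeff_X_mul_normalForm_commutator (a := z) (b := b) le_rfl le_rfl
    change (X * normalForm K (z * b - b * z)).coeff (ord z + ord b) =
      (ord z : K[X]) * lc z * derivative (lc b) - ord b * lc b * derivative (lc z) at h1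
    refine ⟨?_, ?_⟩
    · rw [← h1, hd, show d + 1 + ord b = d + ord b + 1 by ring, coeff_X_mul]
    · have h2 : ord (z * b - b * z) ≤ ord z + ord b := by
        rw [ord, map_sub]
        refine (natDegree_sub_le_of_le (normalForm_mul_natDegree_le le_rfl le_rfl)
          (normalForm_mul_natDegree_le le_rfl le_rfl)).trans ?_
        simp only [ord]
        omega
      by_contra! hlt
      have h3 : ord (z * b - b * z) = ord z + ord b := by omega
      have h4 : (normalForm K (z * b - b * z)).coeff (ord z + ord b) = 0 := by
        rw [map_sub, coeff_sub]
        simp only [ord]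
        rw [coeff_normalForm_mul le_rfl le_rfl, add_comm, coeff_normalForm_mul le_rfl le_rfl,
          mul_comm, sub_self]
      rw [← h3, coeff_eq_lc, lc_eq_zero] at h4
      rw [h4, ord, map_zero, natDegree_zero] at h3
      omega
  obtain ⟨h1, h2⟩ := hbr a
  obtain ⟨h3, h4⟩ := hbr s
  rw [← h1, ← h3]
  by_cases hs0 : z * s - s * z = 0
  · rw [hs0, map_zero, zero_mul, eq_comm, ← map_zero (toSkew K)] at hc
    rw [hs0, toSkew_injective hc]
    simp
  · have ha0 := num_ne_zero_of_mul_eq hs0 hx hc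
    obtain ⟨h5, h6⟩ := skewOrd_skewLc_eq hs0 hx hc
    obtain ⟨h7, h8⟩ := skewOrd_skewLc_eq hs hx h
    rw [h5] at h7
    rw [h6, div_eq_div_iff (algebraMap_lc_ne_zero hs0) (algebraMap_lc_ne_zero hs), ← map_mul,
      ← map_mul] at h8
    have h9 := RatFunc.algebraMap_injective K h8
    -- Both fractions give x the same order, so the two expected top coefficients vanish together or
    -- are both leading coefficients.
    rcases lt_or_eq_of_le h4 with h10 | h10
    · rw [show (normalForm K (z * a - a * z)).coeff (d + ord a) = 0 from
        coeff_eq_zero_of_natDegree_lt (by change ord _ < _; omega),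
        show (normalForm K (z * s - s * z)).coeff (d + ord s) = 0 from
        coeff_eq_zero_of_natDegree_lt (by change ord _ < _; omega), zero_mul, zero_mul]
    · rw [← h10, show d + ord a = ord (z * a - a * z) by omega, coeff_eq_lc, coeff_eq_lc, h9,
        mul_comm]

/-- Dividing by the gcd keeps the Wronskian zero, and coprime polynomials with zero Wronskian have
zero derivative, hence are constant in characteristic zero. -/
theorem exists_eq_C_mul_of_wronskian [CharZero K] {f g : K[X]} (hg : g ≠ 0)
    (h : derivative f * g = f * derivative g) : ∃ c : K, f = C c * g := by
  classical
  set d := EuclideanDomain.gcd f g with hd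
  have hd0 : d ≠ 0 := fun h => hg (EuclideanDomain.gcd_eq_zero_iff.mp h).2
  obtain ⟨u, hu⟩ : d ∣ f := EuclideanDomain.gcd_dvd_left f g
  obtain ⟨v, hv⟩ : d ∣ g := EuclideanDomain.gcd_dvd_right f g
  have hcop : IsCoprime u v := by
    refine ⟨EuclideanDomain.gcdA f g, EuclideanDomain.gcdB f g, ?_⟩
    apply mul_left_cancel₀ hd0
    have := EuclideanDomain.gcd_eq_gcd_ab f g
    rw [← hd] at this
    linear_combination -this - EuclideanDomain.gcdA f g * hu - EuclideanDomain.gcdB f g * hv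
  have hW : wronskian u v = 0 := by
    apply mul_left_cancel₀ (mul_ne_zero hd0 hd0)
    rw [hu, hv, derivative_mul, derivative_mul] at h
    rw [wronskian, mul_zero]
    linear_combination -h
  obtain ⟨h1, h2⟩ := hcop.wronskian_eq_zero_iff.mp hW
  have hu' := eq_C_of_natDegree_eq_zero (derivative_eq_zero.mp h1)
  have hv' := eq_C_of_natDegree_eq_zero (derivative_eq_zero.mp h2)
  have hv0 : v.coeff 0 ≠ 0 := by
    intro h
    rw [h, C_0] at hv'
    exact hg (by rw [hv, hv', mul_zero])
  refine ⟨u.coeff 0 / v.coeff 0, ?_⟩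
  have h3 : u = C (u.coeff 0 / v.coeff 0) * v := by
    conv_rhs => rw [hv', ← C_mul, coeff_C_zero, div_mul_cancel₀ _ hv0]
    exact hu'
  rw [hu, hv, mul_left_comm, ← h3]

/-- Elements of the skew field that commute with `z` and have the same order have proportional
leading coefficients. -/
theorem exists_skewLc_eq [CharZero K] {z : WeylAlgebra K 1} (hz : 0 < ord z) {x y : SkewField K}
    (hx : x ≠ 0) (hy : y ≠ 0) (hzx : toSkew K z * x = x * toSkew K z)
    (hzy : toSkew K z * y = y * toSkew K z) (hxy : skewOrd x = skewOrd y) :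
    ∃ c : K, c ≠ 0 ∧ skewLc x = algebraMap K[X] (RatFunc K) (C c) * skewLc y := by
  obtain ⟨s, a, b, hs, ha, hb⟩ := exists_mul_eq_toSkew_pair x y
  have h1 := lc_equation hz hx hs hzx ha
  have h2 := lc_equation hz hy hs hzy hb
  obtain ⟨h3, h4⟩ := skewOrd_skewLc_eq hs hx ha
  obtain ⟨h5, h6⟩ := skewOrd_skewLc_eq hs hy hb
  have hord : ord a = ord b := by omega
  have hz0 : z ≠ 0 := by
    rintro rfl
    simp [ord] at hz
  have hd : ((ord z : ℕ) : K[X]) ≠ 0 := by exact_mod_cast hz.ne'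
  -- Over a common denominator and with equal orders, the terms with derivatives of `lc s` and `lc
  -- z` cancel between the two equations.
  have hW : derivative (lc a) * lc b = lc a * derivative (lc b) := by
    have hne : (ord z : K[X]) * lc z * lc s ≠ 0 :=
      mul_ne_zero (mul_ne_zero hd (mt lc_eq_zero.mp hz0)) (mt lc_eq_zero.mp hs)
    apply mul_left_cancel₀ hne
    rw [hord] at h1
    linear_combination lc b * h1 - lc a * h2
  have hb0 := num_ne_zero_of_mul_eq hs hy hb
  have ha0 := num_ne_zero_of_mul_eq hs hx ha
  obtain ⟨c, hc⟩ := exists_eq_C_mul_of_wronskian (mt lc_eq_zero.mp hb0) hW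
  refine ⟨c, ?_, ?_⟩
  · rintro rfl
    rw [C_0, zero_mul] at hc
    exact mt lc_eq_zero.mp ha0 hc
  · rw [h4, h6, hc, map_mul, mul_div_assoc]

/-- The order function on the centralizer of `z` in the skew field. -/
theorem isOneDimOrder_centralizer [CharZero K] {z : WeylAlgebra K 1} (hz : 0 < ord z) :
    IsOneDimOrder K fun x : Subalgebra.centralizer K {toSkew K z} => skewOrd (x : SkewField K) where
  mul x y hx hy := (skewOrd_skewLc_mul (by simpa using hx) (by simpa using hy)).1
  add x y hx hy hxy := skewOrd_add_le (by simpa using hx) (by simpa using hy)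
    (fun h => hxy (Subtype.ext h))
  smul c x hc hx := (skewOrd_skewLc_smul hc (by simpa using hx)).1
  oneDim x y hx hy hxy := by
    have hx0 : (x : SkewField K) ≠ 0 := by simpa using hx
    have hy0 : (y : SkewField K) ≠ 0 := by simpa using hy
    obtain ⟨c, hc, h⟩ := exists_skewLc_eq hz hx0 hy0
      (Subalgebra.mem_centralizer_iff K |>.mp x.2 _ rfl)
      (Subalgebra.mem_centralizer_iff K |>.mp y.2 _ rfl) hxy
    obtain ⟨h1, h2⟩ := skewOrd_skewLc_smul hc hy0
    refine ⟨c, (skewOrd_sub_lt hx0 (smul_ne_zero hc hy0) (hxy.trans h1.symm)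
      (h.trans h2.symm)).imp (fun h => Subtype.ext h) id⟩
  commutator x y hx hy := (skewOrd_commutator_lt (by simpa using hx) (by simpa using hy)).imp
    (fun h => Subtype.ext h) id

theorem commute_of_commute_toSkew [CharZero K] {z : WeylAlgebra K 1} (hz : 0 < ord z)
    {x y : SkewField K} (hx : toSkew K z * x = x * toSkew K z)
    (hy : toSkew K z * y = y * toSkew K z) : x * y = y * x := by
  have hmem : ∀ {x : SkewField K}, toSkew K z * x = x * toSkew K z →
      x ∈ Subalgebra.centralizer K {toSkew K z} := fun h => by
    rw [Subalgebra.mem_centralizer_iff]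
    rintro _ rfl
    exact h
  have hz0 : z ≠ 0 := by
    rintro rfl
    simp [ord] at hz
  have h := (isOneDimOrder_centralizer hz).mul_comm (z := ⟨toSkew K z, hmem rfl⟩)
    (by
      change 0 < skewOrd (toSkew K z)
      rw [skewOrd_toSkew hz0]
      exact_mod_cast hz)
    (fun h => toSkew_ne_zero hz0 (congrArg Subtype.val h))
    (fun x => Subtype.ext (Subalgebra.mem_centralizer_iff K |>.mp x.2 _ rfl))
    ⟨x, hmem hx⟩ ⟨y, hmem hy⟩
  exact congrArg Subtype.val h

/-- Centralizers of non-scalar elements of `A_1` are commutative. -/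
theorem commute_of_mem_C [CharZero K] {z : WeylAlgebra K 1}
    (hz : z ∉ Set.range (algebraMap K (WeylAlgebra K 1))) {x y : WeylAlgebra K 1}
    (hx : x ∈ ElementType.C K z) (hy : y ∈ ElementType.C K z) : x * y = y * x := by
  rw [ElementType.mem_C_iff, ElementType.ad_apply] at hx hy
  rcases Nat.eq_zero_or_pos (ord z) with h0 | h0
  -- Here z is a nonconstant polynomial in `p`, and only polynomials in `p` commute with it.
  · have key : ∀ a : WeylAlgebra K 1, z * a - a * z = 0 → ord a = 0 := by
      intro a ha
      by_contra hne
      have h1 := coeff_X_mul_normalForm_commutator (a := z) (b := a) le_rfl le_rfl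
      change (X * normalForm K (z * a - a * z)).coeff (ord z + ord a) =
        (ord z : K[X]) * lc z * derivative (lc a) - ord a * lc a * derivative (lc z) at h1
      rw [ha, map_zero, mul_zero, coeff_zero, h0, Nat.cast_zero, zero_mul, zero_mul, zero_sub,
        eq_comm, neg_eq_zero, mul_eq_zero, mul_eq_zero, lc_eq_zero] at h1
      rcases h1 with (h1 | h1) | h1
      · exact hne (by exact_mod_cast h1)
      · rw [h1, ord, map_zero, natDegree_zero] at hne
        exact hne rfl
      · apply hz
        refine ⟨(lc z).coeff 0, ?_⟩
        conv_rhs => rw [exists_aeval_p_of_ord_eq_zero h0,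
          eq_C_of_natDegree_eq_zero (derivative_eq_zero.mp h1), aeval_C]
    rw [exists_aeval_p_of_ord_eq_zero (key x hx), exists_aeval_p_of_ord_eq_zero (key y hy),
      ← map_mul, ← map_mul, mul_comm]
  · apply toSkew_injective
    rw [map_mul, map_mul]
    exact commute_of_commute_toSkew h0
      (by rw [← map_mul, ← map_mul, sub_eq_zero.mp hx])
      (by rw [← map_mul, ← map_mul, sub_eq_zero.mp hy])

end WeylAlgebra

end

/-! ### Eigenvectors of `ad z` and the equality C(z) = K[z]. -/

noncomputable section

namespace WeylAlgebra

open Polynomial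

variable {K : Type*} [Field K]

/-- In order zero the commutator loses the top degree of x, while c x keeps it. -/
theorem ord_pos_of_eigenvector {z x : WeylAlgebra K 1} {c : K} (hc : c ≠ 0) (hx : x ≠ 0)
    (hzx : ElementType.ad K z x = c • x) : 0 < ord z := by
  by_contra! h
  have h1 : (normalForm K (z * x - x * z)).coeff (ord z + ord x) = 0 := by
    rw [map_sub, coeff_sub]
    simp only [ord]
    rw [coeff_normalForm_mul le_rfl le_rfl, add_comm, coeff_normalForm_mul le_rfl le_rfl,
      mul_comm, sub_self]
  rw [← ElementType.ad_apply (K := K), hzx, map_smul, coeff_smul, Nat.le_zero.mp h, zero_add,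
    coeff_eq_lc] at h1
  exact smul_ne_zero hc (mt lc_eq_zero.mp hx) h1

/-- Conjugation by a nonzero element of the skew field. -/
def conjSkew {x : SkewField K} (hx : x ≠ 0) : SkewField K →ₐ[K] SkewField K where
  toFun l := x * l * x⁻¹
  map_one' := by rw [mul_one, mul_inv_cancel₀ hx]
  map_mul' a b := by
    simp only [mul_assoc]
    rw [← mul_assoc x⁻¹ x, inv_mul_cancel₀ hx, one_mul]
  map_zero' := by rw [mul_zero, zero_mul]
  map_add' a b := by rw [mul_add, add_mul]
  commutes' c := by
    rw [← Algebra.commutes, mul_assoc, mul_inv_cancel₀ hx, mul_one]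

theorem conjSkew_mul {x : SkewField K} (hx : x ≠ 0) (l : SkewField K) :
    conjSkew hx l * x = x * l := by
  change x * l * x⁻¹ * x = x * l
  rw [mul_assoc, inv_mul_cancel₀ hx, mul_one]

/-- Leading coefficients commute, so conjugation preserves both the order and the leading
coefficient. -/
theorem skewOrd_conjSkew_sub {x : SkewField K} (hx : x ≠ 0) {l : SkewField K} (hl : l ≠ 0) :
    conjSkew hx l - l = 0 ∨ skewOrd (conjSkew hx l - l) < skewOrd l := by
  have hl' : conjSkew hx l ≠ 0 := (map_ne_zero_iff _ (conjSkew hx).injective).mpr hl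
  have h := conjSkew_mul hx l
  obtain ⟨h1, h2⟩ := skewOrd_skewLc_mul hl' hx
  obtain ⟨h3, h4⟩ := skewOrd_skewLc_mul hx hl
  rw [h] at h1 h2
  have h5 : skewOrd (conjSkew hx l) = skewOrd l := by omega
  have hx0 : skewLc x ≠ 0 :=
    div_ne_zero (algebraMap_lc_ne_zero
      (num_ne_zero_of_mul_eq (skewDen_ne_zero x) hx (skewDen_mul x)))
      (algebraMap_lc_ne_zero (skewDen_ne_zero x))
  rw [← h5]
  refine skewOrd_sub_lt hl' hl h5 (mul_right_cancel₀ hx0 ?_)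
  rw [← h2, h4, mul_comm]

section

variable (z : WeylAlgebra K 1)

/-- The centralizer of `z` in the skew field. -/
abbrev skewCentralizer : Subalgebra K (SkewField K) := Subalgebra.centralizer K {toSkew K z}

theorem mem_skewCentralizer {z : WeylAlgebra K 1} {l : SkewField K} :
    l ∈ skewCentralizer z ↔ toSkew K z * l = l * toSkew K z := by
  rw [Subalgebra.mem_centralizer_iff]
  simp

/-- The subspaces generated by `C(z) σ(C(z)) ⋯ σ ^ m (C(z))`. -/
def twistedProd (σ : skewCentralizer z →ₐ[K] skewCentralizer z) :
    ℕ → Submodule K (skewCentralizer z)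
  | 0 => (LinearMap.range (toSkew K).toLinearMap).comap (skewCentralizer z).val.toLinearMap
  | m + 1 => (LinearMap.range (toSkew K).toLinearMap).comap (skewCentralizer z).val.toLinearMap *
      (twistedProd σ m).map σ.toLinearMap

variable {z} (σ : skewCentralizer z →ₐ[K] skewCentralizer z)

theorem twistedProd_succ (m : ℕ) : twistedProd z σ (m + 1) =
    twistedProd z σ 0 * (twistedProd z σ m).map σ.toLinearMap := rfl

theorem one_mem_twistedProd (m : ℕ) : (1 : skewCentralizer z) ∈ twistedProd z σ m := by
  induction m with
  | zero => exact ⟨1, map_one (toSkew K)⟩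
  | succ m ih =>
    have := Submodule.mul_mem_mul (show (1 : skewCentralizer z) ∈ twistedProd z σ 0 from
      ⟨1, map_one (toSkew K)⟩) (Submodule.mem_map_of_mem (f := σ.toLinearMap) ih)
    rwa [AlgHom.toLinearMap_apply, map_one, mul_one] at this

theorem twistedProd_le_succ (m : ℕ) : twistedProd z σ m ≤ twistedProd z σ (m + 1) := by
  induction m with
  | zero =>
    intro l hl
    have := Submodule.mul_mem_mul hl (Submodule.mem_map_of_mem (f := σ.toLinearMap)
      (one_mem_twistedProd σ 0))
    rwa [AlgHom.toLinearMap_apply, map_one, mul_one] at this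
  | succ m ih =>
    rw [twistedProd_succ σ m, twistedProd_succ σ (m + 1)]
    exact mul_le_mul' le_rfl (Submodule.map_mono ih)

theorem map_mem_twistedProd {m : ℕ} {l : skewCentralizer z} (hl : l ∈ twistedProd z σ m) :
    σ l ∈ twistedProd z σ (m + 1) := by
  have := Submodule.mul_mem_mul (one_mem_twistedProd σ 0)
    (Submodule.mem_map_of_mem (f := σ.toLinearMap) hl)
  rwa [one_mul] at this

theorem twistedProd_mul_le (hcomm : ∀ a b : skewCentralizer z, a * b = b * a) (m : ℕ) :
    twistedProd z σ m * twistedProd z σ m ≤ twistedProd z σ m := by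
  have h0 : twistedProd z σ 0 * twistedProd z σ 0 ≤ twistedProd z σ 0 := by
    rw [Submodule.mul_le]
    rintro a ⟨u, hu⟩ b ⟨v, hv⟩
    exact ⟨u * v, (map_mul (toSkew K) u v).trans (congrArg₂ _ hu hv)⟩
  induction m with
  | zero => exact h0
  | succ m ih =>
    have hc := Submodule.mul_comm_of_commute (M := (twistedProd z σ m).map σ.toLinearMap)
      (N := twistedProd z σ 0) (fun a _ b _ => hcomm a b)
    rw [twistedProd_succ, mul_assoc, ← mul_assoc (Submodule.map _ _), hc, mul_assoc, ← mul_assoc]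
    refine mul_le_mul' h0 ?_
    rw [← Submodule.map_mul]
    exact Submodule.map_mono ih

theorem pow_mem_twistedProd (hcomm : ∀ a b : skewCentralizer z, a * b = b * a) {m : ℕ}
    {l : skewCentralizer z} (hl : l ∈ twistedProd z σ m) (n : ℕ) : l ^ n ∈ twistedProd z σ m := by
  induction n with
  | zero => rw [pow_zero]; exact one_mem_twistedProd σ m
  | succ n ih =>
    rw [pow_succ]
    exact twistedProd_mul_le σ hcomm m (Submodule.mul_mem_mul ih hl)

/-- Each factor x absorbs one application of σ through σ(l) x = x l, so x^m brings the whole product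
back into A₁. -/
theorem exists_mul_pow_eq_toSkew {x : WeylAlgebra K 1}
    (hσ : ∀ l : skewCentralizer z, (σ l : SkewField K) * toSkew K x = toSkew K x * l) (m : ℕ)
    {l : skewCentralizer z} (hl : l ∈ twistedProd z σ m) :
    ∃ a, (l : SkewField K) * toSkew K x ^ m = toSkew K a := by
  induction m generalizing l with
  | zero =>
    obtain ⟨a, ha⟩ := hl
    exact ⟨a, by rw [pow_zero, mul_one]; exact ha.symm⟩
  | succ m ih =>
    rw [twistedProd_succ] at hl
    induction hl using Submodule.mul_induction_on' with
    | mem_mul_mem b hb r hr =>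
      obtain ⟨b', hb'⟩ := hb
      obtain ⟨r, hr, rfl⟩ := hr
      obtain ⟨a, ha⟩ := ih hr
      refine ⟨b' * (x * a), ?_⟩
      rw [map_mul, map_mul, ← ha, pow_succ', ← mul_assoc (toSkew K x), ← hσ]
      have : toSkew K b' = (b : SkewField K) := hb'
      rw [this]
      simp only [MulMemClass.coe_mul, AlgHom.toLinearMap_apply, mul_assoc]
    | add l _ l' _ h h' =>
      obtain ⟨a, ha⟩ := h
      obtain ⟨a', ha'⟩ := h'
      exact ⟨a + a', by rw [map_add, ← ha, ← ha', ← add_mul]; rfl⟩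

/-- Every power lⁿ lies in the same product space, so lⁿ x^m lies in A₁ with the same m for all n. A
negative order of l would make these orders negative. -/
theorem skewOrd_nonneg_of_mem_twistedProd (hcomm : ∀ a b : skewCentralizer z, a * b = b * a)
    {x : WeylAlgebra K 1} (hx : x ≠ 0)
    (hσ : ∀ l : skewCentralizer z, (σ l : SkewField K) * toSkew K x = toSkew K x * l) {m : ℕ}
    {l : skewCentralizer z} (hl : l ∈ twistedProd z σ m) (hl0 : l ≠ 0) :
    0 ≤ skewOrd (l : SkewField K) := by
  by_contra! hneg
  have hl1 : (l : SkewField K) ≠ 0 := by simpa using hl0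
  have hpow : ∀ {y : SkewField K}, y ≠ 0 → ∀ n : ℕ, skewOrd (y ^ n) = n * skewOrd y := by
    intro y hy n
    induction n with
    | zero =>
      have := (skewOrd_skewLc_mul (one_ne_zero (α := SkewField K)) one_ne_zero).1
      rw [mul_one] at this
      rw [pow_zero, Nat.cast_zero, zero_mul]
      omega
    | succ n ih =>
      rw [pow_succ, (skewOrd_skewLc_mul (pow_ne_zero n hy) hy).1, ih]
      push_cast
      ring
  -- The exponent exceeds the order of x^m by one, more than x^m can compensate.
  obtain ⟨a, ha⟩ := exists_mul_pow_eq_toSkew σ hσ m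
    (pow_mem_twistedProd σ hcomm hl (m * ord x + 1))
  rw [SubmonoidClass.coe_pow] at ha
  have hx' := toSkew_ne_zero hx
  have hne := mul_ne_zero (pow_ne_zero (m * ord x + 1) hl1) (pow_ne_zero m hx')
  have ha0 : a ≠ 0 := by
    rintro rfl
    rw [map_zero] at ha
    exact hne ha
  have h := congrArg skewOrd ha
  rw [(skewOrd_skewLc_mul (pow_ne_zero _ hl1) (pow_ne_zero _ hx')).1, hpow hl1, hpow hx',
    skewOrd_toSkew hx, skewOrd_toSkew ha0] at h
  have h1 : ((m * ord x + 1 : ℕ) : ℤ) * skewOrd (l : SkewField K) ≤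
      ((m * ord x + 1 : ℕ) : ℤ) * (-1) := mul_le_mul_of_nonneg_left (by omega) (by positivity)
  push_cast at h h1
  linarith [Int.natCast_nonneg (ord a)]

end

/-- If `ad z` has a nonzero eigenvalue, then `C(z) = K[z]`. -/
theorem centralizer_eq_adjoin_of_eigenvector [CharZero K] {z x : WeylAlgebra K 1} {c : K}
    (hc : c ≠ 0) (hx : x ≠ 0) (hzx : ElementType.ad K z x = c • x) :
    ElementType.C K z = Algebra.adjoin K {z} := by
  have hz := ord_pos_of_eigenvector hc hx hzx
  have hz0 : z ≠ 0 := by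
    rintro rfl
    simp [ord] at hz
  have hx' := toSkew_ne_zero hx
  have hzx' : conjSkew hx' (toSkew K z) = toSkew K z - c • 1 := by
    apply mul_right_cancel₀ hx'
    rw [conjSkew_mul, sub_mul, smul_mul_assoc, one_mul, ← map_mul, ← map_mul, ← map_smul, ← map_sub,
      ← hzx, ElementType.ad_apply, sub_sub_cancel]
  -- z is the conjugate of z + c, and l commutes with z + c.
  have hstab : ∀ l : skewCentralizer z, conjSkew hx' l ∈ skewCentralizer z := by
    intro l
    have h1 : toSkew K z = conjSkew hx' (toSkew K z + c • 1) := by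
      rw [map_add, hzx', map_smul, map_one, sub_add_cancel]
    have h2 : (toSkew K z + c • 1) * (l : SkewField K) = l * (toSkew K z + c • 1) := by
      rw [add_mul, mul_add, mem_skewCentralizer.mp l.2, smul_mul_assoc, mul_smul_comm, one_mul,
        mul_one]
    rw [mem_skewCentralizer]
    conv_lhs => rw [h1, ← map_mul, h2, map_mul, ← h1]
  let σ : skewCentralizer z →ₐ[K] skewCentralizer z :=
    ((conjSkew hx').comp (skewCentralizer z).val).codRestrict _ hstab
  have hσ : ∀ l : skewCentralizer z, (σ l : SkewField K) * toSkew K x = toSkew K x * l :=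
    fun l => conjSkew_mul hx' _
  have hcomm : ∀ a b : skewCentralizer z, a * b = b * a := fun a b => Subtype.ext
    (commute_of_commute_toSkew hz (mem_skewCentralizer.mp a.2) (mem_skewCentralizer.mp b.2))
  have ho := isOneDimOrder_centralizer hz
  have hmono : Monotone (twistedProd z σ) := monotone_nat_of_le_succ (twistedProd_le_succ σ)
  have hmem : ∀ l, l ∈ ⨆ m, twistedProd z σ m ↔ ∃ m, l ∈ twistedProd z σ m :=
    fun l => Submodule.mem_iSup_of_directed _ hmono.directed_le
  let Z : skewCentralizer z := ⟨toSkew K z, mem_skewCentralizer.mpr rfl⟩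
  have hZ0 : Z ≠ 0 := fun h => toSkew_ne_zero hz0 (congrArg Subtype.val h)
  obtain ⟨d, hd⟩ : ∃ d, ord z = d + 1 := ⟨ord z - 1, by omega⟩
  apply le_antisymm
  · intro w hw
    rw [ElementType.mem_C_iff, ElementType.ad_apply, sub_eq_zero] at hw
    let W : skewCentralizer z := ⟨toSkew K w, mem_skewCentralizer.mpr (by
      rw [← map_mul, ← map_mul, hw])⟩
    -- The union of the `twistedProd z σ m` contains C(z) at level zero, is stable under σ and has
    -- no negative orders.
    have hW := ho.mem_adjoin_of_shift_stable hcomm σ (fun l hl => by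
        refine (skewOrd_conjSkew_sub hx' (l := l) (by simpa using hl)).imp
          (fun h => Subtype.ext h) fun h => ?_
        exact Int.le_sub_one_of_lt h) hZ0 (d := d) (by
          change skewOrd (toSkew K z) = _
          rw [skewOrd_toSkew hz0, hd]
          push_cast
          rfl) hc (Subtype.ext hzx') (⨆ m, twistedProd z σ m)
        (fun n => (hmem _).mpr ⟨0, z ^ n, map_pow (toSkew K) z n⟩)
        (fun l hl => by
          obtain ⟨m, hm⟩ := (hmem l).mp hl
          exact (hmem _).mpr ⟨m + 1, map_mem_twistedProd σ hm⟩)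
        (fun l hl hl0 => by
          obtain ⟨m, hm⟩ := (hmem l).mp hl
          exact skewOrd_nonneg_of_mem_twistedProd σ hcomm hx hσ hm hl0)
        (x := W) ((hmem _).mpr ⟨0, w, rfl⟩)
    have hle : Submodule.span K (Set.range fun n : ℕ => Z ^ n) ≤
        ((Subalgebra.toSubmodule (Algebra.adjoin K {z})).map (toSkew K).toLinearMap).comap
          (skewCentralizer z).val.toLinearMap := by
      rw [Submodule.span_le]
      rintro _ ⟨n, rfl⟩
      exact ⟨z ^ n, pow_mem (Algebra.subset_adjoin (Set.mem_singleton z)) n, map_pow (toSkew K) z n⟩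
    obtain ⟨w', hw', h⟩ := hle hW
    have : w' = w := toSkew_injective h
    rwa [← this]
  · rw [Algebra.adjoin_le_iff]
    rintro _ rfl
    rw [SetLike.mem_coe, ElementType.mem_C_iff, ElementType.ad_apply, sub_self]

end WeylAlgebra

end

/-! ### Slices of tensors. -/

noncomputable section

namespace TensorProduct

variable {K A B : Type*} [Field K] [AddCommGroup A] [Module K A] [AddCommGroup B] [Module K B]

/-- The slice of a tensor by a functional on the second factor. -/
def slice (g : B →ₗ[K] K) : A ⊗[K] B →ₗ[K] A :=
  (TensorProduct.rid K A).toLinearMap.comp (LinearMap.lTensor A g)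

@[simp]
theorem slice_tmul (g : B →ₗ[K] K) (a : A) (b : B) : slice g (a ⊗ₜ[K] b) = g b • a := by
  simp [slice]

theorem slice_add_left (g h : B →ₗ[K] K) (u : A ⊗[K] B) :
    slice (g + h) u = slice g u + slice h u := by
  rw [slice, LinearMap.lTensor_add]
  simp [slice]

theorem slice_sub_left (g h : B →ₗ[K] K) (u : A ⊗[K] B) :
    slice (g - h) u = slice g u - slice h u := by
  rw [slice, LinearMap.lTensor_sub]
  simp [slice]

theorem slice_smul_left (c : K) (g : B →ₗ[K] K) (u : A ⊗[K] B) :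
    slice (c • g) u = c • slice g u := by
  rw [slice, LinearMap.lTensor_smul]
  simp [slice]

/-- Links the slices in the two directions: both sides are f ⊗ g evaluated at u. -/
theorem apply_slice_comm (f : A →ₗ[K] K) (g : B →ₗ[K] K) (u : A ⊗[K] B) :
    g (slice f (TensorProduct.comm K A B u)) = f (slice g u) := by
  induction u with
  | zero => simp
  | add u v hu hv => simp only [map_add, hu, hv]
  | tmul a b => simp [mul_comm]

/-- The coordinates of u in a basis of the second factor are slices. -/
theorem eq_zero_of_forall_slice_eq_zero {u : A ⊗[K] B}
    (h : ∀ g : B →ₗ[K] K, slice g u = 0) : u = 0 := by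
  classical
  let b := Module.Basis.ofVectorSpace K B
  apply (TensorProduct.equivFinsuppOfBasisRight (M := A) b).injective
  rw [map_zero]
  ext1 i
  rw [TensorProduct.equivFinsuppOfBasisRight_apply]
  exact h (b.coord i)

theorem ext_slice {u v : A ⊗[K] B} (h : ∀ g : B →ₗ[K] K, slice g u = slice g v) : u = v := by
  rw [← sub_eq_zero]
  exact eq_zero_of_forall_slice_eq_zero fun g => by rw [map_sub, h, sub_self]

theorem eq_of_forall_functional_eq {a b : A} (h : ∀ f : A →ₗ[K] K, f a = f b) : a = b := by
  rw [← sub_eq_zero, ← Module.forall_dual_apply_eq_zero_iff K]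
  intro f
  rw [map_sub, h, sub_self]

/-- The space of all slices of a tensor. -/
def slices (u : A ⊗[K] B) : Submodule K A :=
  LinearMap.range ({ toFun := fun g => slice g u
                     map_add' := fun g h => slice_add_left g h u
                     map_smul' := fun c g => slice_smul_left c g u } : (B →ₗ[K] K) →ₗ[K] A)

theorem slice_mem_slices (g : B →ₗ[K] K) (u : A ⊗[K] B) : slice g u ∈ slices u := ⟨g, rfl⟩

instance (u : A ⊗[K] B) : FiniteDimensional K (slices u) := by
  induction u with
  | zero =>
    refine Submodule.finiteDimensional_of_le (S₂ := ⊥) ?_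
    rintro _ ⟨g, rfl⟩
    exact map_zero (slice g)
  | add u v hu hv =>
    refine Submodule.finiteDimensional_of_le (S₂ := slices u ⊔ slices v) ?_
    rintro _ ⟨g, rfl⟩
    exact (map_add (slice g) u v) ▸ add_mem
      (Submodule.mem_sup_left (slice_mem_slices g u)) (Submodule.mem_sup_right (slice_mem_slices g v))
  | tmul a b =>
    refine Submodule.finiteDimensional_of_le (S₂ := Submodule.span K {a}) ?_
    rintro _ ⟨g, rfl⟩
    exact (slice_tmul g a b) ▸ Submodule.smul_mem _ _ (Submodule.mem_span_singleton_self a)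

theorem slice_map {A' B' : Type*} [AddCommGroup A'] [Module K A'] [AddCommGroup B'] [Module K B']
    (f : A →ₗ[K] A') (h : B →ₗ[K] B') (g : B' →ₗ[K] K) (u : A ⊗[K] B) :
    slice g (TensorProduct.map f h u) = f (slice (g.comp h) u) := by
  induction u with
  | zero => simp
  | add u v hu hv => simp only [map_add, hu, hv]
  | tmul a b => simp

/-- A tensor with slices in `P` and `Q` comes from `P ⊗ Q`. -/
theorem mem_range_map_subtype {P : Submodule K A} {Q : Submodule K B} {u : A ⊗[K] B}
    (hP : ∀ g, slice g u ∈ P) (hQ : ∀ f, slice f (TensorProduct.comm K A B u) ∈ Q) :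
    ∃ t : P ⊗[K] Q, TensorProduct.map P.subtype Q.subtype t = u := by
  obtain ⟨ρ, hρ⟩ := P.subtype.exists_leftInverse_of_injective P.ker_subtype
  obtain ⟨π, hπ⟩ := Q.subtype.exists_leftInverse_of_injective Q.ker_subtype
  have hρ' : ∀ a (ha : a ∈ P), (ρ a : A) = a := fun a ha =>
    congrArg Subtype.val (LinearMap.congr_fun hρ ⟨a, ha⟩)
  have hπ' : ∀ b (hb : b ∈ Q), (π b : B) = b := fun b hb =>
    congrArg Subtype.val (LinearMap.congr_fun hπ ⟨b, hb⟩)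
  -- Projections onto P and Q do not change u, which can be tested by pairs of functionals.
  refine ⟨TensorProduct.map ρ π u, ext_slice fun g => ?_⟩
  rw [slice_map, slice_map, Submodule.subtype_apply, hρ' _ (hP _)]
  refine eq_of_forall_functional_eq (K := K) fun f => ?_
  rw [← apply_slice_comm f ((g.comp Q.subtype).comp π) u, ← apply_slice_comm f g u]
  change g (π (slice f _) : B) = _
  rw [hπ' _ (hQ f)]

end TensorProduct

/-! ### Commuting operators on finite-dimensional subspaces. -/

section Operators

variable {K A : Type*} [Field K] [IsAlgClosed K] [AddCommGroup A] [Module K A]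

/-- An endomorphism of a finite-dimensional space whose only eigenvalue is `c` becomes nilpotent on
subtracting `c`. -/
theorem exists_sub_smul_pow_eq_zero {V : Type*} [AddCommGroup V] [Module K V] [FiniteDimensional K V]
    {φ : Module.End K V} {c : K} (h : ∀ (v : V) (μ : K), v ≠ 0 → φ v = μ • v → μ = c) (v : V) :
    ∃ r : ℕ, ((φ - c • (1 : Module.End K V)) ^ r) v = 0 := by
  have hbot : ∀ μ : K, μ ≠ c → Module.End.maxGenEigenspace φ μ = ⊥ := by
    intro μ hμ
    have hinj : Function.Injective (φ - μ • (1 : Module.End K V)) := by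
      rw [← LinearMap.ker_eq_bot, LinearMap.ker_eq_bot']
      intro w hw
      by_contra hne
      refine hμ (h w μ hne ?_)
      rwa [LinearMap.sub_apply, LinearMap.smul_apply, Module.End.one_apply, sub_eq_zero] at hw
    rw [eq_bot_iff]
    intro w hw
    obtain ⟨k, hk⟩ := (Module.End.mem_maxGenEigenspace _ _ _).mp hw
    have : Function.Injective ((φ - μ • (1 : Module.End K V)) ^ k) := by
      rw [Module.End.coe_pow]
      exact hinj.iterate k
    exact this (by rw [hk, map_zero])
  have htop : Module.End.maxGenEigenspace φ c = ⊤ := by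
    rw [eq_top_iff, ← Module.End.iSup_maxGenEigenspace_eq_top φ]
    refine iSup_le fun μ => ?_
    by_cases hμ : μ = c
    · rw [hμ]
    · rw [hbot μ hμ]; exact bot_le
  exact (Module.End.mem_maxGenEigenspace φ c v).mp (htop ▸ Submodule.mem_top)

/-- If `b H ⊆ a H` for a finite-dimensional `H`, where `b v = μ • a v` forces `μ = 1`, then `a - b`
is nilpotent on `H`. -/
theorem exists_sub_pow_eq_zero {a b : Module.End K A} (hab : Commute a b)
    (ha : Function.Injective a) (h1 : ∀ (v : A) (μ : K), v ≠ 0 → b v = μ • a v → μ = 1)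
    {H : Submodule K A} [FiniteDimensional K H] (hH : H.map b ≤ H.map a) {v : A} (hv : v ∈ H) :
    ∃ r : ℕ, ((a - b) ^ r) v = 0 := by
  let e := H.equivMapOfInjective a ha
  -- φ is a⁻¹b on H. Its only eigenvalue is 1, so φ - 1 is nilpotent, and (b - a)^r = a^r (φ - 1)^r
  -- on H.
  let φ : Module.End K H := e.symm.toLinearMap.comp
    ((b.comp H.subtype).codRestrict (H.map a) fun w => hH (Submodule.mem_map_of_mem w.2))
  have hφ : ∀ w : H, a (φ w) = b w := by
    intro w
    have : e (φ w) = ⟨b w, hH (Submodule.mem_map_of_mem w.2)⟩ := e.apply_symm_apply _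
    exact congrArg Subtype.val this
  obtain ⟨r, hr⟩ := exists_sub_smul_pow_eq_zero (φ := φ) (c := 1) (fun w μ hw h =>
    h1 w μ (by simpa using hw) (by rw [← hφ, h, Submodule.coe_smul, map_smul])) ⟨v, hv⟩
  have key : ∀ (r : ℕ) (w : H), ((b - a) ^ r) w = (a ^ r) (((φ - (1 : K) • (1 : Module.End K H)) ^ r) w : H) := by
    intro r w
    induction r with
    | zero => rfl
    | succ r ih =>
      have hc : Commute (b - a) (a ^ r) :=
        ((hab.symm.sub_left (Commute.refl a)).pow_right r)
      rw [pow_succ', Module.End.mul_apply, ih, ← Module.End.mul_apply, hc.eq, Module.End.mul_apply,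
        pow_succ a, Module.End.mul_apply, pow_succ' (φ - (1 : K) • (1 : Module.End K H)),
        Module.End.mul_apply]
      congr 1
      rw [LinearMap.sub_apply, ← hφ, one_smul, LinearMap.sub_apply, Module.End.one_apply,
        Submodule.coe_sub, map_sub]
  refine ⟨r, ?_⟩
  have := key r ⟨v, hv⟩
  rw [hr, Submodule.coe_zero, map_zero] at this
  rw [← neg_sub, neg_pow, Module.End.mul_apply, this, map_zero]

/-- If `a` has no eigenvectors and `b V ⊆ a V + V` for a finite-dimensional `V ≠ 0`, then some
functional that kills `a V` is nonzero on `V` and an eigenvector of the transpose of `b` there. -/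
theorem exists_functional_of_map_le_sup {a b : Module.End K A} (hab : Commute a b)
    (ha : Function.Injective a) (ha' : ∀ (v : A) (μ : K), a v = μ • v → v = 0)
    {V : Submodule K A} [FiniteDimensional K V] (hV0 : V ≠ ⊥) (hV : V.map b ≤ V.map a ⊔ V) :
    ∃ (f : A →ₗ[K] K) (β : K), (∀ v ∈ V, f (a v) = 0) ∧ (∀ v ∈ V, f (b v) = β * f v) ∧
      ∃ v ∈ V, f v ≠ 0 := by
  -- W n is V + aV + ⋯ + aⁿV; the union U of the spaces a(W n) is stable under b.
  let W : ℕ → Submodule K A := fun n =>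
    Nat.rec (motive := fun _ => Submodule K A) V (fun _ W => V ⊔ W.map a) n
  have hW0 : W 0 = V := rfl
  have hWs : ∀ n, W (n + 1) = V ⊔ (W n).map a := fun n => rfl
  have hWf : ∀ n, FiniteDimensional K ↥(W n) := by
    intro n
    induction n with
    | zero => rw [hW0]; infer_instance
    | succ n ih => rw [hWs]; infer_instance
  have hWle : ∀ n, W n ≤ W (n + 1) := by
    intro n
    induction n with
    | zero => rw [hWs, hW0]; exact le_sup_left
    | succ n ih =>
      rw [hWs n, hWs (n + 1)]
      exact sup_le_sup_left (Submodule.map_mono ih) V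
  have hmono : Monotone W := monotone_nat_of_le_succ hWle
  have hbW : ∀ n, (W n).map b ≤ W (n + 1) := by
    intro n
    induction n with
    | zero => rw [hW0, hWs, hW0, sup_comm]; exact hV
    | succ n ih =>
      rw [hWs n, Submodule.map_sup]
      refine sup_le ?_ ?_
      · refine hV.trans (sup_le ?_ ?_)
        · rw [hWs (n + 1)]
          exact le_sup_of_le_right (Submodule.map_mono (hW0 ▸ hmono (Nat.zero_le (n + 1))))
        · rw [hWs (n + 1)]; exact le_sup_left
      · rw [← Submodule.map_comp, ← Module.End.mul_eq_comp, ← hab.eq, Module.End.mul_eq_comp,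
          Submodule.map_comp, hWs (n + 1)]
        exact le_sup_of_le_right (Submodule.map_mono ih)
  set U : Submodule K A := ⨆ n, (W n).map a with hU
  have hUmem : ∀ x, x ∈ U ↔ ∃ n, x ∈ (W n).map a := fun x =>
    Submodule.mem_iSup_of_directed _
      (Monotone.directed_le fun m n h => Submodule.map_mono (hmono h))
  -- Otherwise V ⊆ a(W n) for some n, and comparing dimensions gives a(W n) = W n, so a has an
  -- eigenvector there.
  have hVU : ¬ V ≤ U := by
    intro hle
    have hdir : Directed (· ≤ ·) fun n => (W n).map a :=
      Monotone.directed_le fun m n h => Submodule.map_mono (hmono h)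
    obtain ⟨n, hn⟩ : ∃ n, V ≤ (W n).map a := by
      obtain ⟨s, hs⟩ := (Module.Finite.iff_fg (N := V)).mp inferInstance
      have hex : ∀ x ∈ s, ∃ n, x ∈ (W n).map a := fun x hx =>
        (hUmem x).mp (hle (hs ▸ Submodule.subset_span hx))
      choose! N hN using hex
      refine ⟨s.sup N, ?_⟩
      rw [← hs, Submodule.span_le]
      intro x hx
      exact Submodule.map_mono (hmono (Finset.le_sup hx)) (hN x hx)
    have h1 : W (n + 1) = (W n).map a := by rw [hWs, sup_eq_right.mpr hn]
    have h2 : W n = (W n).map a := by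
      refine Submodule.eq_of_le_of_finrank_eq (h1 ▸ hWle n) ?_
      exact (LinearEquiv.finrank_eq ((W n).equivMapOfInjective a ha))
    have hmaps : ∀ x ∈ W n, a x ∈ W n := fun x hx => by
      rw [h2]; exact Submodule.mem_map_of_mem hx
    have : Nontrivial (W n) := by
      rw [Submodule.nontrivial_iff_ne_bot]
      intro hbot
      exact hV0 (eq_bot_iff.mpr (hbot ▸ hmono (Nat.zero_le n)))
    obtain ⟨μ, hμ⟩ := Module.End.exists_eigenvalue (a.restrict hmaps)
    obtain ⟨w, hw⟩ := hμ.exists_hasEigenvector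
    have hw1 := congrArg Subtype.val hw.apply_eq_smul
    refine hw.2 (Subtype.ext (ha' w μ ?_))
    simpa using hw1
  have hbU : U ≤ U.comap b := by
    intro x hx
    obtain ⟨n, y, hy, rfl⟩ := (hUmem x).mp hx
    refine (hUmem _).mpr ⟨n + 1, b y, hbW n (Submodule.mem_map_of_mem hy), ?_⟩
    rw [← Module.End.mul_apply, hab.eq, Module.End.mul_apply]
  have haV : ∀ v ∈ V, a v ∈ U := fun v hv => (hUmem _).mpr ⟨0, Submodule.mem_map_of_mem hv⟩
  let b' : Module.End K (A ⧸ U) := U.mapQ U b hbU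
  -- Modulo U the image of V is nonzero and stable under b, so the transpose of b has an eigenvector
  -- on its dual.
  let V' : Submodule K (A ⧸ U) := V.map U.mkQ
  have hb'V : ∀ x ∈ V', b' x ∈ V' := by
    rintro _ ⟨v, hv, rfl⟩
    obtain ⟨w, hw, v', hv', h⟩ := Submodule.mem_sup.mp (hV (Submodule.mem_map_of_mem hv))
    refine ⟨v', hv', ?_⟩
    obtain ⟨w, hw, rfl⟩ := hw
    change U.mkQ v' = U.mkQ (b v)
    rw [← h, map_add, (Submodule.Quotient.mk_eq_zero U).mpr (haV w hw) |> fun h =>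
      (show U.mkQ (a w) = 0 from h), zero_add]
  have : Nontrivial V' := by
    rw [Submodule.nontrivial_iff_ne_bot]
    intro hbot
    refine hVU fun v hv => ?_
    have : U.mkQ v ∈ V' := Submodule.mem_map_of_mem hv
    rw [hbot, Submodule.mem_bot] at this
    exact (Submodule.Quotient.mk_eq_zero U).mp this
  obtain ⟨β, hβ⟩ := Module.End.exists_eigenvalue
    (LinearMap.dualMap (b'.restrict hb'V) : Module.End K (Module.Dual K V'))
  obtain ⟨f', hf'⟩ := hβ.exists_hasEigenvector
  have hf1 := hf'.apply_eq_smul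
  obtain ⟨g, hg⟩ := LinearMap.exists_extend f'
  refine ⟨g.comp U.mkQ, β, ?_, ?_, ?_⟩
  · intro v hv
    rw [LinearMap.comp_apply, show U.mkQ (a v) = 0 from
      (Submodule.Quotient.mk_eq_zero U).mpr (haV v hv), map_zero]
  · intro v hv
    have hmem : U.mkQ v ∈ V' := Submodule.mem_map_of_mem hv
    have h1 := LinearMap.congr_fun hf1 ⟨U.mkQ v, hmem⟩
    have h2 := LinearMap.congr_fun hg (b'.restrict hb'V ⟨U.mkQ v, hmem⟩)
    have h3 := LinearMap.congr_fun hg ⟨U.mkQ v, hmem⟩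
    simp only [LinearMap.dualMap_apply, LinearMap.smul_apply, smul_eq_mul] at h1
    rw [← h2, ← h3] at h1
    exact h1
  · by_contra! hall
    refine hf'.2 (LinearMap.ext fun x => ?_)
    obtain ⟨_, v, hv, rfl⟩ := x
    rw [← hg]
    exact hall v hv

end Operators

end

/-! ### Characterizations of the types, and their invariance under isomorphism. -/

noncomputable section

namespace ElementType

open TensorProduct

section Characterizations

variable {K : Type*} [Field K] {A : Type*} [Ring A] [Algebra K A]

theorem ad_pow_eq_smul {z x : A} {c : K} (h : ad K z x = c • x) (m : ℕ) :
    (ad K z ^ m) x = c ^ m • x := by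
  induction m with
  | zero => simp
  | succ m ih => rw [pow_succ, Module.End.mul_apply, h, map_smul, ih, smul_smul, pow_succ']

theorem zero_mem_Ev [Nontrivial A] (z : A) : (0 : K) ∈ Ev K z :=
  ⟨1, one_ne_zero, by simp [ad_apply]⟩

theorem Ev_eq_singleton_iff [Nontrivial A] {z : A} :
    Ev K z = {0} ↔ ∀ (x : A) (c : K), x ≠ 0 → ad K z x = c • x → c = 0 := by
  rw [Set.eq_singleton_iff_unique_mem]
  exact ⟨fun h x c hx hc => h.2 c ⟨x, hx, hc⟩,
    fun h => ⟨zero_mem_Ev z, fun c ⟨x, hx, hc⟩ => h x c hx hc⟩⟩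

theorem isNilpotentType_iff {z : A} :
    IsNilpotentType K z ↔ Ev K z = {0} ∧ ∃ x ∈ N K z, ad K z x ≠ 0 := by
  have key : (C K z : Set A) ⊂ N K z ↔ ∃ x ∈ N K z, ad K z x ≠ 0 := by
    rw [Set.ssubset_iff_of_subset (C_le_N z)]
    simp only [SetLike.mem_coe, mem_C_iff, ne_eq]
  rw [← key]
  constructor
  · rintro (h | h)
    · exact ⟨h.1, h.2.1⟩
    · exact ⟨h.1, h.2.1⟩
  · rintro ⟨h1, h2⟩
    by_cases h : N K z = Set.univ
    · exact Or.inl ⟨h1, h2, h⟩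
    · exact Or.inr ⟨h1, h2, Set.ssubset_univ_iff.mpr h⟩

/-- If `ad z` is locally nilpotent, a nonzero eigenvalue c is impossible because c^m x never
vanishes. -/
theorem isStrictlyNilpotent_iff [Nontrivial A] {z : A} :
    IsStrictlyNilpotent K z ↔ (∀ x, x ∈ N K z) ∧ ∃ x, ad K z x ≠ 0 := by
  constructor
  · intro h
    obtain ⟨x, -, hx⟩ := (isNilpotentType_iff.mp (Or.inl h)).2
    exact ⟨Set.eq_univ_iff_forall.mp h.2.2, x, hx⟩
  · rintro ⟨h1, x, hx⟩
    refine ⟨Ev_eq_singleton_iff.mpr fun y c hy hc => ?_, ?_, Set.eq_univ_iff_forall.mpr h1⟩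
    · obtain ⟨m, hm⟩ := h1 y
      rw [ad_pow_eq_smul hc, smul_eq_zero_iff_left hy] at hm
      exact eq_zero_of_pow_eq_zero hm
    · rw [Set.ssubset_iff_of_subset (C_le_N z)]
      exact ⟨x, h1 x, fun h => hx ((mem_C_iff K z x).mp h)⟩

/-- `ad z` acts on the finite-dimensional space K[ad z] x with 0 as its only eigenvalue, hence
nilpotently. -/
theorem mem_N_of_mem_F [IsAlgClosed K] [Nontrivial A] {z x : A} (hz : Ev K z = {0})
    (hx : x ∈ F K z) : x ∈ N K z := by
  let M := Submodule.span K (Set.range fun m : ℕ => (ad K z ^ m) x)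
  have hfin : FiniteDimensional K M := hx
  have hM : ∀ y ∈ M, ad K z y ∈ M := by
    intro y hy
    have hle : M ≤ M.comap (ad K z) := by
      rw [Submodule.span_le]
      rintro _ ⟨m, rfl⟩
      exact Submodule.subset_span ⟨m + 1, by simp [pow_succ']⟩
    exact hle hy
  obtain ⟨r, hr⟩ := exists_sub_smul_pow_eq_zero (φ := (ad K z).restrict hM) (c := 0)
    (fun w μ hw h => Ev_eq_singleton_iff.mp hz w μ (by simpa using hw)
      (by simpa using congrArg Subtype.val h))
    (⟨x, Submodule.subset_span ⟨0, rfl⟩⟩ : M)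
  rw [zero_smul, sub_zero (G := Module.End K M), Module.End.pow_restrict] at hr
  exact ⟨r, congrArg Subtype.val hr⟩

theorem mem_F_of_ad_eq_zero {z x : A} (hx : ad K z x = 0) : x ∈ F K z := by
  refine Submodule.finiteDimensional_of_le (S₂ := Submodule.span K {x}) ?_
  rw [Submodule.span_le]
  rintro _ ⟨m, rfl⟩
  change (ad K z ^ m) x ∈ _
  rw [ad_pow_eq_smul (c := 0) (by rw [hx, zero_smul])]
  exact Submodule.smul_mem _ _ (Submodule.mem_span_singleton_self x)

theorem IsOmegaZero'.of_forall [IsAlgClosed K] [Nontrivial A] {z : A} (hz : Ev K z = {0})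
    (h1 : ∀ x ∈ N K z, ad K z x = 0) (h2 : ∃ x, ad K z x ≠ 0) : IsOmegaZero' K z := by
  have h3 : ∀ x ∈ F K z, ad K z x = 0 := fun x hx => h1 x (mem_N_of_mem_F hz hx)
  obtain ⟨x, hx⟩ := h2
  refine ⟨hz, Set.ext fun y => ?_, Set.ssubset_univ_iff.mpr fun h => hx (h3 x (h ▸ trivial))⟩
  rw [SetLike.mem_coe, mem_C_iff]
  exact ⟨mem_F_of_ad_eq_zero, h3 y⟩

end Characterizations

section AlgEquiv

variable {K : Type*} [Field K] {A B : Type*} [Ring A] [Algebra K A] [Ring B] [Algebra K B]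
  (e : A ≃ₐ[K] B) (z : A)

theorem ad_map (x : A) : ad K (e z) (e x) = e (ad K z x) := by
  simp [ad_apply]

theorem ad_pow_map (x : A) (m : ℕ) : (ad K (e z) ^ m) (e x) = e ((ad K z ^ m) x) := by
  induction m with
  | zero => rfl
  | succ m ih => rw [pow_succ', Module.End.mul_apply, ih, ad_map, pow_succ', Module.End.mul_apply]

theorem map_mem_N_iff (x : A) : e x ∈ N K (e z) ↔ x ∈ N K z := by
  refine exists_congr fun m => ?_
  rw [ad_pow_map, EmbeddingLike.map_eq_zero_iff]

theorem map_mem_C_iff (x : A) : e x ∈ C K (e z) ↔ x ∈ C K z := by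
  rw [mem_C_iff, mem_C_iff, ad_map, EmbeddingLike.map_eq_zero_iff]

theorem Ev_map : Ev K (e z) = Ev K z := by
  ext c
  refine e.surjective.exists.trans (exists_congr fun x => ?_)
  rw [ad_map, ← map_smul, e.injective.eq_iff, ne_eq, EmbeddingLike.map_eq_zero_iff]

theorem C_map : C K (e z) = (C K z).map e.toAlgHom := by
  ext x
  obtain ⟨x, rfl⟩ := e.surjective x
  rw [map_mem_C_iff]
  constructor
  · exact fun h => ⟨x, h, rfl⟩
  · rintro ⟨y, hy, h⟩
    exact e.injective h ▸ hy

theorem isNilpotentType_map_iff : IsNilpotentType K (e z) ↔ IsNilpotentType K z := by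
  rw [isNilpotentType_iff, isNilpotentType_iff, Ev_map, e.surjective.exists]
  simp only [map_mem_N_iff, ad_map, ne_eq, EmbeddingLike.map_eq_zero_iff]

theorem isStrictlyNilpotent_map_iff [Nontrivial A] [Nontrivial B] :
    IsStrictlyNilpotent K (e z) ↔ IsStrictlyNilpotent K z := by
  rw [isStrictlyNilpotent_iff, isStrictlyNilpotent_iff, e.surjective.exists, e.surjective.forall]
  simp only [map_mem_N_iff, ad_map, ne_eq, EmbeddingLike.map_eq_zero_iff]

end AlgEquiv

/-! ### The operator `ad (z₁ ⊗ z₂)` on a tensor product of algebras. -/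

section Tensor

variable {K : Type*} [Field K] {A B : Type*} [Ring A] [Algebra K A] [Ring B] [Algebra K B]

theorem ad_tmul (z₁ : A) (z₂ : B) : ad K (z₁ ⊗ₜ[K] z₂) =
    TensorProduct.map (LinearMap.mulLeft K z₁) (LinearMap.mulLeft K z₂) -
      TensorProduct.map (LinearMap.mulRight K z₁) (LinearMap.mulRight K z₂) := by
  refine TensorProduct.ext' fun a b => ?_
  simp [ad_apply]

theorem ad_tmul_eq_add (z₁ : A) (z₂ : B) : ad K (z₁ ⊗ₜ[K] z₂) =
    TensorProduct.map (ad K z₁) (LinearMap.mulLeft K z₂) +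
      TensorProduct.map (LinearMap.mulRight K z₁) (ad K z₂) := by
  refine TensorProduct.ext' fun a b => ?_
  simp [ad_apply, TensorProduct.sub_tmul, TensorProduct.tmul_sub]

theorem slice_ad_tmul (z₁ : A) (z₂ : B) (g : B →ₗ[K] K) (u : A ⊗[K] B) :
    slice g (ad K (z₁ ⊗ₜ[K] z₂) u) = z₁ * slice (g.comp (LinearMap.mulLeft K z₂)) u -
      slice (g.comp (LinearMap.mulRight K z₂)) u * z₁ := by
  rw [ad_tmul, LinearMap.sub_apply, map_sub, slice_map, slice_map]
  rfl

theorem comm_mem_N_iff (z₁ : A) (z₂ : B) (u : A ⊗[K] B) :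
    TensorProduct.comm K A B u ∈ N K (z₂ ⊗ₜ[K] z₁) ↔ u ∈ N K (z₁ ⊗ₜ[K] z₂) :=
  map_mem_N_iff (Algebra.TensorProduct.comm K A B) (z₁ ⊗ₜ[K] z₂) u

theorem comm_mem_C_iff (z₁ : A) (z₂ : B) (u : A ⊗[K] B) :
    TensorProduct.comm K A B u ∈ C K (z₂ ⊗ₜ[K] z₁) ↔ u ∈ C K (z₁ ⊗ₜ[K] z₂) :=
  map_mem_C_iff (Algebra.TensorProduct.comm K A B) (z₁ ⊗ₜ[K] z₂) u

theorem isNilpotentType_tmul_comm (z₁ : A) (z₂ : B) :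
    IsNilpotentType K (z₂ ⊗ₜ[K] z₁) ↔ IsNilpotentType K (z₁ ⊗ₜ[K] z₂) := by
  have := isNilpotentType_map_iff (Algebra.TensorProduct.comm K A B) (z₁ ⊗ₜ[K] z₂)
  rwa [Algebra.TensorProduct.comm_tmul] at this

theorem isStrictlyNilpotent_tmul_comm [Nontrivial (A ⊗[K] B)] [Nontrivial (B ⊗[K] A)] (z₁ : A)
    (z₂ : B) : IsStrictlyNilpotent K (z₂ ⊗ₜ[K] z₁) ↔ IsStrictlyNilpotent K (z₁ ⊗ₜ[K] z₂) := by
  have := isStrictlyNilpotent_map_iff (Algebra.TensorProduct.comm K A B) (z₁ ⊗ₜ[K] z₂)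
  rwa [Algebra.TensorProduct.comm_tmul] at this

theorem comm_comm_apply (u : A ⊗[K] B) :
    TensorProduct.comm K B A (TensorProduct.comm K A B u) = u :=
  (TensorProduct.comm K A B).symm_apply_apply u

theorem exists_functional_apply_eq_one {a : A} (ha : a ≠ 0) : ∃ f : A →ₗ[K] K, f a = 1 := by
  obtain ⟨f, hf⟩ : ∃ f : A →ₗ[K] K, f a ≠ 0 := by
    by_contra! h
    exact ha ((Module.forall_dual_apply_eq_zero_iff K a).mp h)
  exact ⟨(f a)⁻¹ • f, by simp [hf]⟩

theorem exists_comp_eq_of_injective {d : Module.End K B} (hd : Function.Injective d)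
    (g : B →ₗ[K] K) : ∃ h : B →ₗ[K] K, h.comp d = g :=
  LinearMap.dualMap_surjective_of_injective hd g

theorem slices_ne_bot {u : A ⊗[K] B} (hu : u ≠ 0) : slices u ≠ ⊥ := fun h =>
  hu (eq_zero_of_forall_slice_eq_zero fun g =>
    (Submodule.mem_bot K).mp (h ▸ slice_mem_slices g u))

theorem commute_mulLeft_mulRight (a b : A) :
    Commute (LinearMap.mulLeft K a) (LinearMap.mulRight K b) :=
  LinearMap.ext fun x => (mul_assoc a x b).symm

/-- The slices of u satisfy b V ⊆ a V + V. The functional f from `exists_functional_of_map_le_sup`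
reduces the equation to one in B, where z₂ would be scalar unless β = 0, and then c = 0. -/
theorem eq_zero_of_ad_tmul_eq_smul [IsAlgClosed K] [IsDomain A] [IsDomain B] {z₁ : A} {z₂ : B}
    (hz₁ : z₁ ∉ Set.range (algebraMap K A)) (hz₂ : z₂ ∉ Set.range (algebraMap K B))
    {u : A ⊗[K] B} {c : K} (hu : u ≠ 0) (h : ad K (z₁ ⊗ₜ[K] z₂) u = c • u) : c = 0 := by
  have h0₁ : z₁ ≠ 0 := fun h => hz₁ ⟨0, by rw [h, map_zero]⟩
  have h0₂ : z₂ ≠ 0 := fun h => hz₂ ⟨0, by rw [h, map_zero]⟩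
  have hs : ∀ g : B →ₗ[K] K, slice (g.comp (LinearMap.mulRight K z₂)) u * z₁ =
      z₁ * slice (g.comp (LinearMap.mulLeft K z₂)) u - c • slice g u := by
    intro g
    rw [← map_smul, ← h, slice_ad_tmul, sub_sub_cancel]
  obtain ⟨f, β, hf1, hf2, v, hv, hfv⟩ := exists_functional_of_map_le_sup
    (commute_mulLeft_mulRight (K := K) z₁ z₁) (mul_right_injective₀ h0₁)
    (fun v μ hv => by
      by_contra hne
      refine hz₁ ⟨μ, mul_right_cancel₀ hne ?_⟩
      rw [← Algebra.smul_def, ← hv, LinearMap.mulLeft_apply]) (slices_ne_bot hu) (by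
      rintro _ ⟨_, ⟨g, rfl⟩, rfl⟩
      obtain ⟨g, rfl⟩ := exists_comp_eq_of_injective
        (d := LinearMap.mulRight K z₂) (mul_left_injective₀ h0₂) g
      change slice (g.comp (LinearMap.mulRight K z₂)) u * z₁ ∈ _
      rw [hs]
      exact sub_mem (Submodule.mem_sup_left ⟨_, slice_mem_slices _ u, rfl⟩)
        (Submodule.mem_sup_right (Submodule.smul_mem _ _ (slice_mem_slices g u))))
  -- Apply f to the sliced equation: the a-term dies, and the b-term becomes multiplication by β.
  have key : slice f (TensorProduct.comm K A B u) * (β • z₂ + c • 1) = 0 := by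
    refine eq_of_forall_functional_eq (K := K) fun g => ?_
    have h1 := congrArg f (hs g)
    have h2 := hf1 _ (slice_mem_slices (g.comp (LinearMap.mulLeft K z₂)) u)
    have h3 := hf2 _ (slice_mem_slices (g.comp (LinearMap.mulRight K z₂)) u)
    rw [LinearMap.mulLeft_apply] at h2
    rw [LinearMap.mulRight_apply, h1, map_sub, h2, map_smul, ← apply_slice_comm f g u,
      ← apply_slice_comm f (g.comp _) u, LinearMap.comp_apply, LinearMap.mulRight_apply] at h3
    rw [mul_add, mul_smul_comm, mul_smul_comm, mul_one, map_add, map_smul, map_smul, map_zero,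
      smul_eq_mul, ← h3, zero_sub, neg_add_cancel]
  have hy : slice f (TensorProduct.comm K A B u) ≠ 0 := by
    obtain ⟨g, rfl⟩ := hv
    intro h
    change f (slice g u) ≠ 0 at hfv
    rw [← apply_slice_comm, h, map_zero] at hfv
    exact hfv rfl
  have h2 := (mul_eq_zero.mp key).resolve_left hy
  by_cases hβ : β = 0
  · rw [hβ, zero_smul, zero_add, smul_eq_zero_iff_left one_ne_zero] at h2
    exact h2
  · refine absurd ⟨β⁻¹ * -c, ?_⟩ hz₂
    rw [Algebra.algebraMap_eq_smul_one, mul_smul, neg_smul, ← eq_neg_of_add_eq_zero_left h2,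
      inv_smul_smul₀ hβ]

/-- With V the space of slices, expanding (R ⊗ R - L ⊗ L)^(m+1) u = 0 gives b^(m+1) V ⊆ a H m, hence
b (H m) ⊆ a (H m), and `exists_sub_pow_eq_zero` applies. -/
theorem slice_mem_N [IsAlgClosed K] [IsDomain A] [IsDomain B] {z₁ : A} {z₂ : B}
    (hz₁ : z₁ ≠ 0) (hz₂ : z₂ ≠ 0)
    (h1 : ∀ (v : A) (μ : K), v ≠ 0 → v * z₁ = μ • (z₁ * v) → μ = 1)
    {u : A ⊗[K] B} (hu : u ∈ N K (z₁ ⊗ₜ[K] z₂)) (g : B →ₗ[K] K) : slice g u ∈ N K z₁ := by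
  obtain ⟨m, hm⟩ := hu
  replace hm := ad_pow_eq_zero_of_le hm m.le_succ
  set a : Module.End K A := LinearMap.mulLeft K z₁ with ha
  set b : Module.End K A := LinearMap.mulRight K z₁ with hb
  have hab : Commute a b := commute_mulLeft_mulRight z₁ z₁
  have hinj : Function.Injective a := mul_right_injective₀ hz₁
  -- H k is the sum of the spaces aⁱ bʲ V with i + j = k.
  let H : ℕ → Submodule K A := fun n =>
    Nat.rec (motive := fun _ => Submodule K A) (slices u)
      (fun k H => H.map a ⊔ (slices u).map (b ^ (k + 1))) n
  have hH0 : H 0 = slices u := rfl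
  have hHs : ∀ k, H (k + 1) = (H k).map a ⊔ (slices u).map (b ^ (k + 1)) := fun _ => rfl
  have hHf : ∀ k, FiniteDimensional K ↥(H k) := by
    intro k
    induction k with
    | zero => rw [hH0]; infer_instance
    | succ k ih => rw [hHs]; infer_instance
  have hbH : ∀ k, (H k).map b ≤ H (k + 1) := by
    intro k
    induction k with
    | zero => rw [hHs, hH0, zero_add, pow_one]; exact le_sup_right
    | succ k ih =>
      have hpow : ((slices u).map (b ^ (k + 1))).map b = (slices u).map (b ^ (k + 1 + 1)) := by
        rw [pow_succ' b (k + 1), Module.End.mul_eq_comp, Submodule.map_comp]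
      rw [hHs k, Submodule.map_sup, hpow, ← Submodule.map_comp, ← Module.End.mul_eq_comp, ← hab.eq,
        Module.End.mul_eq_comp, Submodule.map_comp, hHs (k + 1)]
      exact sup_le_sup_right (Submodule.map_mono ih) _
  have haH : ∀ k, ∀ v ∈ slices u, (a ^ k) v ∈ H k := by
    intro k v hv
    induction k with
    | zero => exact hv
    | succ k ih =>
      rw [hHs, pow_succ' a, Module.End.mul_apply]
      exact Submodule.mem_sup_left (Submodule.mem_map_of_mem ih)
  -- Modulo a(H k), only the pure power of b survives in the expansion.
  have hform : ∀ k (g : B →ₗ[K] K),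
      (b ^ (k + 1)) (slice (g.comp (LinearMap.mulRight K z₂ ^ (k + 1))) u) -
        slice g (((-ad K (z₁ ⊗ₜ[K] z₂)) ^ (k + 1)) u) ∈ (H k).map a := by
    intro k
    have hstep : ∀ (g : B →ₗ[K] K) (w : A ⊗[K] B), slice g ((-ad K (z₁ ⊗ₜ[K] z₂)) w) =
        b (slice (g.comp (LinearMap.mulRight K z₂)) w) -
          a (slice (g.comp (LinearMap.mulLeft K z₂)) w) := by
      intro g w
      rw [LinearMap.neg_apply, map_neg, slice_ad_tmul, neg_sub]
      rfl
    induction k with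
    | zero =>
      intro g
      rw [zero_add, pow_one, pow_one, pow_one, hstep, sub_sub_cancel]
      exact Submodule.mem_map_of_mem (slice_mem_slices _ u)
    | succ k ih =>
      intro g
      have h2 := ih (g.comp (LinearMap.mulRight K z₂))
      have h3 := ih (g.comp (LinearMap.mulLeft K z₂))
      obtain ⟨y, hy, hy'⟩ := h2
      rw [LinearMap.comp_assoc, ← Module.End.mul_eq_comp, ← pow_succ'] at hy'
      rw [pow_succ' (-ad K (z₁ ⊗ₜ[K] z₂)), Module.End.mul_apply, hstep, pow_succ' b,
        Module.End.mul_apply, ← sub_add, ← map_sub, ← hy', ← Module.End.mul_apply, ← hab.eq,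
        Module.End.mul_apply, ← map_add]
      refine Submodule.mem_map_of_mem (add_mem (hbH k (Submodule.mem_map_of_mem hy)) ?_)
      rw [hHs]
      refine (Submodule.sub_mem_iff_right _ (Submodule.mem_sup_right
        (Submodule.mem_map_of_mem (slice_mem_slices _ u)))).mp (Submodule.mem_sup_left h3)
  have hdinj : Function.Injective (LinearMap.mulRight K z₂ ^ (m + 1)) := by
    rw [Module.End.coe_pow]
    exact Function.Injective.iterate (mul_left_injective₀ hz₂) _
  have hle : (H m).map b ≤ (H m).map a := by
    refine (hbH m).trans ?_
    rw [hHs]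
    refine sup_le le_rfl ?_
    rintro _ ⟨_, ⟨g, rfl⟩, rfl⟩
    obtain ⟨g, rfl⟩ := exists_comp_eq_of_injective hdinj g
    have hT : ((-ad K (z₁ ⊗ₜ[K] z₂)) ^ (m + 1)) u = 0 := by
      rw [neg_pow (ad K (z₁ ⊗ₜ[K] z₂) : Module.End K (A ⊗[K] B)), Module.End.mul_apply, hm,
        map_zero]
    have := hform m g
    rwa [hT, map_zero, sub_zero] at this
  obtain ⟨r, hr⟩ := exists_sub_pow_eq_zero hab hinj h1 hle (haH m _ (slice_mem_slices g u))
  refine ⟨r, ?_⟩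
  -- H m contains a^m of the slice rather than the slice itself; a^m is injective and commutes with
  -- a - b, so it cancels.
  have hc : Commute ((a - b) ^ r) (a ^ m) :=
    (((Commute.refl a).sub_left hab.symm).pow_pow r m)
  rw [← Module.End.mul_apply, hc.eq, Module.End.mul_apply] at hr
  have hinj' : Function.Injective (a ^ m) := by
    rw [Module.End.coe_pow]
    exact hinj.iterate m
  exact hinj' (by rw [map_zero]; exact hr)

/-- `ad (z₁ ⊗ z₂)` is a sum of two commuting operators, each nilpotent on x ⊗ y, so the binomial
formula applies. -/
theorem tmul_mem_N {z₁ x : A} {z₂ y : B} (hx : x ∈ N K z₁) (hy : y ∈ N K z₂) :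
    x ⊗ₜ[K] y ∈ N K (z₁ ⊗ₜ[K] z₂) := by
  obtain ⟨m, hm⟩ := hx
  obtain ⟨n, hn⟩ := hy
  have hcomm : Commute (TensorProduct.map (ad K z₁) (LinearMap.mulLeft K z₂))
      (TensorProduct.map (LinearMap.mulRight K z₁) (ad K z₂)) := by
    refine TensorProduct.ext' fun a b => ?_
    simp [ad_apply, mul_sub, sub_mul, mul_assoc]
  refine ⟨m + n, ?_⟩
  rw [ad_tmul_eq_add, hcomm.add_pow, LinearMap.sum_apply]
  refine Finset.sum_eq_zero fun i _ => ?_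
  rw [← nsmul_eq_mul', LinearMap.smul_apply]
  rcases le_total m i with h | h
  · rw [(hcomm.pow_pow _ _).eq, Module.End.mul_apply, TensorProduct.map_pow (ad K z₁),
      TensorProduct.map_tmul, ad_pow_eq_zero_of_le hm h, TensorProduct.zero_tmul, map_zero, smul_zero]
  · rw [Module.End.mul_apply, TensorProduct.map_pow _ (ad K z₂), TensorProduct.map_tmul,
      ad_pow_eq_zero_of_le hn (by omega), TensorProduct.tmul_zero, map_zero, smul_zero]

theorem mem_N_of_tmul_one_mem_N [IsAlgClosed K] [IsDomain A] [IsDomain B] {z₁ : A} {z₂ : B}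
    (hz₁ : z₁ ≠ 0) (hz₂ : z₂ ≠ 0)
    (h1 : ∀ (v : A) (μ : K), v ≠ 0 → v * z₁ = μ • (z₁ * v) → μ = 1) {x : A}
    (hx : x ⊗ₜ[K] (1 : B) ∈ N K (z₁ ⊗ₜ[K] z₂)) : x ∈ N K z₁ := by
  obtain ⟨g, hg⟩ := exists_functional_apply_eq_one (K := K) (one_ne_zero (α := B))
  simpa [hg] using slice_mem_N hz₁ hz₂ h1 hx g

theorem ad_tmul_one_ne_zero {z₁ x : A} {z₂ : B} (hz₂ : z₂ ≠ 0) (hx : ad K z₁ x ≠ 0) :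
    ad K (z₁ ⊗ₜ[K] z₂) (x ⊗ₜ[K] (1 : B)) ≠ 0 := by
  obtain ⟨g, hg⟩ := exists_functional_apply_eq_one (K := K) hz₂
  intro h
  have := congrArg (slice g) h
  rw [slice_ad_tmul, slice_tmul, slice_tmul, map_zero, LinearMap.comp_apply, LinearMap.comp_apply,
    LinearMap.mulLeft_apply, LinearMap.mulRight_apply, mul_one, one_mul, hg, one_smul] at this
  exact hx this

theorem tmul_mem_C {z₁ x : A} {z₂ y : B} (hx : x ∈ C K z₁) (hy : y ∈ C K z₂) :
    x ⊗ₜ[K] y ∈ C K (z₁ ⊗ₜ[K] z₂) := by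
  rw [mem_C_iff] at *
  rw [ad_tmul_eq_add, LinearMap.add_apply, TensorProduct.map_tmul, TensorProduct.map_tmul, hx, hy,
    TensorProduct.zero_tmul, TensorProduct.tmul_zero, add_zero]

theorem range_map_val_le_C (z₁ : A) (z₂ : B) :
    (Algebra.TensorProduct.map (C K z₁).val (C K z₂).val).range ≤ C K (z₁ ⊗ₜ[K] z₂) := by
  rintro _ ⟨t, rfl⟩
  induction t with
  | zero => simp
  | add s t hs ht => simpa using add_mem hs ht
  | tmul a b => exact tmul_mem_C a.2 b.2

theorem mem_range_map_val_of_slices {z₁ : A} {z₂ : B} {u : A ⊗[K] B}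
    (h1 : ∀ g, slice g u ∈ C K z₁) (h2 : ∀ f, slice f (TensorProduct.comm K A B u) ∈ C K z₂) :
    u ∈ (Algebra.TensorProduct.map (C K z₁).val (C K z₂).val).range := by
  obtain ⟨t, ht⟩ := mem_range_map_subtype (P := Subalgebra.toSubmodule (C K z₁))
    (Q := Subalgebra.toSubmodule (C K z₂)) h1 h2
  exact ⟨t, ht⟩

/-- When all slices commute with z₁, the sliced equation has z₁ as a left factor. Cancelling it
leaves commutation with z₂ in the other factor. -/
theorem slice_comm_mem_C [IsDomain A] {z₁ : A} {z₂ : B} (hz₁ : z₁ ≠ 0) {u : A ⊗[K] B}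
    (hu : u ∈ C K (z₁ ⊗ₜ[K] z₂)) (h1 : ∀ g, slice g u ∈ C K z₁) (f : A →ₗ[K] K) :
    slice f (TensorProduct.comm K A B u) ∈ C K z₂ := by
  rw [mem_C_iff] at *
  refine eq_of_forall_functional_eq (K := K) fun g => ?_
  have h2 := slice_ad_tmul z₁ z₂ g u
  have h3 := h1 (g.comp (LinearMap.mulRight K z₂))
  rw [mem_C_iff, ad_apply, sub_eq_zero] at h3
  rw [hu, map_zero, ← h3, ← mul_sub, eq_comm, mul_eq_zero, or_iff_right hz₁,
    ← slice_sub_left, ← LinearMap.comp_sub] at h2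
  rw [← LinearMap.comp_apply, apply_slice_comm, map_zero]
  change f (slice (g.comp (LinearMap.mulLeft K z₂ - LinearMap.mulRight K z₂)) u) = 0
  rw [h2, map_zero]

theorem commute_of_mem_range_map_val {P : Subalgebra K A} {Q : Subalgebra K B}
    (hP : ∀ x ∈ P, ∀ y ∈ P, x * y = y * x) (hQ : ∀ x ∈ Q, ∀ y ∈ Q, x * y = y * x)
    {u v : A ⊗[K] B} (hu : u ∈ (Algebra.TensorProduct.map P.val Q.val).range)
    (hv : v ∈ (Algebra.TensorProduct.map P.val Q.val).range) : u * v = v * u := by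
  obtain ⟨s, rfl⟩ := hu
  obtain ⟨t, rfl⟩ := hv
  change Algebra.TensorProduct.map P.val Q.val s * Algebra.TensorProduct.map P.val Q.val t =
    Algebra.TensorProduct.map P.val Q.val t * Algebra.TensorProduct.map P.val Q.val s
  induction s with
  | zero => simp
  | add s s' hs hs' => rw [map_add, add_mul, mul_add, hs, hs']
  | tmul a b =>
    induction t with
    | zero => simp
    | add t t' ht ht' => rw [map_add, add_mul, mul_add, ht, ht']
    | tmul a' b' =>
      simp [hP a a.2 a' a'.2, hQ b b.2 b' b'.2]

end Tensor

end ElementType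

end

/-! ### The four assertions for A₁ and A₂. -/

noncomputable section

namespace WeylAlgebra

open TensorProduct ElementType

variable {K : Type*} [Field K]

theorem exists_eigenvector_of_Ev_ne {z : WeylAlgebra K 1} (h : Ev K z ≠ {0}) :
    ∃ (x : WeylAlgebra K 1) (c : K), c ≠ 0 ∧ x ≠ 0 ∧ ad K z x = c • x := by
  by_contra! H
  exact h (Ev_eq_singleton_iff.mpr fun x c hx hc => by_contra fun h0 => H x c h0 hx hc)

theorem ne_zero_of_notMem_range {z : WeylAlgebra K 1}
    (hz : z ∉ Set.range (algebraMap K (WeylAlgebra K 1))) : z ≠ 0 := fun h =>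
  hz ⟨0, by rw [h, map_zero]⟩

instance : Nontrivial (WeylAlgebra K 1 ⊗[K] WeylAlgebra K 1) := by
  obtain ⟨g, hg⟩ := exists_functional_apply_eq_one (K := K) (one_ne_zero (α := WeylAlgebra K 1))
  refine ⟨1 ⊗ₜ 1, 0, fun h => ?_⟩
  have := congrArg (slice g) h
  rw [slice_tmul, hg, one_smul, map_zero] at this
  exact one_ne_zero this

instance : Nontrivial (WeylAlgebra K 2) := (tensorEquiv K).symm.toEquiv.nontrivial

variable {z₁ z₂ : WeylAlgebra K 1} [IsAlgClosed K]

theorem slice_mem_N (h₁ : z₁ ≠ 0) (h₂ : z₂ ≠ 0) {u : WeylAlgebra K 1 ⊗[K] WeylAlgebra K 1}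
    (hu : u ∈ N K (z₁ ⊗ₜ[K] z₂)) (g : WeylAlgebra K 1 →ₗ[K] K) : slice g u ∈ N K z₁ :=
  ElementType.slice_mem_N h₁ h₂ (fun _ _ hv h => eq_one_of_mul_eq_smul_mul h₁ hv h) hu g

theorem Ev_tmul (hz₁ : z₁ ∉ Set.range (algebraMap K (WeylAlgebra K 1)))
    (hz₂ : z₂ ∉ Set.range (algebraMap K (WeylAlgebra K 1))) : Ev K (z₁ ⊗ₜ[K] z₂) = {0} :=
  Ev_eq_singleton_iff.mpr fun _ _ hu h => eq_zero_of_ad_tmul_eq_smul hz₁ hz₂ hu h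

variable [CharZero K]


/-- If Ev(z) = {0}, this is the definition of nilpotency; if there is a nonzero eigenvalue, N(z) =
C(z) by the growth argument. -/
theorem not_isNilpotentType_iff {z : WeylAlgebra K 1} :
    ¬ IsNilpotentType K z ↔ ∀ x ∈ N K z, ad K z x = 0 := by
  constructor
  · intro h x hx
    by_cases hz : Ev K z = {0}
    · by_contra hne
      exact h (isNilpotentType_iff.mpr ⟨hz, x, hx, hne⟩)
    · obtain ⟨v, c, hc, hv, hzv⟩ := exists_eigenvector_of_Ev_ne hz
      exact ad_eq_zero_of_mem_N hc hv hzv hx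
  · intro h hn
    obtain ⟨-, x, hx, hne⟩ := isNilpotentType_iff.mp hn
    exact hne (h x hx)

omit [IsAlgClosed K] [CharZero K] in
theorem exists_eigenvector_of_isSemisimpleType {z : WeylAlgebra K 1} (h : IsSemisimpleType K z) :
    ∃ (x : WeylAlgebra K 1) (c : K), c ≠ 0 ∧ x ≠ 0 ∧ ad K z x = c • x :=
  exists_eigenvector_of_Ev_ne (by rcases h with h | h <;> exact h.1.ne')

theorem slice_mem_C_of_not_isNilpotentType (h₁ : z₁ ≠ 0) (h₂ : z₂ ≠ 0)
    (h : ¬ IsNilpotentType K z₁) {u : WeylAlgebra K 1 ⊗[K] WeylAlgebra K 1}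
    (hu : u ∈ N K (z₁ ⊗ₜ[K] z₂)) (g : WeylAlgebra K 1 →ₗ[K] K) : slice g u ∈ C K z₁ :=
  (mem_C_iff K _ _).mpr (not_isNilpotentType_iff.mp h _ (slice_mem_N h₁ h₂ hu g))

variable (hz₁ : z₁ ∉ Set.range (algebraMap K (WeylAlgebra K 1)))
    (hz₂ : z₂ ∉ Set.range (algebraMap K (WeylAlgebra K 1)))

include hz₁ hz₂

omit [IsAlgClosed K] in
theorem exists_ad_tmul_ne_zero : ∃ u, ad K (z₁ ⊗ₜ[K] z₂) u ≠ 0 := by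
  obtain ⟨x, hx⟩ := exists_not_commute hz₁
  exact ⟨x ⊗ₜ 1, ad_tmul_one_ne_zero (ne_zero_of_notMem_range hz₂) hx⟩

omit [CharZero K] in
theorem isNilpotentType_tmul (h : IsNilpotentType K z₁) : IsNilpotentType K (z₁ ⊗ₜ[K] z₂) := by
  obtain ⟨-, x, hx, hne⟩ := isNilpotentType_iff.mp h
  exact isNilpotentType_iff.mpr ⟨Ev_tmul hz₁ hz₂, x ⊗ₜ 1, tmul_mem_N hx ⟨1, by simp [ad_apply]⟩,
    ad_tmul_one_ne_zero (ne_zero_of_notMem_range hz₂) hne⟩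

theorem isStrictlyNilpotent_left_of_tmul (h : IsStrictlyNilpotent K (z₁ ⊗ₜ[K] z₂)) :
    IsStrictlyNilpotent K z₁ := by
  have h₁ := ne_zero_of_notMem_range hz₁
  exact isStrictlyNilpotent_iff.mpr ⟨fun x => mem_N_of_tmul_one_mem_N h₁
    (ne_zero_of_notMem_range hz₂) (fun _ _ hv h => eq_one_of_mul_eq_smul_mul h₁ hv h)
    ((isStrictlyNilpotent_iff.mp h).1 _), exists_not_commute hz₁⟩

theorem isStrictlyNilpotent_tmul_iff : IsStrictlyNilpotent K (z₁ ⊗ₜ[K] z₂) ↔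
    IsStrictlyNilpotent K z₁ ∧ IsStrictlyNilpotent K z₂ := by
  constructor
  · intro h
    exact ⟨isStrictlyNilpotent_left_of_tmul hz₁ hz₂ h, isStrictlyNilpotent_left_of_tmul hz₂ hz₁
      ((isStrictlyNilpotent_tmul_comm z₁ z₂).mpr h)⟩
  · rintro ⟨h1, h2⟩
    refine isStrictlyNilpotent_iff.mpr ⟨fun u => ?_, exists_ad_tmul_ne_zero hz₁ hz₂⟩
    -- As a generalized eigenspace, N is a subspace, so pure tensors suffice.
    rw [mem_N_iff_mem_maxGenEigenspace]
    induction u with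
    | zero => exact zero_mem _
    | add u v hu hv => exact add_mem hu hv
    | tmul a b =>
      rw [← mem_N_iff_mem_maxGenEigenspace]
      exact tmul_mem_N ((isStrictlyNilpotent_iff.mp h1).1 a) ((isStrictlyNilpotent_iff.mp h2).1 b)

/-- Slices in both directions lie in the centralizers, so N(z₁ ⊗ z₂) lies in C(z₁) ⊗ C(z₂), which
centralizes z₁ ⊗ z₂. -/
theorem isOmegaZero'_tmul (h1 : ¬ IsNilpotentType K z₁) (h2 : ¬ IsNilpotentType K z₂) :
    IsOmegaZero' K (tmul z₁ z₂) := by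
  have h₁ := ne_zero_of_notMem_range hz₁
  have h₂ := ne_zero_of_notMem_range hz₂
  refine IsOmegaZero'.of_forall ((Ev_map _ _).trans (Ev_tmul hz₁ hz₂)) ?_ ?_
  · refine (tensorEquiv K).surjective.forall.mpr fun u hu => ?_
    have hu := (map_mem_N_iff _ _ _).mp hu
    rw [tmul, ad_map, (mem_C_iff K _ _).mp (range_map_val_le_C z₁ z₂ (mem_range_map_val_of_slices
      (slice_mem_C_of_not_isNilpotentType h₁ h₂ h1 hu)
      (slice_mem_C_of_not_isNilpotentType h₂ h₁ h2 ((comm_mem_N_iff _ _ _).mpr hu)))), map_zero]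
  · obtain ⟨u, hu⟩ := exists_ad_tmul_ne_zero hz₁ hz₂
    refine ⟨tensorEquiv K u, ?_⟩
    rwa [tmul, ad_map, ne_eq, EmbeddingLike.map_eq_zero_iff]

/-- One non-nilpotent factor controls the slices in its own direction, and `slice_comm_mem_C`
carries this over to the other. -/
theorem C_tmul (h : ¬ IsNilpotentType K z₁ ∨ ¬ IsNilpotentType K z₂) : C K (z₁ ⊗ₜ[K] z₂) =
    (Algebra.TensorProduct.map (C K z₁).val (C K z₂).val).range := by
  have h₁ := ne_zero_of_notMem_range hz₁
  have h₂ := ne_zero_of_notMem_range hz₂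
  refine le_antisymm (fun u hu => ?_) (range_map_val_le_C z₁ z₂)
  rcases h with h | h
  · have h1 := slice_mem_C_of_not_isNilpotentType h₁ h₂ h (C_le_N _ hu)
    exact mem_range_map_val_of_slices h1 (slice_comm_mem_C h₁ hu h1)
  · have hu' := (comm_mem_C_iff z₁ z₂ u).mpr hu
    have h2 := slice_mem_C_of_not_isNilpotentType h₂ h₁ h (C_le_N _ hu')
    refine mem_range_map_val_of_slices (fun g => ?_) h2
    have := slice_comm_mem_C h₂ hu' h2 g
    rwa [comm_comm_apply] at this

theorem C_tmul_eq_tensorSubalgebra (h : ¬ IsNilpotentType K z₁ ∨ ¬ IsNilpotentType K z₂) :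
    C K (tmul z₁ z₂) = tensorSubalgebra (C K z₁) (C K z₂) := by
  rw [tmul, C_map, C_tmul hz₁ hz₂ h, tensorSubalgebra]

theorem commute_of_mem_C_tmul (h : ¬ IsNilpotentType K z₁ ∨ ¬ IsNilpotentType K z₂)
    {x y : WeylAlgebra K 2} (hx : x ∈ C K (tmul z₁ z₂)) (hy : y ∈ C K (tmul z₁ z₂)) :
    x * y = y * x := by
  rw [C_tmul_eq_tensorSubalgebra hz₁ hz₂ h] at hx hy
  obtain ⟨u, hu, rfl⟩ := hx
  obtain ⟨v, hv, rfl⟩ := hy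
  have := commute_of_mem_range_map_val (fun _ hx _ hy => commute_of_mem_C hz₁ hx hy)
    (fun _ hx _ hy => commute_of_mem_C hz₂ hx hy) hu hv
  change tensorEquiv K u * tensorEquiv K v = tensorEquiv K v * tensorEquiv K u
  rw [← map_mul, ← map_mul, this]

end WeylAlgebra

end

theorem corollary5 {K : Type*} [Field K] [IsAlgClosed K] [CharZero K]
    (z₁ z₂ : WeylAlgebra K 1)
    (hz₁ : z₁ ∉ Set.range (algebraMap K (WeylAlgebra K 1)))
    (hz₂ : z₂ ∉ Set.range (algebraMap K (WeylAlgebra K 1))) :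
    ((ElementType.IsNilpotentType K z₁ ∨ ElementType.IsNilpotentType K z₂) →
      ElementType.IsNilpotentType K (WeylAlgebra.tmul z₁ z₂) ∧
      (ElementType.IsStrictlyNilpotent K (WeylAlgebra.tmul z₁ z₂) ↔
        ElementType.IsStrictlyNilpotent K z₁ ∧ ElementType.IsStrictlyNilpotent K z₂)) ∧
    ((¬ ElementType.IsNilpotentType K z₁ ∧ ¬ ElementType.IsNilpotentType K z₂) →
      ElementType.IsOmegaZero' K (WeylAlgebra.tmul z₁ z₂)) ∧
    ((¬ ElementType.IsNilpotentType K z₁ ∨ ¬ ElementType.IsNilpotentType K z₂) →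
      ElementType.C K (WeylAlgebra.tmul z₁ z₂) =
        WeylAlgebra.tensorSubalgebra (ElementType.C K z₁) (ElementType.C K z₂) ∧
      ∀ x ∈ ElementType.C K (WeylAlgebra.tmul z₁ z₂),
        ∀ y ∈ ElementType.C K (WeylAlgebra.tmul z₁ z₂), x * y = y * x) ∧
    ((ElementType.IsSemisimpleType K z₁ ∧ ElementType.IsSemisimpleType K z₂) →
      ElementType.C K (WeylAlgebra.tmul z₁ z₂) =
        WeylAlgebra.tensorSubalgebra (Algebra.adjoin K {z₁}) (Algebra.adjoin K {z₂})) := by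
  refine ⟨fun h => ⟨?_, ?_⟩, fun h => WeylAlgebra.isOmegaZero'_tmul hz₁ hz₂ h.1 h.2, fun h =>
    ⟨WeylAlgebra.C_tmul_eq_tensorSubalgebra hz₁ hz₂ h, fun x hx y hy =>
      WeylAlgebra.commute_of_mem_C_tmul hz₁ hz₂ h hx hy⟩, ?_⟩
  · rw [WeylAlgebra.tmul, ElementType.isNilpotentType_map_iff]
    rcases h with h | h
    · exact WeylAlgebra.isNilpotentType_tmul hz₁ hz₂ h
    · exact (ElementType.isNilpotentType_tmul_comm _ _).mp
        (WeylAlgebra.isNilpotentType_tmul hz₂ hz₁ h)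
  · rw [WeylAlgebra.tmul, ElementType.isStrictlyNilpotent_map_iff,
      WeylAlgebra.isStrictlyNilpotent_tmul_iff hz₁ hz₂]
  · rintro ⟨h1, h2⟩
    obtain ⟨x, c, hc, hx, hzx⟩ := WeylAlgebra.exists_eigenvector_of_isSemisimpleType h1
    obtain ⟨y, d, hd, hy, hzy⟩ := WeylAlgebra.exists_eigenvector_of_isSemisimpleType h2
    -- A nonzero eigenvalue excludes nilpotency, so the description of the centralizer applies.
    have hn : ¬ ElementType.IsNilpotentType K z₁ := WeylAlgebra.not_isNilpotentType_iff.mpr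
      fun _ h => WeylAlgebra.ad_eq_zero_of_mem_N hc hx hzx h
    rw [WeylAlgebra.C_tmul_eq_tensorSubalgebra hz₁ hz₂ (Or.inl hn),
      WeylAlgebra.centralizer_eq_adjoin_of_eigenvector hc hx hzx,
      WeylAlgebra.centralizer_eq_adjoin_of_eigenvector hd hy hzy]
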